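/- Let $S$ be a separated noetherian scheme, let $\mathrm{Sm}_S$ be the category of smooth $S$-schemes of finite presentation, and let $\mathrm{sPre}(\mathrm{Sm}_S)$ be the category of simplicial presheaves on $\mathrm{Sm}_S$ (functors $\mathrm{Sm}_S^{\mathrm{op}}\to\mathrm{sSets}$) with its projective model structure (weak equivalences and fibrations are objectwise). Call $Y\in\mathrm{sPre}(\mathrm{Sm}_S)$ $\mathbb{A}^1$-invariant if the projection induces a weak equivalence $Y(U)\to Y(U\times_S\mathbb{A}^1_S)$ of simplicial sets for every $U\in\mathrm{Sm}_S$. Let $\Delta^\bullet$ be the cosimplicial smooth $S$-scheme with $\Delta^n = S\times\operatorname{Spec}\mathbb{Z}[x_0,\dots,x_n]/(x_0+\dots+x_n-1)$, whose cofaces $\partial_j$ insert the coordinate $x_j=0$ and whose codegeneracies $\sigma_i$ add the $i$-th and $(i+1)$-st coordinates. For a simplicial presheaf $X$ let $\mathrm{Sing}^{\mathbb{A}^1}X=|X(-\times_S\Delta^\bullet)|$, where $|\cdot|$ is the geometric realization (diagonal) of a simplicial object in simplicial sets, so that $(\mathrm{Sing}^{\mathbb{A}^1}X)(U)_n=X(U\times_S\Delta^n)_n$,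 and let $g:X\to\mathrm{Sing}^{\mathbb{A}^1}X$ be the natural map induced by the projections $U\times_S\Delta^n\to U$. Then, for every simplicial presheaf $X$ on $\mathrm{Sm}_S$: 1. $\mathrm{Sing}^{\mathbb{A}^1}X$ is $\mathbb{A}^1$-invariant; 2. for every $\mathbb{A}^1$-invariant simplicial presheaf $Y$, the map $g$ induces a weak equivalence $\mathrm{map}(\mathrm{Sing}^{\mathbb{A}^1}X,Y)\to\mathrm{map}(X,Y)$ of (derived) mapping spaces. That is: one can choose projectively cofibrant $QX$, $QZ$ with objectwise weak equivalences $QX\to X$ and $QZ\to\mathrm{Sing}^{\mathbb{A}^1}X$, a map $Qg:QX\to QZ$ lifting $g$, and an objectwise weak equivalence $Y\to RY$ with $RY$ objectwise a Kan complex; and for every such choice the map $Qg^*:\mathrm{map}(QZ,RY)\to\mathrm{map}(QX,RY)$ of simplicial mapping spaces, where $\mathrm{map}(F,G)_n=\mathrm{Hom}(F\times\Delta[n],G)$ and $\Delta[n]$ is the constant presheaf on the standard simplicial $n$-simplex, is a weak equivalence of simplicial sets. -/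

import Mathlib

open CategoryTheory Limits Opposite AlgebraicGeometry MonoidalCategory Simplicial

universe w v u

noncomputable section

namespace MotivicSing

/-! ### Homotopy theory of simplicial sets -/

/-- The set `[X, K]` of simplicial homotopy classes of maps, i.e. the quotient of `X ⟶ K` by the
equivalence relation generated by simplicial homotopies `X ⊗ Δ[1] ⟶ K`
(i.e. `π₀` of the simplicial mapping space from `X` to `K`). -/
def HomotopyClasses (X K : SSet.{w}) : Type w :=
  Quot fun f g : X ⟶ K => Nonempty (SSet.Homotopy f g)

/-- Precomposition with `f` on homotopy classes of maps into `K`. -/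
def HomotopyClasses.precomp {X Y : SSet.{w}} (f : X ⟶ Y) (K : SSet.{w}) :
    HomotopyClasses Y K → HomotopyClasses X K :=
  Quot.lift (fun g => Quot.mk _ (f ≫ g)) (by
    rintro g g' ⟨H⟩
    exact Quot.sound ⟨SSet.RelativeMorphism.Homotopy.mk (f ▷ Δ[1] ≫ H.h)
      (congrArg (f ≫ ·) H.h₀) (congrArg (f ≫ ·) H.h₁)
      (by ext n ⟨⟨x, hx⟩, y⟩; exact hx.elim)⟩)

/-- Weak homotopy equivalences of simplicial sets: the maps `f : X ⟶ Y` such that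
`f* : [Y, K] → [X, K]` is bijective for all Kan complexes `K` (equivalently, the geometric
realization of `f` is a weak homotopy equivalence). -/
def weakEquiv : MorphismProperty SSet.{w} := fun _ _ f =>
  ∀ (K : SSet.{w}) [SSet.KanComplex K], Function.Bijective (HomotopyClasses.precomp f K)

/-- Kan fibrations. -/
def kanFibration : MorphismProperty SSet.{w} := SSet.modelCategoryQuillen.J.rlp

/-- The geometric realization of a simplicial object in simplicial sets, i.e. the diagonal
of the corresponding bisimplicial set. -/
def realization : SimplicialObject SSet.{w} ⥤ SSet.{w} where
  obj K :=
    { obj := fun n => (K.obj n).obj n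
      map := fun {m n} θ => (K.map θ).app m ≫ (K.obj n).map θ
      map_id := fun n => by simp
      map_comp := fun f g => by simp }
  map {K L} φ :=
    { app := fun n => (φ.app n).app n
      naturality := fun m n θ => by
        have h : (K.map θ).app m ≫ (φ.app n).app m = (φ.app m).app m ≫ (L.map θ).app m :=
          congr_app (φ.naturality θ) m
        have h' : (K.obj n).map θ ≫ (φ.app n).app n = (φ.app n).app m ≫ (L.obj n).map θ :=
          (φ.app n).naturality θ
        rw [Category.assoc, h', ← Category.assoc, h, Category.assoc] }

/-! ### Simplicial presheaves and their mapping spaces -/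

section SimplicialPresheaves

variable (C : Type w) [Category.{v} C]

/-- Simplicial presheaves on `C`. The simplicial sets live in the universe of the objects of `C`,
so that representable presheaves, mapping spaces and projective cofibrant replacements exist. -/
abbrev SPre := Cᵒᵖ ⥤ SSet.{w}

/-- Objectwise weak equivalences. -/
def objectwiseWeakEquiv : MorphismProperty (SPre C) := weakEquiv.functorCategory Cᵒᵖ

/-- Objectwise (Kan) fibrations. -/
def objectwiseFibration : MorphismProperty (SPre C) := kanFibration.functorCategory Cᵒᵖ

/-- Projective cofibrations: the maps with the left lifting property with respect to
acyclic objectwise fibrations. -/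
def projectiveCofibration : MorphismProperty (SPre C) :=
  (objectwiseFibration C ⊓ objectwiseWeakEquiv C).llp

variable {C}

/-- Projectively cofibrant simplicial presheaves. -/
def IsProjectiveCofibrant (X : SPre C) : Prop := projectiveCofibration C (initial.to X)

/-- Projectively fibrant simplicial presheaves, i.e. presheaves of Kan complexes. -/
def IsProjectiveFibrant (X : SPre C) : Prop := objectwiseFibration C (terminal.from X)

variable (C) in
/-- The constant simplicial presheaf with value the standard simplex `Δ[n]`. -/
def constSimplex : SimplexCategory ⥤ SPre C :=
  SSet.stdSimplex ⋙ Functor.const Cᵒᵖ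

/-- The simplicial mapping space `map(X, Y)`, with `n`-simplices the maps `X × Δ[n] ⟶ Y`. -/
def mappingSpace (X Y : SPre C) : SSet.{w} where
  obj n := X ⊗ (constSimplex C).obj n.unop ⟶ Y
  map θ := ↾fun φ => X ◁ (constSimplex C).map θ.unop ≫ φ
  map_id n := by
    refine ConcreteCategory.hom_ext _ _ fun φ => ?_
    change X ◁ (constSimplex C).map (𝟙 n.unop) ≫ φ = φ
    rw [CategoryTheory.Functor.map_id, MonoidalCategory.whiskerLeft_id, Category.id_comp]
  map_comp θ η := by
    refine ConcreteCategory.hom_ext _ _ fun φ => ?_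
    change X ◁ (constSimplex C).map (η.unop ≫ θ.unop) ≫ φ =
      X ◁ (constSimplex C).map η.unop ≫ X ◁ (constSimplex C).map θ.unop ≫ φ
    rw [Functor.map_comp, MonoidalCategory.whiskerLeft_comp, Category.assoc]

/-- The map `map(X', Y) ⟶ map(X, Y)` induced by `f : X ⟶ X'`. -/
def mappingSpacePrecomp {X X' : SPre C} (f : X ⟶ X') (Y : SPre C) :
    mappingSpace X' Y ⟶ mappingSpace X Y where
  app n := ↾fun φ => f ▷ (constSimplex C).obj n.unop ≫ φ
  naturality m n θ := by
    refine ConcreteCategory.hom_ext _ _ fun φ => ?_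
    exact (whisker_exchange_assoc f ((constSimplex C).map θ.unop) φ).symm

/-- The data needed to compute, in the projective model structure, the map which a morphism
`g : X ⟶ Z` induces on (homotopy invariant) mapping spaces into `Y`: cofibrant replacements of
`X` and `Z`, a lift of `g` to them, and a fibrant replacement of `Y`. -/
structure Resolution {X Z : SPre C} (g : X ⟶ Z) (Y : SPre C) where
  /-- a cofibrant replacement of the source -/
  QX : SPre C
  /-- the augmentation of `QX` -/
  p : QX ⟶ X
  cofibrant_QX : IsProjectiveCofibrant QX
  weakEquiv_p : objectwiseWeakEquiv C p
  /-- a cofibrant replacement of the target -/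
  QZ : SPre C
  /-- the augmentation of `QZ` -/
  q : QZ ⟶ Z
  cofibrant_QZ : IsProjectiveCofibrant QZ
  weakEquiv_q : objectwiseWeakEquiv C q
  /-- a lift of `g` to the cofibrant replacements -/
  Qg : QX ⟶ QZ
  comm : Qg ≫ q = p ≫ g
  /-- a fibrant replacement of `Y` -/
  RY : SPre C
  /-- the coaugmentation of `RY` -/
  r : Y ⟶ RY
  fibrant_RY : IsProjectiveFibrant RY
  weakEquiv_r : objectwiseWeakEquiv C r

/-- `g : X ⟶ Z` induces a weak equivalence `map(Z, Y) ⟶ map(X, Y)` of (homotopy invariant)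
mapping spaces: resolutions exist, and for every choice of resolution the induced map
`map(QZ, RY) ⟶ map(QX, RY)` is a weak equivalence of simplicial sets. -/
def InducesWeakEquivOnMap {X Z : SPre C} (g : X ⟶ Z) (Y : SPre C) : Prop :=
  Nonempty (Resolution g Y) ∧
    ∀ ρ : Resolution g Y, weakEquiv (mappingSpacePrecomp ρ.Qg ρ.RY)

end SimplicialPresheaves

/-! ### Smooth schemes and the algebraic simplices -/

/-- Smooth schemes of finite presentation over `S` (the local part of finite presentation is
contained in smoothness), as a property of schemes over `S`. -/
def smProperty (S : Scheme.{u}) : ObjectProperty (Over S) := fun U =>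
  Smooth U.hom ∧ QuasiCompact U.hom ∧ QuasiSeparated U.hom

/-- The category of smooth finitely presented schemes over `S` (and all `S`-morphisms). -/
abbrev Sm (S : Scheme.{u}) := (smProperty S).FullSubcategory

namespace Sm

variable {S : Scheme.{u}}

/-- The fibre product `U ×_S V`. -/
def prod (U V : Sm S) : Sm S where
  obj := Over.mk (pullback.fst U.obj.hom V.obj.hom ≫ U.obj.hom)
  property := by
    obtain ⟨U, _, _, _⟩ := U
    obtain ⟨V, _, _, _⟩ := V
    refine ⟨?_, ?_, ?_⟩ <;> dsimp only [Over.mk_hom] <;> infer_instance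

lemma hom_ext {U V : Sm S} {f g : U ⟶ V} (h : f.hom.left = g.hom.left) : f = g := by
  apply ObjectProperty.hom_ext
  exact Over.OverMorphism.ext h

/-- The underlying morphism of schemes of `f × g`. -/
def prodMapLeft {U U' V V' : Sm S} (f : U ⟶ U') (g : V ⟶ V') :
    pullback U.obj.hom V.obj.hom ⟶ pullback U'.obj.hom V'.obj.hom :=
  pullback.lift (pullback.fst _ _ ≫ f.hom.left) (pullback.snd _ _ ≫ g.hom.left) (by
    rw [Category.assoc, Category.assoc, Over.w, Over.w, pullback.condition])

lemma prodMapLeft_fst {U U' V V' : Sm S} (f : U ⟶ U') (g : V ⟶ V') :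
    prodMapLeft f g ≫ pullback.fst _ _ = pullback.fst _ _ ≫ f.hom.left :=
  pullback.lift_fst _ _ _

lemma prodMapLeft_snd {U U' V V' : Sm S} (f : U ⟶ U') (g : V ⟶ V') :
    prodMapLeft f g ≫ pullback.snd _ _ = pullback.snd _ _ ≫ g.hom.left :=
  pullback.lift_snd _ _ _

/-- The functoriality of `U ×_S V`. -/
def prodMap {U U' V V' : Sm S} (f : U ⟶ U') (g : V ⟶ V') : prod U V ⟶ prod U' V' :=
  ObjectProperty.homMk (Over.homMk (prodMapLeft f g) (by
    change prodMapLeft f g ≫ pullback.fst _ _ ≫ U'.obj.hom = pullback.fst _ _ ≫ U.obj.hom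
    rw [← Category.assoc, prodMapLeft_fst, Category.assoc, Over.w]))

/-- The projection `U ×_S V ⟶ U`. -/
def prodFst (U V : Sm S) : prod U V ⟶ U :=
  ObjectProperty.homMk (Over.homMk (pullback.fst _ _) rfl)

lemma prodMap_id (U V : Sm S) : prodMap (𝟙 U) (𝟙 V) = 𝟙 (prod U V) := by
  apply hom_ext
  change prodMapLeft (𝟙 U) (𝟙 V) = 𝟙 (pullback U.obj.hom V.obj.hom)
  apply pullback.hom_ext
  · rw [prodMapLeft_fst, Category.id_comp]
    exact Category.comp_id _
  · rw [prodMapLeft_snd, Category.id_comp]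
    exact Category.comp_id _

lemma prodMap_comp {U U' U'' V V' V'' : Sm S} (f : U ⟶ U') (f' : U' ⟶ U'') (g : V ⟶ V')
    (g' : V' ⟶ V'') : prodMap (f ≫ f') (g ≫ g') = prodMap f g ≫ prodMap f' g' := by
  apply hom_ext
  change prodMapLeft (f ≫ f') (g ≫ g') = prodMapLeft f g ≫ prodMapLeft f' g'
  apply pullback.hom_ext
  · rw [Category.assoc, prodMapLeft_fst, prodMapLeft_fst, ← Category.assoc, prodMapLeft_fst,
      Category.assoc]
    rfl
  · rw [Category.assoc, prodMapLeft_snd, prodMapLeft_snd, ← Category.assoc, prodMapLeft_snd,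
      Category.assoc]
    rfl

lemma prodMap_fst {U U' V V' : Sm S} (f : U ⟶ U') (g : V ⟶ V') :
    prodMap f g ≫ prodFst U' V' = prodFst U V ≫ f :=
  hom_ext (prodMapLeft_fst f g)

/-- The product bifunctor on `Sm S`. -/
def prodFunctor (S : Scheme.{u}) : Sm S ⥤ Sm S ⥤ Sm S where
  obj U :=
    { obj := fun V => prod U V
      map := fun g => prodMap (𝟙 U) g
      map_id := fun V => prodMap_id U V
      map_comp := fun g g' => by rw [← prodMap_comp, Category.comp_id] }
  map f :=
    { app := fun V => prodMap f (𝟙 V)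
      naturality := fun V V' g => by simp [← prodMap_comp] }
  map_id U := by ext V : 2; exact prodMap_id U V
  map_comp f f' := by ext V : 2; simp [← prodMap_comp]

end Sm

/-- The ring `R[x₀, …, xₙ] / (x₀ + ⋯ + xₙ - 1)`. -/
abbrev SimplexRing (R : Type u) [CommRing R] (n : ℕ) : Type u :=
  MvPolynomial (Fin (n + 1)) R ⧸
    Ideal.span {(∑ i, MvPolynomial.X i - 1 : MvPolynomial (Fin (n + 1)) R)}

namespace SimplexRing

variable (R : Type u) [CommRing R]

/-- The coordinate `xᵢ`. -/
def coord {n : ℕ} (i : Fin (n + 1)) : SimplexRing R n := Ideal.Quotient.mk _ (MvPolynomial.X i)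

lemma sum_coord (n : ℕ) : ∑ i, coord R (n := n) i = 1 := by
  have h : Ideal.Quotient.mk (Ideal.span {(∑ i, MvPolynomial.X i - 1 :
      MvPolynomial (Fin (n + 1)) R)}) (∑ i, MvPolynomial.X i - 1) = 0 :=
    Ideal.Quotient.eq_zero_iff_mem.2 (Ideal.mem_span_singleton_self _)
  rw [map_sub, map_one, sub_eq_zero, map_sum] at h
  exact h

variable {R}

/-- The homomorphism to `A` given by elements `aᵢ` with sum `1`. -/
def lift {n : ℕ} {A : Type*} [CommRing A] [Algebra R A] (a : Fin (n + 1) → A)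
    (ha : ∑ i, a i = 1) : SimplexRing R n →ₐ[R] A :=
  Ideal.Quotient.liftₐ _ (MvPolynomial.aeval a) (by
    intro x hx
    obtain ⟨y, rfl⟩ := Ideal.mem_span_singleton'.1 hx
    simp [ha])

lemma lift_coord {n : ℕ} {A : Type*} [CommRing A] [Algebra R A] (a : Fin (n + 1) → A)
    (ha : ∑ i, a i = 1) (i : Fin (n + 1)) : lift (R := R) a ha (coord R i) = a i := by
  change MvPolynomial.aeval a (MvPolynomial.X i) = a i
  simp

lemma algHom_ext {n : ℕ} {A : Type*} [CommRing A] [Algebra R A]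
    {f g : SimplexRing R n →ₐ[R] A} (h : ∀ i, f (coord R i) = g (coord R i)) : f = g := by
  apply Ideal.Quotient.algHom_ext
  apply MvPolynomial.algHom_ext
  exact h

/-- The map induced by `θ : [m] ⟶ [n]` on coordinate rings, dual to
`(x₀, …, xₘ) ↦ (∑_{θ i = j} xᵢ)_j`. The coface maps insert the coordinate `0` and the
codegeneracy maps sum two consecutive coordinates. -/
def map {m n : SimplexCategory} (θ : m ⟶ n) : SimplexRing R n.len →ₐ[R] SimplexRing R m.len :=
  lift (fun j => ∑ i with θ.toOrderHom i = j, coord R i) (by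
    rw [Finset.sum_fiberwise, sum_coord])

lemma map_coord {m n : SimplexCategory} (θ : m ⟶ n) (j : Fin (n.len + 1)) :
    map θ (coord R j) = ∑ i with θ.toOrderHom i = j, coord R i :=
  lift_coord _ _ _

lemma map_id (n : SimplexCategory) : map (𝟙 n) = AlgHom.id R (SimplexRing R n.len) := by
  apply algHom_ext
  intro i
  rw [map_coord]
  simp [Finset.filter_eq']

lemma map_comp {l m n : SimplexCategory} (θ : l ⟶ m) (η : m ⟶ n) :
    map (R := R) (θ ≫ η) = (map θ).comp (map η) := by
  apply algHom_ext
  intro k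
  rw [AlgHom.comp_apply, map_coord, map_coord, map_sum]
  simp_rw [map_coord]
  rw [Finset.sum_sigma']
  refine Finset.sum_bij' (fun i _ => ⟨θ.toOrderHom i, i⟩) (fun x _ => x.2) ?_ ?_ ?_ ?_ ?_ <;>
    aesop

instance smooth (n : ℕ) : Algebra.Smooth R (SimplexRing R n) where
  formallySmooth := by
    refine Algebra.FormallySmooth.of_comp_surjective fun B _ _ I hI f => ?_
    choose b hb using fun i => Ideal.Quotient.mk_surjective (I := I) (f (coord R i))
    refine ⟨lift (Fin.cons (1 - ∑ i : Fin n, b i.succ) fun i => b i.succ)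
      (by simp [Fin.sum_univ_succ]), ?_⟩
    apply algHom_ext
    intro i
    rw [AlgHom.comp_apply, lift_coord]
    refine Fin.cases ?_ (fun i => ?_) i
    · have h : ∑ i, f (coord R i) = 1 := by rw [← map_sum, sum_coord, map_one]
      rw [Fin.sum_univ_succ] at h
      rw [← eq_sub_iff_add_eq] at h
      simp [hb, h]
    · simp [hb]
  finitePresentation := .quotient (Submodule.fg_span_singleton _)

/-- The structure morphism of `Spec R[x₀, …, xₙ] / (x₀ + ⋯ + xₙ - 1)`. -/
def toSpec (R : Type u) [CommRing R] (n : ℕ) : Spec (.of (SimplexRing R n)) ⟶ Spec (.of R) :=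
  Spec.map (CommRingCat.ofHom (algebraMap R (SimplexRing R n)))

instance smooth_toSpec (n : ℕ) : Smooth (toSpec R n) := by
  rw [toSpec, HasRingHomProperty.Spec_iff (P := @Smooth)]
  exact (RingHom.smooth_algebraMap).2 (smooth n)

instance isAffineHom_toSpec (n : ℕ) : IsAffineHom (toSpec R n) := by
  rw [toSpec]; infer_instance

/-- The morphism of spectra induced by `θ : [m] ⟶ [n]`. -/
def specMap (R : Type u) [CommRing R] {m n : SimplexCategory} (θ : m ⟶ n) :
    Spec (.of (SimplexRing R m.len)) ⟶ Spec (.of (SimplexRing R n.len)) :=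
  Spec.map (CommRingCat.ofHom (map θ).toRingHom)

lemma specMap_toSpec {m n : SimplexCategory} (θ : m ⟶ n) :
    specMap R θ ≫ toSpec R n.len = toSpec R m.len := by
  rw [specMap, toSpec, toSpec, ← Spec.map_comp, ← CommRingCat.ofHom_comp]
  congr 2
  exact (map θ).comp_algebraMap

lemma specMap_id (n : SimplexCategory) : specMap R (𝟙 n) = 𝟙 _ := by
  rw [specMap, map_id]
  exact Spec.map_id _

lemma specMap_comp {l m n : SimplexCategory} (θ : l ⟶ m) (η : m ⟶ n) :
    specMap R (θ ≫ η) = specMap R θ ≫ specMap R η := by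
  rw [specMap, map_comp, specMap, specMap, ← Spec.map_comp, ← CommRingCat.ofHom_comp]
  rfl

end SimplexRing

section AlgSimplex

variable (S : Scheme.{u})

/-- The scheme `S × Spec ℤ[x₀, …, xₙ] / (x₀ + ⋯ + xₙ - 1)`. -/
abbrev algSimplexScheme (n : ℕ) : Scheme.{u} :=
  pullback (specULiftZIsTerminal.from S) (SimplexRing.toSpec (ULift.{u} ℤ) n)

/-- The algebraic `n`-simplex `Δⁿ` over `S`. -/
def algSimplexObj (n : ℕ) : Sm S where
  obj := Over.mk (pullback.fst (specULiftZIsTerminal.from S) (SimplexRing.toSpec (ULift.{u} ℤ) n))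
  property := by
    refine ⟨?_, ?_, ?_⟩ <;> dsimp only [Over.mk_hom] <;> infer_instance

/-- The morphism of schemes `Δᵐ ⟶ Δⁿ` induced by `θ : [m] ⟶ [n]`. -/
def algSimplexMap {m n : SimplexCategory} (θ : m ⟶ n) :
    algSimplexScheme S m.len ⟶ algSimplexScheme S n.len :=
  pullback.lift (pullback.fst _ _) (pullback.snd _ _ ≫ SimplexRing.specMap (ULift.{u} ℤ) θ) (by
    rw [Category.assoc, SimplexRing.specMap_toSpec, pullback.condition])

lemma algSimplexMap_fst {m n : SimplexCategory} (θ : m ⟶ n) :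
    algSimplexMap S θ ≫ pullback.fst _ _ = pullback.fst _ _ :=
  pullback.lift_fst _ _ _

lemma algSimplexMap_snd {m n : SimplexCategory} (θ : m ⟶ n) :
    algSimplexMap S θ ≫ pullback.snd _ _ =
      pullback.snd _ _ ≫ SimplexRing.specMap (ULift.{u} ℤ) θ :=
  pullback.lift_snd _ _ _

/-- The cosimplicial smooth `S`-scheme `Δ^•`. -/
def algSimplex : SimplexCategory ⥤ Sm S where
  obj n := algSimplexObj S n.len
  map θ := ObjectProperty.homMk (Over.homMk (algSimplexMap S θ) (pullback.lift_fst _ _ _))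
  map_id n := by
    apply Sm.hom_ext
    change algSimplexMap S (𝟙 n) = 𝟙 _
    apply pullback.hom_ext
    · rw [algSimplexMap_fst]
      exact (Category.id_comp _).symm
    · rw [algSimplexMap_snd, SimplexRing.specMap_id, Category.comp_id]
      exact (Category.id_comp _).symm
  map_comp θ η := by
    apply Sm.hom_ext
    change algSimplexMap S (θ ≫ η) = algSimplexMap S θ ≫ algSimplexMap S η
    apply pullback.hom_ext
    · rw [Category.assoc, algSimplexMap_fst, algSimplexMap_fst, algSimplexMap_fst]
    · rw [Category.assoc, algSimplexMap_snd, algSimplexMap_snd, ← Category.assoc,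
        algSimplexMap_snd, SimplexRing.specMap_comp, Category.assoc]

end AlgSimplex

lemma smooth_mvPolynomial (R : Type u) [CommRing R] :
    Smooth (Spec.map (CommRingCat.ofHom (MvPolynomial.C : R →+* MvPolynomial PUnit.{u + 1} R))) := by
  rw [HasRingHomProperty.Spec_iff (P := @Smooth)]
  exact RingHom.smooth_algebraMap.2
    (⟨inferInstance, inferInstance⟩ : Algebra.Smooth R (MvPolynomial PUnit.{u + 1} R))

lemma smooth_affineLine (S : Scheme.{u}) : Smooth (𝔸(PUnit.{u + 1}; S) ↘ S) := by
  have := isIso_of_isTerminal specULiftZIsTerminal.{u} terminalIsTerminal (terminal.from _)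
  have := smooth_mvPolynomial (ULift.{u} ℤ)
  have h : Smooth (terminal.from (Spec (.of (MvPolynomial PUnit.{u + 1} (ULift.{u} ℤ))))) := by
    rw [← terminal.comp_from (Spec.map (CommRingCat.ofHom MvPolynomial.C))]
    infer_instance
  exact inferInstanceAs (Smooth (pullback.fst (terminal.from S) (terminal.from _)))

/-- The affine line over `S` as an object of `Sm S`. -/
def affineLine (S : Scheme.{u}) : Sm S where
  obj := Over.mk (𝔸(PUnit.{u + 1}; S) ↘ S)
  property := by
    have : Smooth (𝔸(PUnit.{u + 1}; S) ↘ S) := smooth_affineLine S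
    refine ⟨?_, ?_, ?_⟩ <;> dsimp only [Over.mk_hom] <;> infer_instance

/-! ### `𝔸¹`-invariance and the singular construction -/

variable {S : Scheme.{u}}

/-- A simplicial presheaf `X` on `Sm S` is `𝔸¹`-invariant if `X(U) ⟶ X(U ×_S 𝔸¹)` is a weak
equivalence for all `U`. -/
def IsA1Invariant (X : SPre (Sm S)) : Prop :=
  ∀ U : Sm S, weakEquiv (X.map (Sm.prodFst U (affineLine S)).op)

variable (S)

/-- The simplicial object `X(- × Δ^•)` in simplicial presheaves, regarded as a presheaf of
simplicial objects in simplicial sets, functorially in `X`. -/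
def simplexEvaluation : SPre (Sm S) ⥤ (Sm S)ᵒᵖ ⥤ SimplicialObject SSet.{u + 1} where
  obj X :=
    { obj := fun U => (algSimplex S ⋙ (Sm.prodFunctor S).obj U.unop).op ⋙ X
      map := fun f => Functor.whiskerRight
        (NatTrans.op (Functor.whiskerLeft (algSimplex S) ((Sm.prodFunctor S).map f.unop))) X
      map_id := fun U => by ext : 2; simp
      map_comp := fun f g => by ext : 2; simp }
  map φ :=
    { app := fun U => Functor.whiskerLeft _ φ
      naturality := fun U V f => by ext : 2; simp }
  map_id X := by ext : 4; simp
  map_comp φ ψ := by ext : 4; simp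

/-- The singular construction `Sing^{𝔸¹} X = |X(- × Δ^•)|`. -/
def singA1 : SPre (Sm S) ⥤ SPre (Sm S) :=
  simplexEvaluation S ⋙ (Functor.whiskeringRight _ _ _).obj realization

/-- The natural map `X ⟶ Sing^{𝔸¹} X`, induced by the projections `U ×_S Δⁿ ⟶ U` (that is, by
the map from `X`, as a constant simplicial object, to `X(- × Δ^•)`). -/
def toSingA1 : 𝟭 (SPre (Sm S)) ⟶ singA1 S where
  app X :=
    { app := fun U =>
        { app := fun n => (X.map (Sm.prodFst U.unop ((algSimplex S).obj n.unop)).op).app n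
          naturality := fun m n θ => by
            have h : Sm.prodMap (𝟙 U.unop) ((algSimplex S).map θ.unop) ≫ Sm.prodFst _ _ =
                Sm.prodFst _ _ := by rw [Sm.prodMap_fst, Category.comp_id]
            have h' := congrArg (fun f => (X.map f.op).app m) h
            change (X.obj U).map θ ≫ (X.map (Sm.prodFst _ _).op).app n =
              (X.map (Sm.prodFst _ _).op).app m ≫ (X.map (Sm.prodMap (𝟙 U.unop)
                ((algSimplex S).map θ.unop)).op).app m ≫ (X.obj _).map θ
            rw [(X.map (Sm.prodFst _ _).op).naturality, ← h']
            simp only [op_comp, Functor.map_comp, NatTrans.comp_app, Category.assoc] }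
      naturality := fun U V f => by
        refine NatTrans.ext (funext fun n => ?_)
        have h := congrArg (fun f => (X.map f.op).app n)
          (Sm.prodMap_fst f.unop (𝟙 ((algSimplex S).obj n.unop)))
        simp only [op_comp, Functor.map_comp, NatTrans.comp_app] at h
        exact h.symm }
  naturality X Y φ := by
    refine NatTrans.ext (funext fun U => NatTrans.ext (funext fun n => ?_))
    exact (congr_app (φ.naturality _) n).symm

end MotivicSing

end

/-!
# The singular construction computes `𝔸¹`-local mapping spaces

The geometric input is elementary. A morphism from a smooth `S`-scheme `V` to `𝔸¹` is a function
on `V`, and a morphism to `Δⁿ` is an `(n + 1)`-tuple of functions with sum `1`. Therefore a morphism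
`V ×_S 𝔸¹ ⟶ W` induces a simplicial homotopy between the two maps `Sing X (W) ⟶ Sing X (V)` obtained
by restriction to `0` and `1`: on the simplex of `Δ[1]` given by `t : [n] ⟶ [1]` use the function
`∑_{t i = 1} xᵢ` on `V ×_S Δⁿ` (`homotopic_singA1_map_lineSection`). The contraction of the line to
its origin then shows that `Sing X` is `𝔸¹`-invariant (`isA1Invariant_singA1`), and the linear
contraction of `Δⁿ` to a vertex shows that an `𝔸¹`-invariant `Y` satisfies `Y(U) ≃ Y(U ×_S Δⁿ)`
(`IsA1Invariant.weakEquiv_map_prodFst_algSimplex`).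

Homotopy theory enters through the statement that the diagonal of a map of bisimplicial sets which
is a levelwise weak equivalence is a weak equivalence (`weakEquiv_realization_map`). It implies that
`Sing` preserves objectwise weak equivalences and that `g_Y : Y ⟶ Sing Y` is one as soon as `Y` is
`𝔸¹`-invariant. The diagonals `Δⁿ ⟶ Δⁿ × Δⁿ` define a common retraction `Sing Sing X ⟶ Sing X` of
`Sing(g_X)` and `g_{Sing X}`. Since `g_{Sing X}` is an equivalence, `Sing(g_X)` is invertible in the
homotopy category, and the usual argument for idempotent localizations gives that precomposition with `g_X` is bijective on
morphisms into `𝔸¹`-invariant presheaves in the homotopy category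
(`bijective_Q_map_toSingA1_comp`). As `Sing (X × L) = Sing X × L` for each simplicial set `L`, the
same holds for `g_X × L`; and maps `L ⟶ map(A, K)` up to homotopy are morphisms `A × L ⟶ K` in the
homotopy category if `A` is cofibrant and `K` is fibrant, so the map of mapping spaces is bijective
on homotopy classes of maps out of every `L`, hence a weak equivalence
(`weakEquiv_mappingSpacePrecomp`).

The foundation is the theorem that a Kan fibration which is a weak equivalence has the right lifting
property against all monomorphisms (`trivialFibration_of_weakEquiv`). With weak equivalences
detected by maps into Kan complexes, this is direct when the base is a Kan complex: a section up
to homotopy can be straightened and deformed. The general case is reduced to it by extending the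
fibration along an anodyne map from its base to a Kan complex. For this, Kan fibrations with
fibres of bounded size are classified by a universe whose `n`-simplices are the fibrations over
`Δ[n]`, and the universe is a Kan complex because fibrations extend from horns to simplices: a
deformation of the simplex and the pushforward of fibrations along fibrations (right adjoint to
pullback) reduce this to extending a trivial fibration. Stability of anodyne maps under pullback
along fibrations then shows that the fibration and its extension are related by anodyne maps. The
theorem yields the projective model structure on simplicial presheaves
(`projectiveModelCategory`), and also that injective weak equivalences are anodyne, which reduces
the statement on diagonals to levelwise anodyne maps (`anodyne_realization_map`).
-/
noncomputable section

namespace MotivicSing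

open SSet HomotopicalAlgebra

/-! ### Lifting properties of pushout-products -/

/-- Trivial Kan fibrations: maps with the right lifting property against monomorphisms. -/
abbrev trivialFibration : MorphismProperty SSet.{w} := (MorphismProperty.monomorphisms SSet.{w}).rlp

open modelCategoryQuillen in
lemma kanComplex_iff_kanFibration (K : SSet.{w}) :
    KanComplex K ↔ kanFibration (terminal.from K) := by
  rw [KanComplex, isFibrant_iff_of_isTerminal (terminal.from K) terminalIsTerminal]
  exact modelCategoryQuillen.fibration_iff _

lemma mono_of_anodyne {A B : SSet.{w}} {i : A ⟶ B} (hi : anodyneExtensions i) : Mono i := by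
  rw [anodyneExtensions_eq_retracts_transfiniteCompositions] at hi
  refine (?_ : _ ≤ MorphismProperty.monomorphisms SSet.{w}) _ hi
  rw [MorphismProperty.retracts_le_iff, MorphismProperty.transfiniteCompositions_le_iff,
    MorphismProperty.pushouts_le_iff, MorphismProperty.coproducts_le_iff]
  exact modelCategoryQuillen.J_le_monomorphisms

lemma trivialFibration.kanFibration {E B : SSet.{w}} {p : E ⟶ B} (hp : trivialFibration p) :
    kanFibration p :=
  MorphismProperty.antitone_rlp modelCategoryQuillen.J_le_monomorphisms _ hp

lemma exists_lift_of_pushoutObjObj {V W K L E B : SSet.{w}} {j : V ⟶ W} {i : K ⟶ L} {p : E ⟶ B}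
    (sq : (curriedTensor SSet.{w}).PushoutObjObj j i) (hsq : HasLiftingProperty sq.ι p)
    (a : W ⊗ K ⟶ E) (b : V ⊗ L ⟶ E) (c : W ⊗ L ⟶ B) (hab : j ▷ K ≫ a = V ◁ i ≫ b)
    (hac : a ≫ p = W ◁ i ≫ c) (hbc : b ≫ p = j ▷ L ≫ c) :
    ∃ l : W ⊗ L ⟶ E, W ◁ i ≫ l = a ∧ j ▷ L ≫ l = b ∧ l ≫ p = c := by
  have comm : CommSq (sq.isPushout.desc a b hab) sq.ι p c := ⟨by
    apply sq.isPushout.hom_ext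
    · rw [IsPushout.inl_desc_assoc, sq.inl_ι_assoc]; exact hac
    · rw [IsPushout.inr_desc_assoc, sq.inr_ι_assoc]; exact hbc⟩
  refine ⟨comm.lift, ?_, ?_, comm.fac_right⟩
  · have := congrArg (sq.inl ≫ ·) comm.fac_left
    simp only [sq.inl_ι_assoc, IsPushout.inl_desc] at this
    exact this
  · have := congrArg (sq.inr ≫ ·) comm.fac_left
    simp only [sq.inr_ι_assoc, IsPushout.inr_desc] at this
    exact this

section

variable {V W K L E B : SSet.{w}} {j : V ⟶ W} {i : K ⟶ L} {p : E ⟶ B}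
    (a : W ⊗ K ⟶ E) (b : V ⊗ L ⟶ E) (c : W ⊗ L ⟶ B) (hab : j ▷ K ≫ a = V ◁ i ≫ b)
    (hac : a ≫ p = W ◁ i ≫ c) (hbc : b ≫ p = j ▷ L ≫ c)
include hab hac hbc

lemma exists_lift_of_anodyne_right [Mono j] (hi : anodyneExtensions i) (hp : kanFibration p) :
    ∃ l : W ⊗ L ⟶ E, W ◁ i ≫ l = a ∧ j ▷ L ≫ l = b ∧ l ≫ p = c :=
  exists_lift_of_pushoutObjObj (.ofHasPushout _ j i)
    (anodyneExtensions_pushoutObjObjι _ hi _ hp) a b c hab hac hbc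

lemma exists_lift_of_anodyne_left [Mono i] (hj : anodyneExtensions j) (hp : kanFibration p) :
    ∃ l : W ⊗ L ⟶ E, W ◁ i ≫ l = a ∧ j ▷ L ≫ l = b ∧ l ≫ p = c :=
  exists_lift_of_pushoutObjObj (.ofHasPushout _ j i)
    (anodyneExtensions_pushoutObjObjι' _ hj _ hp) a b c hab hac hbc

end

lemma exists_lift_of_trivialFibration {V W L E B : SSet.{w}} {j : V ⟶ W} {K : L.Subcomplex}
    {p : E ⟶ B} [Mono j]
    (a : W ⊗ (K : SSet) ⟶ E) (b : V ⊗ L ⟶ E) (c : W ⊗ L ⟶ B)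
    (hab : j ▷ (K : SSet) ≫ a = V ◁ K.ι ≫ b)
    (hac : a ≫ p = W ◁ K.ι ≫ c) (hbc : b ≫ p = j ▷ L ≫ c) (hp : trivialFibration p) :
    ∃ l : W ⊗ L ⟶ E, W ◁ K.ι ≫ l = a ∧ j ▷ L ≫ l = b ∧ l ≫ p = c := by
  let sq₁₂ := Functor.PushoutObjObj.ofHasPushout (curriedTensor SSet.{w}) j K.ι
  refine exists_lift_of_pushoutObjObj sq₁₂ ?_ a b c hab hac hbc
  rw [HasLiftingProperty.iff_of_arrow_iso_left
    (show Arrow.mk sq₁₂.ι ≅ Arrow.mk sq₁₂.flipTensor.ι from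
      Arrow.isoMk (Iso.refl _) (β_ _ _))]
  let sq₁₃ := Functor.PullbackObjObj.ofHasPullback MonoidalClosed.internalHom K.ι p
  rw [MonoidalClosed.internalHomAdjunction₂.hasLiftingProperty_iff _ sq₁₃]
  suffices (MorphismProperty.monomorphisms _).rlp sq₁₃.π from this _ inferInstance
  rw [rlp_monomorphisms]
  rintro _ _ _ ⟨n⟩
  rw [← MonoidalClosed.internalHomAdjunction₂.hasLiftingProperty_iff
    (Subcomplex.unionProd.pushoutObjObj.{w} _ _),
    Subcomplex.unionProd.pushoutObjObj_ι]
  exact hp _ (inferInstanceAs (Mono (Subcomplex.unionProd K ∂Δ[_]).ι))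

/-! ### Cylinders and lifting of homotopies -/

/-- The inclusion of an end of the cylinder. -/
def cylEnd (X : SSet.{w}) (e : Fin 2) : X ⟶ X ⊗ Δ[1] :=
  CartesianMonoidalCategory.lift (𝟙 X) (const (stdSimplex.obj₀Equiv.symm e))

lemma cylEnd_naturality {X Y : SSet.{w}} (f : X ⟶ Y) (e : Fin 2) :
    cylEnd X e ≫ f ▷ Δ[1] = f ≫ cylEnd Y e := rfl

@[simp]
lemma cylEnd_fst (X : SSet.{w}) (e : Fin 2) :
    cylEnd X e ≫ SemiCartesianMonoidalCategory.fst X Δ[1] = 𝟙 X := rfl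

@[simp]
lemma cylEnd_fst_assoc (X : SSet.{w}) (e : Fin 2) {Z : SSet.{w}} (h : X ⟶ Z) :
    cylEnd X e ≫ SemiCartesianMonoidalCategory.fst X Δ[1] ≫ h = h := rfl

/-- The vertices of a simplex of `Δ[1]`. -/
abbrev vtx {m : SimplexCategoryᵒᵖ} (t : (Δ[1] : SSet.{w}).obj m) (i : Fin (m.unop.len + 1)) : Fin 2 :=
  stdSimplex.asOrderHom t i

lemma vtx_ext {m : SimplexCategoryᵒᵖ} {t t' : (Δ[1] : SSet.{w}).obj m} (h : ∀ i, vtx t i = vtx t' i) :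
    t = t' := by
  induction m using Opposite.rec with | _ m
  induction m using SimplexCategory.rec with | _ m
  exact SSet.stdSimplex.ext _ _ h

lemma vtx_cylEnd {X : SSet.{w}} (e : Fin 2) {m : SimplexCategoryᵒᵖ} (x : X.obj m) (i) :
    vtx ((cylEnd X e).app m x).2 i = e := rfl

lemma eq_cylEnd {X : SSet.{w}} (e : Fin 2) {m : SimplexCategoryᵒᵖ} (x : (X ⊗ Δ[1]).obj m)
    (h : ∀ i, vtx x.2 i = e) : x = (cylEnd X e).app m x.1 :=
  Prod.ext rfl (vtx_ext h)

lemma vtx_of_mem_horn (e : Fin 2) {m : SimplexCategoryᵒᵖ} (t : (Λ[1, e] : SSet.{w}).obj m) (i) :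
    vtx t.1 i = e := by
  by_contra h
  refine t.2 (Set.eq_univ_of_forall fun k => ?_)
  by_cases hk : k = e
  · exact Or.inr hk
  · exact Or.inl ⟨i, by change vtx t.1 i = k; omega⟩

lemma mem_horn_one (e : Fin 2) {m : SimplexCategoryᵒᵖ} (t : (Δ[1] : SSet.{w}).obj m)
    (h : ∀ i, vtx t i = e) : t ∈ Λ[1, e].obj m := by
  intro h'
  have : (1 - e) ∈ Set.range ⇑(stdSimplex.asOrderHom t) ∪ {e} := h' ▸ Set.mem_univ _
  rcases this with ⟨i, hi⟩ | hi
  · have := h i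
    change vtx t i = _ at hi
    omega
  · simp at hi; omega

/-- The relative homotopy lifting property of Kan fibrations, from either end of the cylinder. -/
lemma exists_lift_cylinder {V W E B : SSet.{w}} (j : V ⟶ W) [Mono j] {p : E ⟶ B}
    (hp : kanFibration p) (e : Fin 2) (a : W ⟶ E) (b : V ⊗ Δ[1] ⟶ E) (c : W ⊗ Δ[1] ⟶ B)
    (hab : j ≫ a = cylEnd V e ≫ b) (hac : a ≫ p = cylEnd W e ≫ c) (hbc : b ≫ p = j ▷ Δ[1] ≫ c) :
    ∃ l : W ⊗ Δ[1] ⟶ E, cylEnd W e ≫ l = a ∧ j ▷ Δ[1] ≫ l = b ∧ l ≫ p = c := by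
  have key : ∀ {X Z : SSet.{w}} (f : X ⊗ Δ[1] ⟶ Z) (g : X ⟶ Z), g = cylEnd X e ≫ f →
      SemiCartesianMonoidalCategory.fst X (Λ[1, e] : SSet.{w}) ≫ g = X ◁ Λ[1, e].ι ≫ f := by
    rintro X Z f _ rfl
    ext m ⟨x, t⟩
    exact congrArg (f.app m) (eq_cylEnd e (x, t.1) (vtx_of_mem_horn e t)).symm
  obtain ⟨l, h₁, h₂, h₃⟩ := exists_lift_of_anodyne_right (j := j) (i := Λ[1, e].ι) (p := p)
    (SemiCartesianMonoidalCategory.fst _ _ ≫ a) b c (key b _ hab)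
      (by rw [Category.assoc]; exact key c _ hac) hbc (anodyneExtensions.horn_ι e) hp
  refine ⟨l, ?_, h₂, h₃⟩
  ext m x
  exact ConcreteCategory.congr_hom (congr_app h₁ m)
    ((x, ⟨((cylEnd W e).app m x).2, mem_horn_one e _ (vtx_cylEnd e x)⟩) :
      (W ⊗ (Λ[1, e] : SSet.{w})).obj m)

lemma mono_iff_injective {X Y : SSet.{w}} (f : X ⟶ Y) :
    Mono f ↔ ∀ m, Function.Injective (f.app m) := by
  rw [NatTrans.mono_iff_mono_app]
  exact forall_congr' fun m => CategoryTheory.mono_iff_injective _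

instance mono_whiskerLeft (X : SSet.{w}) {Y Z : SSet.{w}} (i : Y ⟶ Z) [Mono i] : Mono (X ◁ i) := by
  rw [mono_iff_injective]
  intro m x y h
  have h₁ : x.1 = y.1 := congrArg (fun z : (X ⊗ Z).obj m => z.1) h
  have h₂ : i.app m x.2 = i.app m y.2 := congrArg (fun z : (X ⊗ Z).obj m => z.2) h
  exact Prod.ext h₁ ((mono_iff_injective i).1 inferInstance m h₂)

lemma vtx_of_mem_boundary {m : SimplexCategoryᵒᵖ} (t : (∂Δ[1] : SSet.{w}).obj m) (i i') :
    vtx t.1 i = vtx t.1 i' := by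
  by_contra h
  refine t.2 fun k => ?_
  by_cases hk : vtx t.1 i = k
  · exact ⟨i, hk⟩
  · exact ⟨i', by change vtx t.1 i' = k; omega⟩

/-- The map on `X` which is `f 0` where `d` takes the value `0` and `f 1` where it takes the
value `1`. -/
def glueEnds {X E : SSet.{w}} (d : X ⟶ (∂Δ[1] : SSet.{w})) (f : Fin 2 → (X ⟶ E)) : X ⟶ E where
  app m := ↾fun x => (f (vtx (d.app m x).1 0)).app m x
  naturality m m' θ := by
    ext x
    change (f (vtx (d.app m' (X.map θ x)).1 0)).app m' (X.map θ x) =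
      E.map θ ((f (vtx (d.app m x).1 0)).app m x)
    have h : vtx (d.app m' (X.map θ x)).1 0 = vtx (d.app m x).1 0 := by
      rw [NatTrans.naturality_apply]
      exact vtx_of_mem_boundary (d.app m x) (θ.unop.toOrderHom 0) 0
    rw [h, NatTrans.naturality_apply]

lemma glueEnds_comp {X E B : SSet.{w}} (d : X ⟶ (∂Δ[1] : SSet.{w})) (f : Fin 2 → (X ⟶ E))
    (p : E ⟶ B) (g : X ⟶ B)
    (h : ∀ k m (x : X.obj m), (∀ i, vtx (d.app m x).1 i = k) →
      p.app m ((f k).app m x) = g.app m x) : glueEnds d f ≫ p = g := by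
  ext m x
  exact h _ m x fun i => vtx_of_mem_boundary _ _ _

lemma comp_glueEnds {X Z E : SSet.{w}} (d : X ⟶ (∂Δ[1] : SSet.{w})) (f : Fin 2 → (X ⟶ E))
    (i : Z ⟶ X) (g : Z ⟶ E)
    (h : ∀ k m (z : Z.obj m), (∀ l, vtx (d.app m (i.app m z)).1 l = k) →
      (f k).app m (i.app m z) = g.app m z) : i ≫ glueEnds d f = g := by
  ext m z
  exact h _ m z fun i => vtx_of_mem_boundary _ _ _

/-- The end of the cylinder, as a map to the product with the boundary of the interval. -/
def cylEndBoundary (X : SSet.{w}) (e : Fin 2) : X ⟶ X ⊗ (∂Δ[1] : SSet.{w}) :=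
  CartesianMonoidalCategory.lift (𝟙 X) (Subcomplex.lift (const (stdSimplex.obj₀Equiv.symm e)) (by
    rintro m _ ⟨x, rfl⟩ h
    obtain ⟨i, hi⟩ := h (1 - e)
    have : e = 1 - e := hi
    omega))

lemma whiskerLeft_boundary_comp_eq {X E : SSet.{w}} (l : X ⊗ Δ[1] ⟶ E) (f : Fin 2 → (X ⟶ E))
    (h : X ◁ ∂Δ[1].ι ≫ l = glueEnds (SemiCartesianMonoidalCategory.snd _ _)
      (fun k => SemiCartesianMonoidalCategory.fst _ _ ≫ f k)) (e : Fin 2) :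
    cylEnd X e ≫ l = f e := by
  have := congrArg (cylEndBoundary X e ≫ ·) h
  refine Eq.trans (Eq.trans ?_ this) ?_
  · rfl
  · refine comp_glueEnds _ _ _ _ fun k m x hk => ?_
    obtain rfl : e = k := hk 0
    rfl

lemma glue_boundary_comp {X E B : SSet.{w}} (p : E ⟶ B) (c : X ⊗ Δ[1] ⟶ B) (f : Fin 2 → (X ⟶ E))
    (h : ∀ k, f k ≫ p = cylEnd X k ≫ c) :
    glueEnds (SemiCartesianMonoidalCategory.snd X (∂Δ[1] : SSet.{w}))
      (fun k => SemiCartesianMonoidalCategory.fst _ _ ≫ f k) ≫ p = X ◁ ∂Δ[1].ι ≫ c := by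
  refine glueEnds_comp _ _ _ _ fun k m x hx => ?_
  refine (ConcreteCategory.congr_hom (congr_app (h k) m) x.1).trans ?_
  exact congrArg (c.app m) (eq_cylEnd k ((X ◁ ∂Δ[1].ι).app m x) hx).symm

/-- Homotopies lift along trivial fibrations, relative to the ends and to a subobject. -/
lemma exists_lift_homotopy {V W E B : SSet.{w}} (j : V ⟶ W) [Mono j] {p : E ⟶ B}
    (hp : trivialFibration p) (f : Fin 2 → (W ⟶ E)) (b : V ⊗ Δ[1] ⟶ E) (c : W ⊗ Δ[1] ⟶ B)
    (hfb : ∀ k, j ≫ f k = cylEnd V k ≫ b) (hfc : ∀ k, f k ≫ p = cylEnd W k ≫ c)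
    (hbc : b ≫ p = j ▷ Δ[1] ≫ c) :
    ∃ l : W ⊗ Δ[1] ⟶ E, (∀ k, cylEnd W k ≫ l = f k) ∧ j ▷ Δ[1] ≫ l = b ∧ l ≫ p = c := by
  obtain ⟨l, h₁, h₂, h₃⟩ := exists_lift_of_trivialFibration (j := j) (K := ∂Δ[1]) (p := p)
    (glueEnds (SemiCartesianMonoidalCategory.snd _ _)
      (fun k => SemiCartesianMonoidalCategory.fst _ _ ≫ f k)) b c (by
        refine comp_glueEnds _ _ _ _ fun k m x hx => ?_
        refine (ConcreteCategory.congr_hom (congr_app (hfb k) m) x.1).trans ?_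
        exact congrArg (b.app m) (eq_cylEnd k ((V ◁ ∂Δ[1].ι).app m x) hx).symm)
      (glue_boundary_comp p c f hfc) hbc hp
  exact ⟨l, whiskerLeft_boundary_comp_eq l f h₁, h₂, h₃⟩

/-- Homotopies extend along anodyne extensions, relative to the ends. -/
lemma exists_extend_homotopy {V W E B : SSet.{w}} {j : V ⟶ W} (hj : anodyneExtensions j) {p : E ⟶ B}
    (hp : kanFibration p) (f : Fin 2 → (W ⟶ E)) (b : V ⊗ Δ[1] ⟶ E) (c : W ⊗ Δ[1] ⟶ B)
    (hfb : ∀ k, j ≫ f k = cylEnd V k ≫ b) (hfc : ∀ k, f k ≫ p = cylEnd W k ≫ c)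
    (hbc : b ≫ p = j ▷ Δ[1] ≫ c) :
    ∃ l : W ⊗ Δ[1] ⟶ E, (∀ k, cylEnd W k ≫ l = f k) ∧ j ▷ Δ[1] ≫ l = b ∧ l ≫ p = c := by
  obtain ⟨l, h₁, h₂, h₃⟩ := exists_lift_of_anodyne_left (j := j) (i := ∂Δ[1].ι) (p := p)
    (glueEnds (SemiCartesianMonoidalCategory.snd _ _)
      (fun k => SemiCartesianMonoidalCategory.fst _ _ ≫ f k)) b c (by
        refine comp_glueEnds _ _ _ _ fun k m x hx => ?_
        refine (ConcreteCategory.congr_hom (congr_app (hfb k) m) x.1).trans ?_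
        exact congrArg (b.app m) (eq_cylEnd k ((V ◁ ∂Δ[1].ι).app m x) hx).symm)
      (glue_boundary_comp p c f hfc) hbc hj hp
  exact ⟨l, whiskerLeft_boundary_comp_eq l f h₁, h₂, h₃⟩

lemma glueEnds_app {X E : SSet.{w}} (d : X ⟶ (∂Δ[1] : SSet.{w})) (f : Fin 2 → (X ⟶ E)) {k : Fin 2}
    {m : SimplexCategoryᵒᵖ} {x : X.obj m} (h : vtx (d.app m x).1 0 = k) :
    (glueEnds d f).app m x = (f k).app m x := by
  subst h; rfl

lemma vtx_cylEndBoundary {X : SSet.{w}} (e : Fin 2) {m : SimplexCategoryᵒᵖ} (x : X.obj m) (i) :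
    vtx ((cylEndBoundary X e).app m x).2.1 i = e := rfl

/-- Filling a square of homotopies in the total space of a Kan fibration: three sides of a
square, lying over a given square of the base, can be completed by a fourth one. -/
lemma exists_square_lift {W E B : SSet.{w}} {p : E ⟶ B} (hp : kanFibration p)
    (a : W ⊗ Δ[1] ⟶ E) (s : Fin 2 → (W ⊗ Δ[1] ⟶ E)) (c : (W ⊗ Δ[1]) ⊗ Δ[1] ⟶ B)
    (has : ∀ k, cylEnd W k ≫ a = cylEnd W 0 ≫ s k) (hac : a ≫ p = cylEnd _ 0 ≫ c)
    (hsc : ∀ k, s k ≫ p = cylEnd W k ▷ Δ[1] ≫ c) :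
    ∃ t : W ⊗ Δ[1] ⟶ E, (∀ k, cylEnd W k ≫ t = cylEnd W 1 ≫ s k) ∧ t ≫ p = cylEnd _ 1 ≫ c := by
  have key : ∀ (k : Fin 2) (m : SimplexCategoryᵒᵖ)
      (x : ((W ⊗ (∂Δ[1] : SSet.{w})) ⊗ Δ[1]).obj m), (∀ l, vtx x.1.2.1 l = k) →
      ((W ◁ ∂Δ[1].ι) ▷ Δ[1]).app m x = (cylEnd W k ▷ Δ[1]).app m (x.1.1, x.2) := by
    intro k m x hx
    exact Prod.ext (eq_cylEnd k ((W ◁ ∂Δ[1].ι).app m x.1) hx) rfl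
  obtain ⟨l, h₁, h₂, h₃⟩ := exists_lift_cylinder (W ◁ ∂Δ[1].ι) hp 0 a
    (glueEnds (SemiCartesianMonoidalCategory.fst _ _ ≫ SemiCartesianMonoidalCategory.snd _ _)
      (fun k => SemiCartesianMonoidalCategory.fst _ _ ▷ Δ[1] ≫ s k)) c (by
        symm
        refine comp_glueEnds _ _ _ _ fun k m x hx => ?_
        refine (ConcreteCategory.congr_hom (congr_app (has k) m) x.1).symm.trans ?_
        exact congrArg (a.app m) (eq_cylEnd k ((W ◁ ∂Δ[1].ι).app m x) hx).symm) hac (by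
        refine glueEnds_comp _ _ _ _ fun k m x hx => ?_
        refine (ConcreteCategory.congr_hom (congr_app (hsc k) m)
          ((x.1.1, x.2) : (W ⊗ Δ[1]).obj m)).trans ?_
        exact congrArg (c.app m) (key k m x hx).symm)
  refine ⟨cylEnd _ 1 ≫ l, fun k => ?_, by rw [Category.assoc, h₃]⟩
  ext m x
  refine (ConcreteCategory.congr_hom (congr_app h₂ m)
    (((cylEndBoundary W k).app m x, ((cylEnd W 1).app m x).2) :
      ((W ⊗ (∂Δ[1] : SSet.{w})) ⊗ Δ[1]).obj m)).trans
        ((glueEnds_app _ _ (k := k) ?_).trans ?_)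
  · exact vtx_cylEndBoundary k x 0
  · rfl

/-! ### Homotopies and weak equivalences -/

/-- Two maps are homotopic if they are the ends of one simplicial homotopy. -/
def Homotopic {X Y : SSet.{w}} (f g : X ⟶ Y) : Prop :=
  ∃ h : X ⊗ Δ[1] ⟶ Y, cylEnd X 0 ≫ h = f ∧ cylEnd X 1 ≫ h = g

lemma homotopic_iff {X Y : SSet.{w}} (f g : X ⟶ Y) :
    Homotopic f g ↔ Nonempty (SSet.Homotopy f g) := by
  constructor
  · rintro ⟨h, h₀, h₁⟩
    exact ⟨RelativeMorphism.Homotopy.mk h h₀ h₁ (by ext n ⟨⟨x, hx⟩, y⟩; exact hx.elim)⟩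
  · rintro ⟨H⟩
    exact ⟨H.h, H.h₀, H.h₁⟩

namespace Homotopic

variable {X Y Z : SSet.{w}}

lemma refl (f : X ⟶ Y) : Homotopic f f :=
  ⟨SemiCartesianMonoidalCategory.fst _ _ ≫ f, rfl, rfl⟩

lemma precomp (i : X ⟶ Y) {f g : Y ⟶ Z} (h : Homotopic f g) : Homotopic (i ≫ f) (i ≫ g) := by
  obtain ⟨h, rfl, rfl⟩ := h
  exact ⟨i ▷ Δ[1] ≫ h, rfl, rfl⟩

lemma postcomp {f g : X ⟶ Y} (h : Homotopic f g) (p : Y ⟶ Z) : Homotopic (f ≫ p) (g ≫ p) := by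
  obtain ⟨h, rfl, rfl⟩ := h
  exact ⟨h ≫ p, rfl, rfl⟩

/-- Homotopies into a Kan complex satisfy the Euclidean property. -/
lemma euclid {K : SSet.{w}} (hK : KanComplex K) {f f' g g' : X ⟶ K} (h : Homotopic f f')
    (h₀ : Homotopic f g) (h₁ : Homotopic f' g') : Homotopic g g' := by
  rw [kanComplex_iff_kanFibration] at hK
  obtain ⟨a, ha₀, ha₁⟩ := h
  obtain ⟨b₀, hb₀, hb₀'⟩ := h₀
  obtain ⟨b₁, hb₁, hb₁'⟩ := h₁
  obtain ⟨t, ht, -⟩ := exists_square_lift hK a ![b₀, b₁] (terminal.from _)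
    (fun k => by fin_cases k <;> simp [*]) (Subsingleton.elim _ _) (fun _ => Subsingleton.elim _ _)
  exact ⟨t, (ht 0).trans hb₀', (ht 1).trans hb₁'⟩

lemma symm {K : SSet.{w}} (hK : KanComplex K) {f g : X ⟶ K} (h : Homotopic f g) : Homotopic g f :=
  euclid hK (refl f) h (refl f)

lemma trans {K : SSet.{w}} (hK : KanComplex K) {f g k : X ⟶ K} (h : Homotopic f g)
    (h' : Homotopic g k) : Homotopic f k :=
  euclid hK h (refl f) h'

end Homotopic

/-- The class of a map in `[X, K]`. -/
def HomotopyClasses.mk {X K : SSet.{w}} (f : X ⟶ K) : HomotopyClasses X K := Quot.mk _ f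

lemma HomotopyClasses.mk_surjective {X K : SSet.{w}} :
    Function.Surjective (HomotopyClasses.mk (X := X) (K := K)) := Quot.mk_surjective

lemma HomotopyClasses.precomp_mk {X Y K : SSet.{w}} (f : X ⟶ Y) (g : Y ⟶ K) :
    HomotopyClasses.precomp f K (.mk g) = .mk (f ≫ g) := rfl

lemma HomotopyClasses.sound {X K : SSet.{w}} {f g : X ⟶ K} (h : Homotopic f g) :
    HomotopyClasses.mk f = .mk g :=
  Quot.sound ((homotopic_iff f g).1 h)

lemma HomotopyClasses.mk_eq_iff {X K : SSet.{w}} (hK : KanComplex K) (f g : X ⟶ K) :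
    HomotopyClasses.mk f = .mk g ↔ Homotopic f g := by
  refine ⟨fun h => ?_, HomotopyClasses.sound⟩
  replace h := Quot.eqvGen_exact h
  induction h with
  | rel f g h => exact (homotopic_iff f g).2 h
  | refl f => exact .refl f
  | symm f g _ ih => exact ih.symm hK
  | trans f g k _ _ ih ih' => exact ih.trans hK ih'

/-- The functor `[-, K]`. -/
def homotopyClassesFunctor (K : SSet.{w}) : SSet.{w}ᵒᵖ ⥤ Type w where
  obj X := HomotopyClasses X.unop K
  map f := ↾(HomotopyClasses.precomp f.unop K)
  map_id X := by
    ext x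
    obtain ⟨f, rfl⟩ := HomotopyClasses.mk_surjective x
    exact congrArg HomotopyClasses.mk (Category.id_comp f)
  map_comp i j := by
    ext x
    obtain ⟨f, rfl⟩ := HomotopyClasses.mk_surjective x
    exact congrArg HomotopyClasses.mk (Category.assoc _ _ f)

lemma weakEquiv_iff_isIso {X Y : SSet.{w}} (f : X ⟶ Y) :
    weakEquiv f ↔ ∀ K : SSet.{w}, KanComplex K → IsIso ((homotopyClassesFunctor K).map f.op) :=
  forall_congr' fun K => forall_congr' fun _ =>
    (isIso_iff_bijective ((homotopyClassesFunctor K).map f.op)).symm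

lemma weakEquiv_iff {X Y : SSet.{w}} (f : X ⟶ Y) :
    weakEquiv f ↔ ∀ K : SSet.{w}, KanComplex K →
      (∀ g : X ⟶ K, ∃ g' : Y ⟶ K, Homotopic (f ≫ g') g) ∧
      ∀ g g' : Y ⟶ K, Homotopic (f ≫ g) (f ≫ g') → Homotopic g g' := by
  refine forall_congr' fun K => forall_congr' fun hK => ?_
  rw [Function.Bijective, and_comm]
  refine and_congr ⟨fun h g => ?_, fun h x => ?_⟩ ⟨fun h g g' hg => ?_, fun h x x' hx => ?_⟩
  · obtain ⟨x, hx⟩ := h (.mk g)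
    obtain ⟨g', rfl⟩ := HomotopyClasses.mk_surjective x
    exact ⟨g', (HomotopyClasses.mk_eq_iff hK _ _).1 hx⟩
  · obtain ⟨g, rfl⟩ := HomotopyClasses.mk_surjective x
    obtain ⟨g', hg'⟩ := h g
    exact ⟨.mk g', HomotopyClasses.sound hg'⟩
  · exact (HomotopyClasses.mk_eq_iff hK _ _).1 (h (HomotopyClasses.sound hg))
  · obtain ⟨g, rfl⟩ := HomotopyClasses.mk_surjective x
    obtain ⟨g', rfl⟩ := HomotopyClasses.mk_surjective x'
    exact HomotopyClasses.sound (h g g' ((HomotopyClasses.mk_eq_iff hK _ _).1 hx))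

instance : weakEquiv.{w}.HasTwoOutOfThreeProperty where
  comp_mem f g hf hg := by
    simp only [weakEquiv_iff_isIso, op_comp, Functor.map_comp] at *
    intro K hK
    have := hf K hK
    have := hg K hK
    infer_instance
  of_postcomp f g hg hfg := by
    simp only [weakEquiv_iff_isIso, op_comp, Functor.map_comp] at *
    intro K hK
    have h₁ := hg K hK
    have h₂ := hfg K hK
    exact IsIso.of_isIso_comp_left ((homotopyClassesFunctor K).map g.op)
      ((homotopyClassesFunctor K).map f.op)
  of_precomp f g hf hfg := by
    simp only [weakEquiv_iff_isIso, op_comp, Functor.map_comp] at *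
    intro K hK
    have h₁ := hf K hK
    have h₂ := hfg K hK
    exact IsIso.of_isIso_comp_right _ ((homotopyClassesFunctor K).map f.op)

lemma weakEquiv_of_isIso {X Y : SSet.{w}} (f : X ⟶ Y) [IsIso f] : weakEquiv f :=
  (weakEquiv_iff_isIso f).2 fun _ _ => inferInstance

/-- Simplicial homotopy equivalences are weak equivalences. -/
lemma weakEquiv_of_homotopyInverse {X Y : SSet.{w}} (f : X ⟶ Y) (g : Y ⟶ X)
    (hfg : HomotopyClasses.mk (f ≫ g) = .mk (𝟙 X))
    (hgf : HomotopyClasses.mk (g ≫ f) = .mk (𝟙 Y)) : weakEquiv f := by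
  have key : ∀ {Z Z' K : SSet.{w}} {a b : Z ⟶ Z'}, HomotopyClasses.mk a = .mk b →
      ∀ k : Z' ⟶ K, HomotopyClasses.mk (a ≫ k) = .mk (b ≫ k) := by
    intro Z Z' K a b h k
    exact congrArg (Quot.lift (fun a => HomotopyClasses.mk (a ≫ k)) fun a b hab =>
      HomotopyClasses.sound (((homotopic_iff a b).2 hab).postcomp k)) h
  rw [weakEquiv_iff]
  intro K hK
  refine ⟨fun k => ⟨g ≫ k, ?_⟩, fun k k' h => ?_⟩
  · rw [← HomotopyClasses.mk_eq_iff hK, ← Category.assoc, key hfg, Category.id_comp]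
  · rw [← HomotopyClasses.mk_eq_iff hK] at h ⊢
    have := congrArg (HomotopyClasses.precomp g K) h
    simp only [HomotopyClasses.precomp_mk, ← Category.assoc, key hgf, Category.id_comp] at this
    exact this

lemma weakEquiv_of_anodyne {X Y : SSet.{w}} {f : X ⟶ Y} (hf : anodyneExtensions f) :
    weakEquiv f := by
  rw [weakEquiv_iff]
  intro K hK
  have hK' := (kanComplex_iff_kanFibration K).1 hK
  refine ⟨fun g => ?_, fun g g' ⟨h, h₀, h₁⟩ => ?_⟩
  · have sq : CommSq g f (terminal.from K) (terminal.from Y) := ⟨Subsingleton.elim _ _⟩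
    have := hf _ hK'
    exact ⟨sq.lift, by rw [sq.fac_left]; exact .refl g⟩
  · obtain ⟨l, hl, -⟩ := exists_extend_homotopy hf hK' ![g, g'] h (terminal.from _)
      (fun k => by fin_cases k <;> simp [*]) (fun _ => Subsingleton.elim _ _)
      (Subsingleton.elim _ _)
    exact ⟨l, hl 0, hl 1⟩

/-- Trivial fibrations have a section over which they deformation retract fibrewise. -/
lemma trivialFibration.exists_section {E B : SSet.{w}} {p : E ⟶ B} (hp : trivialFibration p) :
    ∃ (s : B ⟶ E) (h : E ⊗ Δ[1] ⟶ E), s ≫ p = 𝟙 B ∧ cylEnd E 0 ≫ h = 𝟙 E ∧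
      cylEnd E 1 ≫ h = p ≫ s ∧ h ≫ p = SemiCartesianMonoidalCategory.fst _ _ ≫ p ∧
      s ▷ Δ[1] ≫ h = SemiCartesianMonoidalCategory.fst _ _ ≫ s := by
  have sq : CommSq (Subcomplex.isInitialBot.to E) (⊥ : B.Subcomplex).ι p (𝟙 B) :=
    ⟨Subcomplex.isInitialBot.hom_ext _ _⟩
  have : HasLiftingProperty (⊥ : B.Subcomplex).ι p :=
    hp _ (MorphismProperty.monomorphisms.infer_property _)
  have hs := sq.fac_right
  have : IsSplitMono sq.lift := ⟨⟨p, hs⟩⟩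
  obtain ⟨h, h₀, h₁, h₂⟩ := exists_lift_homotopy sq.lift hp ![𝟙 E, p ≫ sq.lift]
    (SemiCartesianMonoidalCategory.fst _ _ ≫ sq.lift) (SemiCartesianMonoidalCategory.fst _ _ ≫ p)
    (by
      intro k
      fin_cases k
      · rfl
      · change sq.lift ≫ p ≫ sq.lift = sq.lift
        rw [reassoc_of% hs]) (by
      intro k
      fin_cases k
      · rfl
      · change (p ≫ sq.lift) ≫ p = p
        rw [Category.assoc, hs, Category.comp_id]) rfl
  exact ⟨sq.lift, h, hs, h₀ 0, h₀ 1, h₂, h₁⟩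

lemma weakEquiv_of_trivialFibration {E B : SSet.{w}} {p : E ⟶ B} (hp : trivialFibration p) :
    weakEquiv p := by
  obtain ⟨s, h, hs, h₀, h₁, -⟩ := hp.exists_section
  exact weakEquiv_of_homotopyInverse p s (HomotopyClasses.sound ⟨h, h₀, h₁⟩).symm
    (congrArg HomotopyClasses.mk hs)

/-- The homotopy lifting property of Kan fibrations. -/
lemma kanFibration.exists_homotopy_lift {W E B : SSet.{w}} {p : E ⟶ B} (hp : kanFibration p)
    (e : Fin 2) (a : W ⟶ E) (c : W ⊗ Δ[1] ⟶ B) (hac : a ≫ p = cylEnd W e ≫ c) :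
    ∃ l : W ⊗ Δ[1] ⟶ E, cylEnd W e ≫ l = a ∧ l ≫ p = c := by
  obtain ⟨l, h₁, -, h₂⟩ := exists_lift_cylinder (⊥ : W.Subcomplex).ι hp e a
    { app := fun m => ↾fun x => x.1.2.elim
      naturality := fun m m' θ => by ext x; exact x.1.2.elim } c
    (by ext m x; exact x.2.elim) hac (by ext m x; exact x.1.2.elim)
  exact ⟨l, h₁, h₂⟩

/-- A Kan fibration with Kan base which is a weak equivalence is a trivial fibration: a homotopy
inverse can be made a section, the homotopy can be made fibrewise, and the
relative homotopy lifting property then applies. -/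
lemma trivialFibration_of_weakEquiv_of_kanComplex {E B : SSet.{w}} {p : E ⟶ B} (hp : kanFibration p)
    (hp' : weakEquiv p) (hB : KanComplex B) : trivialFibration p := by
  have hE : KanComplex E := by
    rw [kanComplex_iff_kanFibration] at hB ⊢
    rw [← terminal.comp_from p]
    exact MorphismProperty.comp_mem (W := modelCategoryQuillen.J.rlp) _ _ hp hB
  rw [weakEquiv_iff] at hp'
  obtain ⟨s₀, hs₀⟩ := (hp' E hE).1 (𝟙 E)
  have hs₀' : Homotopic (s₀ ≫ p) (𝟙 B) := (hp' B hB).2 _ _ (by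
    rw [← Category.assoc, Category.comp_id]
    simpa using hs₀.postcomp p)
  obtain ⟨k, hk₀, hk₁⟩ := hs₀'
  obtain ⟨k', hk'₀, hk'⟩ := hp.exists_homotopy_lift 0 s₀ k hk₀.symm
  obtain ⟨s, hs⟩ : ∃ s, s = cylEnd _ 1 ≫ k' := ⟨_, rfl⟩
  have hsp : s ≫ p = 𝟙 B := by rw [hs, Category.assoc, hk', hk₁]
  obtain ⟨H, hH₀, hH₁⟩ : Homotopic (p ≫ s) (𝟙 E) :=
    (Homotopic.precomp p ⟨k', hk'₀, hs.symm⟩ |>.symm hE).trans hE hs₀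
  obtain ⟨t, ht, ht'⟩ := exists_square_lift hp (SemiCartesianMonoidalCategory.fst _ _ ≫ p ≫ s)
    ![H ≫ p ≫ s, H] (SemiCartesianMonoidalCategory.fst _ _ ▷ Δ[1] ≫ H ≫ p) (by
      intro k
      fin_cases k
      · change p ≫ s = (cylEnd _ 0 ≫ H) ≫ p ≫ s
        rw [hH₀, Category.assoc, reassoc_of% hsp]
      · exact hH₀.symm) (by
      change SemiCartesianMonoidalCategory.fst _ _ ≫ (p ≫ s) ≫ p =
        SemiCartesianMonoidalCategory.fst _ _ ≫ (cylEnd _ 0 ≫ H) ≫ p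
      rw [hH₀]) (by
      intro k
      fin_cases k
      · change H ≫ p ≫ s ≫ p = H ≫ p
        rw [hsp, Category.comp_id]
      · rfl)
  have ht₀ : cylEnd E 0 ≫ t = p ≫ s := (ht 0).trans (by
    change (cylEnd E 1 ≫ H) ≫ p ≫ s = _
    rw [hH₁, Category.id_comp])
  have ht₁ : cylEnd E 1 ≫ t = 𝟙 E := (ht 1).trans hH₁
  have htp : t ≫ p = SemiCartesianMonoidalCategory.fst _ _ ≫ p := ht'.trans (by
    change SemiCartesianMonoidalCategory.fst _ _ ≫ (cylEnd _ 1 ≫ H) ≫ p = _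
    rw [hH₁, Category.id_comp])
  intro V W j hj
  have : Mono j := hj
  refine ⟨fun {f g} sq => ?_⟩
  obtain ⟨l, hl₀, hl₁, hl₂⟩ := exists_lift_cylinder j hp 0 (g ≫ s) (f ▷ Δ[1] ≫ t)
    (SemiCartesianMonoidalCategory.fst _ _ ≫ g) (by
      change j ≫ g ≫ s = f ≫ cylEnd E 0 ≫ t
      rw [ht₀, sq.w_assoc]) (by
      rw [Category.assoc, hsp, Category.comp_id, cylEnd_fst_assoc]) (by
      rw [Category.assoc, htp]
      change SemiCartesianMonoidalCategory.fst _ _ ≫ f ≫ p = SemiCartesianMonoidalCategory.fst _ _ ≫ j ≫ g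
      rw [sq.w])
  refine ⟨⟨⟨cylEnd _ 1 ≫ l, ?_, ?_⟩⟩⟩
  · change cylEnd V 1 ≫ j ▷ Δ[1] ≫ l = f
    rw [hl₁]
    change f ≫ cylEnd E 1 ≫ t = f
    rw [ht₁, Category.comp_id]
  · rw [Category.assoc, hl₂, cylEnd_fst_assoc]

lemma map_id_app (X : SSet.{w}) {m : SimplexCategoryᵒᵖ} (x : X.obj m) : X.map (𝟙 m) x = x := by
  rw [CategoryTheory.Functor.map_id]; rfl

lemma map_comp_app (X : SSet.{w}) {m m' m'' : SimplexCategoryᵒᵖ} (θ : m ⟶ m') (η : m' ⟶ m'')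
    (x : X.obj m) : X.map (θ ≫ η) x = X.map η (X.map θ x) :=
  Functor.map_comp_apply X θ η x

lemma app_map {X Y : SSet.{w}} (f : X ⟶ Y) {m m' : SimplexCategoryᵒᵖ} (θ : m ⟶ m') (x : X.obj m) :
    f.app m' (X.map θ x) = Y.map θ (f.app m x) :=
  NatTrans.naturality_apply f θ x

lemma hom_ext_app {X Y : SSet.{w}} {f g : X ⟶ Y} (h : ∀ m (x : X.obj m), f.app m x = g.app m x) :
    f = g :=
  NatTrans.ext (funext fun m => ConcreteCategory.hom_ext _ _ (h m))

lemma congr_app_apply {X Y : SSet.{w}} {f g : X ⟶ Y} (h : f = g) {m : SimplexCategoryᵒᵖ}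
    (x : X.obj m) : f.app m x = g.app m x := by rw [h]

/-! ### Fibre products and pushforwards of simplicial sets -/

section FibProd

variable {X Y B E : SSet.{w}}

/-- The fibre product of simplicial sets, with its explicit simplices. -/
def fibProd (f : X ⟶ B) (p : E ⟶ B) : SSet.{w} where
  obj m := { x : X.obj m × E.obj m // f.app m x.1 = p.app m x.2 }
  map θ := ↾fun x => ⟨(X.map θ x.1.1, E.map θ x.1.2), by
    rw [app_map, app_map, x.2]⟩
  map_id m := ConcreteCategory.hom_ext _ _ fun x =>
    Subtype.ext (Prod.ext (map_id_app _ _) (map_id_app _ _))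
  map_comp θ η := ConcreteCategory.hom_ext _ _ fun x =>
    Subtype.ext (Prod.ext (map_comp_app _ _ _ _) (map_comp_app _ _ _ _))

namespace fibProd

variable (f : X ⟶ B) (p : E ⟶ B)

/-- The first projection. -/
def fst : fibProd f p ⟶ X where
  app m := ↾fun x => x.1.1

/-- The second projection. -/
def snd : fibProd f p ⟶ E where
  app m := ↾fun x => x.1.2

lemma condition : fst f p ≫ f = snd f p ≫ p := by
  refine hom_ext_app fun m x => ?_
  exact x.2

variable {f p}

lemma ext_elt {m : SimplexCategoryᵒᵖ} {x y : (fibProd f p).obj m} (h₁ : x.1.1 = y.1.1)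
    (h₂ : x.1.2 = y.1.2) : x = y := Subtype.ext (Prod.ext h₁ h₂)

/-- The map to the fibre product with given components. -/
def lift (a : Y ⟶ X) (b : Y ⟶ E) (h : a ≫ f = b ≫ p) : Y ⟶ fibProd f p where
  app m := ↾fun y => ⟨(a.app m y, b.app m y), ConcreteCategory.congr_hom (congr_app h m) y⟩
  naturality m m' θ := by
    refine ConcreteCategory.hom_ext _ _ fun y => ?_
    exact ext_elt (app_map a θ y) (app_map b θ y)

@[simp]
lemma lift_fst (a : Y ⟶ X) (b : Y ⟶ E) (h : a ≫ f = b ≫ p) : lift a b h ≫ fst f p = a := rfl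

@[simp]
lemma lift_snd (a : Y ⟶ X) (b : Y ⟶ E) (h : a ≫ f = b ≫ p) : lift a b h ≫ snd f p = b := rfl

lemma hom_ext {a b : Y ⟶ fibProd f p} (h₁ : a ≫ fst f p = b ≫ fst f p)
    (h₂ : a ≫ snd f p = b ≫ snd f p) : a = b := by
  refine hom_ext_app fun m y => ?_
  exact ext_elt (congr_app_apply h₁ y)
    (congr_app_apply h₂ y)

variable (f p)

lemma isPullback : IsPullback (fst f p) (snd f p) f p :=
  ⟨⟨condition f p⟩, ⟨PullbackCone.IsLimit.mk _ (fun s => lift s.fst s.snd s.condition)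
    (fun _ => lift_fst _ _ _) (fun _ => lift_snd _ _ _)
    (fun _ _ h₁ h₂ => hom_ext h₁ h₂)⟩⟩

/-- The map of fibre products induced by a map to `X`. -/
def map (j : Y ⟶ X) : fibProd (j ≫ f) p ⟶ fibProd f p :=
  lift (fst _ _ ≫ j) (snd _ _) (by rw [Category.assoc, condition])

instance (j : Y ⟶ X) [Mono j] : Mono (map f p j) := by
  rw [mono_iff_injective]
  intro m x y h
  refine ext_elt ((mono_iff_injective j).1 inferInstance m ?_) ?_
  · exact congrArg (fun z : (fibProd f p).obj m => z.1.1) h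
  · exact congrArg (fun z : (fibProd f p).obj m => z.1.2) h

instance [Mono f] : Mono (snd f p) := by
  rw [mono_iff_injective]
  intro m x y h
  refine ext_elt ((mono_iff_injective f).1 inferInstance m ?_) h
  rw [x.2, y.2]
  exact congrArg (p.app m) h

variable {f p}

lemma fst_mem_rlp {W : MorphismProperty SSet.{w}} (hp : W.rlp p) : W.rlp (fst f p) :=
  MorphismProperty.of_isPullback (isPullback f p).flip hp

end fibProd

end FibProd

section Push

variable {B E Z : SSet.{w}} (p : E ⟶ B) (q : Z ⟶ E)

/-- A simplex of the pushforward of `q : Z ⟶ E` along `p : E ⟶ B`: a simplex of `B`,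
with a section of `q` over the corresponding pullback of `E`. -/
structure PushElt (n : SimplexCategoryᵒᵖ) where
  /-- the simplex of the base -/
  base : B.obj n
  /-- the values of the section -/
  sec : ∀ {m : SimplexCategoryᵒᵖ} (θ : n ⟶ m) (e : E.obj m), p.app m e = B.map θ base → Z.obj m
  isSection : ∀ {m : SimplexCategoryᵒᵖ} (θ : n ⟶ m) (e : E.obj m) (h : p.app m e = B.map θ base),
    q.app m (sec θ e h) = e
  nat : ∀ {m m' : SimplexCategoryᵒᵖ} (θ : n ⟶ m) (α : m ⟶ m') (e : E.obj m)
    (h : p.app m e = B.map θ base), Z.map α (sec θ e h) = sec (θ ≫ α) (E.map α e)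
      (by rw [app_map, h, map_comp_app])

variable {p q}

lemma PushElt.ext {n : SimplexCategoryᵒᵖ} {x y : PushElt p q n} (h : x.base = y.base)
    (h' : ∀ {m : SimplexCategoryᵒᵖ} (θ : n ⟶ m) (e : E.obj m) (h₁ : p.app m e = B.map θ x.base)
      (h₂ : p.app m e = B.map θ y.base), x.sec θ e h₁ = y.sec θ e h₂) : x = y := by
  obtain ⟨b, s, _, _⟩ := x
  obtain ⟨b', s', _, _⟩ := y
  obtain rfl : b = b' := h
  congr
  funext m θ e h₁
  exact h' θ e h₁ h₁

lemma PushElt.sec_congr {n m : SimplexCategoryᵒᵖ} (x : PushElt p q n) {θ θ' : n ⟶ m} {e e' : E.obj m}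
    (hθ : θ = θ') (he : e = e') (h : p.app m e = B.map θ x.base) :
    x.sec θ e h = x.sec θ' e' (hθ ▸ he ▸ h) := by
  subst hθ he; rfl

variable (p q)

/-- The pushforward of `q : Z ⟶ E` along `p : E ⟶ B`. -/
def push : SSet.{w} where
  obj n := PushElt p q n
  map α := ↾fun x =>
    { base := B.map α x.base
      sec := fun θ e h => x.sec (α ≫ θ) e (by rw [h, map_comp_app])
      isSection := fun θ e h => x.isSection _ _ _
      nat := fun θ β e h => by
        rw [x.nat]
        exact x.sec_congr (by simp) rfl _ }
  map_id n := by
    refine ConcreteCategory.hom_ext _ _ fun x => ?_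
    exact PushElt.ext (by simp) fun θ e h₁ h₂ => x.sec_congr (by simp) rfl _
  map_comp α β := by
    refine ConcreteCategory.hom_ext _ _ fun x => ?_
    exact PushElt.ext (by simp) fun θ e h₁ h₂ => x.sec_congr (by simp) rfl _

lemma PushElt.sec_eq_of_eq_map {p : E ⟶ B} {q : Z ⟶ E} {n n' m : SimplexCategoryᵒᵖ}
    {x : PushElt p q n'} {y : PushElt p q n} {α : n ⟶ n'}
    (hxy : x = (push p q).map α y) {θ : n' ⟶ m} {η : n ⟶ m} (hθ : α ≫ θ = η)
    {e e' : E.obj m} (he : e = e') (h : p.app m e = B.map θ x.base)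
    (h' : p.app m e' = B.map η y.base) : x.sec θ e h = y.sec η e' h' := by
  subst hxy hθ he
  rfl

/-- The structure map of the pushforward. -/
def pushProj : push p q ⟶ B where
  app n := ↾fun x => x.base

variable {p q}

/-- The map to the pushforward given by a map on the fibre product. -/
def toPush {X : SSet.{w}} {f : X ⟶ B} (ψ : fibProd f p ⟶ Z) (hψ : ψ ≫ q = fibProd.snd f p) :
    X ⟶ push p q where
  app n := ↾fun x =>
    { base := f.app n x
      sec := fun {m} θ e h => ψ.app m ⟨(X.map θ x, e), by rw [h, app_map]⟩
      isSection := fun {m} θ e h => ConcreteCategory.congr_hom (congr_app hψ m) _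
      nat := fun {m m'} θ α e h => (app_map ψ α _).symm.trans
        (congrArg (ψ.app m') (fibProd.ext_elt (map_comp_app _ _ _ _).symm rfl)) }
  naturality m m' α := by
    refine ConcreteCategory.hom_ext _ _ fun x => ?_
    refine PushElt.ext (app_map f α x) fun θ e h₁ h₂ => ?_
    refine congrArg (ψ.app _) (fibProd.ext_elt (map_comp_app _ _ _ _).symm rfl)

lemma toPush_pushProj {X : SSet.{w}} {f : X ⟶ B} (ψ : fibProd f p ⟶ Z)
    (hψ : ψ ≫ q = fibProd.snd f p) : toPush ψ hψ ≫ pushProj p q = f := rfl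

/-- The map on the fibre product given by a map to the pushforward. -/
def ofPush {X : SSet.{w}} {f : X ⟶ B} (g : X ⟶ push p q) (hg : g ≫ pushProj p q = f) :
    fibProd f p ⟶ Z where
  app n := ↾fun x => (g.app n x.1.1).sec (𝟙 n) x.1.2 (by
    rw [map_id_app]; exact x.2.symm.trans (congr_app_apply hg x.1.1).symm)
  naturality m m' α := by
    refine ConcreteCategory.hom_ext _ _ fun x => ?_
    refine Eq.trans ?_ ((g.app m x.1.1).nat (𝟙 m) α x.1.2 _).symm
    exact PushElt.sec_eq_of_eq_map (app_map g α x.1.1) (by simp) rfl _ _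

lemma ofPush_comp {X : SSet.{w}} {f : X ⟶ B} (g : X ⟶ push p q) (hg : g ≫ pushProj p q = f) :
    ofPush g hg ≫ q = fibProd.snd f p := by
  refine hom_ext_app fun n x => ?_
  exact (g.app n x.1.1).isSection _ _ _

/-- A map has the left lifting property against a pushforward if its pullbacks have
the left lifting property against the original map. -/
lemma hasLiftingProperty_pushProj {V W : SSet.{w}} (j : V ⟶ W)
    (h : ∀ f : W ⟶ B, HasLiftingProperty (fibProd.map f p j) q) :
    HasLiftingProperty j (pushProj p q) where
  sq_hasLift {g f} sq := by
    have sq' : CommSq (ofPush g sq.w) (fibProd.map f p j) q (fibProd.snd f p) := ⟨ofPush_comp _ _⟩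
    have := h f
    refine ⟨⟨⟨toPush sq'.lift sq'.fac_right, ?_, toPush_pushProj _ _⟩⟩⟩
    refine hom_ext_app fun n x => ?_
    have hx : ∀ {m} (y : V.obj m), (g.app m y).base = f.app m (j.app m y) := fun y =>
      congr_app_apply sq.w y
    refine PushElt.ext (hx x).symm fun {m} θ e h₁ h₂ => ?_
    refine Eq.trans ?_ ((congr_app_apply sq'.fac_left (⟨(V.map θ x, e), ?_⟩ :
      (fibProd (j ≫ f) p).obj m)).trans ?_)
    · exact congrArg (sq'.lift.app m) (fibProd.ext_elt (app_map j θ x).symm rfl)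
    · change f.app m (j.app m _) = _
      rw [← hx, h₂, app_map]; rfl
    · exact PushElt.sec_eq_of_eq_map (app_map g θ x) (by simp) rfl _ _

end Push

/-! ### Anodyne extensions are stable under pullback along Kan fibrations -/

/-- A deformation of `Q` into the subobject `j : A ⟶ Q`, which preserves `A`, in one of the two
possible directions. -/
structure Deformation {A Q : SSet.{w}} (j : A ⟶ Q) where
  /-- the end of the cylinder where the deformation is the identity -/
  e : Fin 2
  /-- the end of the cylinder where the deformation has values in `A` -/
  e' : Fin 2
  /-- the deformation -/
  H : Q ⊗ Δ[1] ⟶ Q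
  /-- its value at the second end -/
  r : Q ⟶ A
  /-- its restriction to `A` -/
  k : A ⊗ Δ[1] ⟶ A
  H_e : cylEnd Q e ≫ H = 𝟙 Q
  H_e' : cylEnd Q e' ≫ H = r ≫ j
  k_j : k ≫ j = j ▷ Δ[1] ≫ H

namespace Deformation

variable {A Q : SSet.{w}} {j : A ⟶ Q} (D : Deformation j)

lemma k_e [Mono j] : cylEnd A D.e ≫ D.k = 𝟙 A := by
  rw [← cancel_mono j, Category.assoc, D.k_j]
  change j ≫ cylEnd Q D.e ≫ D.H = j
  rw [D.H_e, Category.comp_id]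

lemma k_e' [Mono j] : cylEnd A D.e' ≫ D.k = j ≫ D.r := by
  rw [← cancel_mono j, Category.assoc, D.k_j]
  change j ≫ cylEnd Q D.e' ≫ D.H = _
  rw [D.H_e', Category.assoc]

include D in
lemma anodyne [Mono j] : anodyneExtensions j := by
  intro E B q (hq : kanFibration q)
  refine ⟨fun {u v} sq => ?_⟩
  obtain ⟨l, h₀, h₁, h₂⟩ := exists_lift_cylinder j hq D.e' (D.r ≫ u) (D.k ≫ u) (D.H ≫ v)
    (by rw [← Category.assoc, ← Category.assoc, D.k_e'])
    (by rw [← Category.assoc, D.H_e', Category.assoc, sq.w, Category.assoc])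
    (by rw [Category.assoc, sq.w, ← Category.assoc, D.k_j, Category.assoc])
  refine ⟨⟨⟨cylEnd _ D.e ≫ l, ?_, ?_⟩⟩⟩
  · change cylEnd A D.e ≫ j ▷ Δ[1] ≫ l = u
    rw [h₁, ← Category.assoc, k_e, Category.id_comp]
  · rw [Category.assoc, h₂, ← Category.assoc, D.H_e, Category.id_comp]

include D in
/-- Deformations lift along Kan fibrations, by the homotopy lifting property. -/
lemma nonempty_pullback {E : SSet.{w}} {p : E ⟶ Q} (hp : kanFibration p) :
    Nonempty (Deformation (fibProd.snd j p)) := by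
  obtain ⟨H, h₀, h₁⟩ := hp.exists_homotopy_lift D.e (𝟙 E) (p ▷ Δ[1] ≫ D.H) (by
    change p = p ≫ cylEnd Q D.e ≫ D.H
    rw [D.H_e, Category.comp_id])
  exact ⟨{
    e := D.e
    e' := D.e'
    H := H
    r := fibProd.lift (p ≫ D.r) (cylEnd _ D.e' ≫ H) (by
      rw [Category.assoc, ← D.H_e', Category.assoc, h₁]; rfl)
    k := fibProd.lift (fibProd.fst _ _ ▷ Δ[1] ≫ D.k) (fibProd.snd _ _ ▷ Δ[1] ≫ H) (by
      rw [Category.assoc, D.k_j, Category.assoc, h₁, ← comp_whiskerRight_assoc,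
        fibProd.condition, comp_whiskerRight_assoc])
    H_e := h₀
    H_e' := rfl
    k_j := rfl }⟩

end Deformation

/-- The map to a standard simplex which is given by an order preserving map on vertices. -/
def toStdSimplex {X : SSet.{w}} {n : ℕ}
    (f : ∀ m : SimplexCategoryᵒᵖ, X.obj m → (Fin (m.unop.len + 1) →o Fin (n + 1)))
    (hf : ∀ (m m' : SimplexCategoryᵒᵖ) (θ : m ⟶ m') (x : X.obj m) i,
      f m' (X.map θ x) i = f m x (θ.unop.toOrderHom i)) : X ⟶ Δ[n] where
  app m := ↾fun x => stdSimplex.objEquiv.symm (SimplexCategory.Hom.mk (f m x))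
  naturality m m' θ := by
    refine ConcreteCategory.hom_ext _ _ fun x => ?_
    apply stdSimplex.objEquiv.injective
    apply SimplexCategory.Hom.ext
    ext i : 2
    exact hf m m' θ x i

lemma stdSimplex_ext {n : ℕ} {m : SimplexCategoryᵒᵖ} {x y : (Δ[n] : SSet.{w}).obj m}
    (h : ∀ i, stdSimplex.asOrderHom x i = stdSimplex.asOrderHom y i) : x = y := by
  apply stdSimplex.objEquiv.injective
  apply SimplexCategory.Hom.ext
  ext i : 2
  exact h i

/-- A horn inclusion admits a deformation: depending on the position of the distinguished
vertex `k`, it is given by `min (-, k)` or `max (-, k)`. -/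
lemma nonempty_deformation_horn (n : ℕ) (k : Fin (n + 2)) :
    Nonempty (Deformation (Λ[n + 1, k] : SSet.Subcomplex.{w} _).ι) := by
  -- `c 0 ≤ c 1` are the identity and the retraction, in the order given by the direction
  obtain ⟨c, e, e', hc, he, hk, l, hl, he'⟩ : ∃ (c : Fin 2 → (Fin (n + 2) →o Fin (n + 2)))
      (e e' : Fin 2), c 0 ≤ c 1 ∧ (∀ i, c e i = i) ∧ (∀ t i, c t i = i ∨ c t i = k) ∧
      ∃ l, l ≠ k ∧ ∀ i, c e' i ≠ l := by
    by_cases h : k = Fin.last _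
    · subst h
      refine ⟨![OrderHom.id, ⟨fun i => max i (Fin.last _), fun i j h => max_le_max_right _ h⟩],
        0, 1, fun i => le_max_left _ _, fun i => rfl, fun t i => ?_, 0, ?_, fun i => ?_⟩
      · fin_cases t
        · exact Or.inl rfl
        · exact Or.inr (max_eq_right (Fin.le_last i))
      · exact (Fin.last_pos).ne
      · have : max i (Fin.last (n + 1)) = Fin.last _ := max_eq_right (Fin.le_last i)
        change max i (Fin.last (n + 1)) ≠ 0
        rw [this]
        exact (Fin.last_pos).ne'
    · refine ⟨![⟨fun i => min i k, fun i j h => min_le_min_right _ h⟩, OrderHom.id],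
        1, 0, fun i => min_le_left _ _, fun i => rfl, fun t i => ?_, Fin.last _, Ne.symm h, fun i => ?_⟩
      · fin_cases t
        · exact min_choice i k
        · exact Or.inl rfl
      · exact ((min_le_right i k).trans_lt (Fin.lt_last_iff_ne_last.2 h)).ne
  have hc' : ∀ a b : Fin 2, a ≤ b → c a ≤ c b := by
    intro a b hab
    fin_cases a <;> fin_cases b
    · exact le_rfl
    · exact hc
    · exact absurd hab (by decide)
    · exact le_rfl
  let H : (Δ[n + 1] ⊗ Δ[1] : SSet.{w}) ⟶ Δ[n + 1] := toStdSimplex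
    (fun m x => ⟨fun i => c (vtx x.2 i) (stdSimplex.asOrderHom x.1 i), fun i j hij => by
      have h₁ := (stdSimplex.asOrderHom x.1).monotone hij
      have h₂ : vtx x.2 i ≤ vtx x.2 j := (stdSimplex.asOrderHom x.2).monotone hij
      exact ((c _).monotone h₁).trans (hc' _ _ h₂ _)⟩) (fun m m' θ x i => rfl)
  have H_app : ∀ {m : SimplexCategoryᵒᵖ} (x : (Δ[n + 1] ⊗ Δ[1] : SSet.{w}).obj m) i,
      stdSimplex.asOrderHom (H.app m x) i = c (vtx x.2 i) (stdSimplex.asOrderHom x.1 i) :=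
    fun x i => rfl
  have h₁ : cylEnd _ e ≫ H = 𝟙 _ := hom_ext_app fun m x => stdSimplex_ext fun i => he _
  have h₂ : Subcomplex.range (cylEnd _ e' ≫ H) ≤ Λ[n + 1, k] := by
    rintro m _ ⟨x, rfl⟩ h
    rcases (h ▸ Set.mem_univ l : l ∈ _ ∪ {k}) with ⟨i, hi⟩ | h
    · exact he' _ hi
    · exact hl h
  have h₃ : Subcomplex.range ((Λ[n + 1, k] : SSet.Subcomplex.{w} _).ι ▷ Δ[1] ≫ H) ≤ Λ[n + 1, k] := by
    rintro m _ ⟨x, rfl⟩ h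
    refine x.1.2 (Set.eq_univ_of_forall fun a => ?_)
    rcases (h ▸ Set.mem_univ a : a ∈ _ ∪ {k}) with ⟨i, hi⟩ | h
    · rcases hk (vtx x.2 i) (stdSimplex.asOrderHom x.1.1 i) with h' | h'
      · exact Or.inl ⟨i, h'.symm.trans hi⟩
      · exact Or.inr (hi.symm.trans h')
    · exact Or.inr h
  exact ⟨{ e := e, e' := e', H := H, r := Subcomplex.lift _ h₂, k := Subcomplex.lift _ h₃,
           H_e := h₁, H_e' := rfl, k_j := rfl }⟩

lemma kanFibration_of_horn {E B : SSet.{w}} {p : E ⟶ B}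
    (h : ∀ (n : ℕ) (k : Fin (n + 2)), HasLiftingProperty (Λ[n + 1, k] : SSet.Subcomplex.{w} _).ι p) :
    kanFibration p := by
  intro _ _ _ hi
  simp only [modelCategoryQuillen.J, MorphismProperty.iSup_iff] at hi
  obtain ⟨n, ⟨k⟩⟩ := hi
  exact h n k

/-- The pushforward of a Kan fibration along a Kan fibration is a Kan fibration. -/
lemma kanFibration_pushProj {B E Z : SSet.{w}} {p : E ⟶ B} {q : Z ⟶ E} (hp : kanFibration p)
    (hq : kanFibration q) : kanFibration (pushProj p q) := by
  refine kanFibration_of_horn fun n k => hasLiftingProperty_pushProj _ fun f => ?_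
  obtain ⟨D⟩ := nonempty_deformation_horn.{w} n k
  obtain ⟨D'⟩ := D.nonempty_pullback (fibProd.fst_mem_rlp (f := f) hp)
  have h := D'.anodyne _ hq
  let e : fibProd (Λ[n + 1, k].ι ≫ f) p ⟶ fibProd Λ[n + 1, k].ι (fibProd.fst f p) :=
    fibProd.lift (fibProd.fst _ _) (fibProd.map f p _) rfl
  have : IsIso e := ⟨fibProd.lift (fibProd.fst _ _) (fibProd.snd _ _ ≫ fibProd.snd _ _) (by
    rw [← Category.assoc, fibProd.condition, Category.assoc, fibProd.condition, Category.assoc]),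
    rfl, fibProd.hom_ext rfl (fibProd.hom_ext (fibProd.condition _ _) rfl)⟩
  have : fibProd.map f p Λ[n + 1, k].ι = e ≫ fibProd.snd _ _ := rfl
  rw [this]
  infer_instance

/-- The Frobenius property: anodyne extensions are stable under pullback along Kan fibrations. -/
lemma anodyne_fibProd_snd {A B E : SSet.{w}} {j : A ⟶ B} (hj : anodyneExtensions j) {p : E ⟶ B}
    (hp : kanFibration p) : anodyneExtensions (fibProd.snd j p) := by
  intro Z₀ B₀ q₀ hq₀
  refine ⟨fun {u c} sq => ?_⟩
  let q : fibProd c q₀ ⟶ E := fibProd.fst c q₀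
  have hq : kanFibration q := fibProd.fst_mem_rlp hq₀
  let ψ : fibProd j p ⟶ fibProd c q₀ := fibProd.lift (fibProd.snd _ _) u sq.w.symm
  have sq' : CommSq (toPush ψ rfl) j (pushProj p q) (𝟙 B) := ⟨rfl⟩
  have := hj _ (kanFibration_pushProj hp hq)
  let s : E ⟶ fibProd (𝟙 B) p := fibProd.lift p (𝟙 E) rfl
  refine ⟨⟨⟨s ≫ ofPush sq'.lift sq'.fac_right ≫ fibProd.snd _ _, ?_, ?_⟩⟩⟩
  · refine hom_ext_app fun m x => ?_
    have h : (sq'.lift.app m (p.app m x.1.2)) = (push p q).map (𝟙 m) ((toPush ψ rfl).app m x.1.1) := by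
      rw [map_id_app, ← congr_app_apply sq'.fac_left]
      exact congrArg (sq'.lift.app m) x.2.symm
    have h' := PushElt.sec_eq_of_eq_map h (Category.id_comp (𝟙 m)) (e := x.1.2) rfl
      (by rw [map_id_app]; exact (congr_app_apply sq'.fac_right _).symm)
      (by rw [map_id_app]; exact x.2.symm)
    refine (congrArg (fun z : (fibProd c q₀).obj m => z.1.2) h').trans ?_
    exact congrArg (u.app m) (fibProd.ext_elt (map_id_app _ _) rfl)
  · have h := ofPush_comp sq'.lift sq'.fac_right
    rw [Category.assoc, Category.assoc, ← fibProd.condition]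
    change s ≫ (ofPush sq'.lift sq'.fac_right ≫ q) ≫ c = c
    rw [h]
    rfl

/-! ### Bounds on the sets of simplices -/

/-- The type `T` is large enough to contain all the types obtained from its subtypes by
countable operations. -/
structure CountablyClosed (T : Type w) : Prop where
  nat : Nonempty (ℕ ↪ T)
  pi : Nonempty ((ℕ → T) ↪ T)

lemma exists_countablyClosed (α : Type w) : ∃ T : Type w, CountablyClosed T ∧ Nonempty (α ↪ T) := by
  refine ⟨ℕ → α ⊕ ULift.{w} ℕ, ⟨⟨⟨fun n _ => Sum.inr ⟨n⟩, fun n m h => ?_⟩⟩,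
    ⟨⟨fun f n => f n.unpair.1 n.unpair.2, fun f g h => ?_⟩⟩⟩, ⟨⟨fun a _ => Sum.inl a, fun a b h => ?_⟩⟩⟩
  · simpa using congrFun h 0
  · funext n m
    simpa using congrFun h (Nat.pair n m)
  · simpa using congrFun h 0

namespace CountablyClosed

variable {T : Type w} (hT : CountablyClosed T)

include hT

lemma of_countable (α : Type*) [Countable α] : Nonempty (α ↪ T) := by
  obtain ⟨f⟩ := hT.nat
  obtain ⟨g, hg⟩ := exists_injective_nat α
  exact ⟨(⟨g, hg⟩ : α ↪ ℕ).trans f⟩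

lemma prod : Nonempty (T × T ↪ T) := by
  obtain ⟨f⟩ := hT.pi
  refine ⟨Function.Embedding.trans (β := ℕ → T)
    ⟨fun x n => if n = 0 then x.1 else x.2, fun x y h => ?_⟩ f⟩
  have h₀ := congrFun h 0
  have h₁ := congrFun h 1
  exact Prod.ext (by simpa using h₀) (by simpa using h₁)

lemma sigma {α : Type*} {β : α → Type*} (hα : Nonempty (α ↪ T)) (hβ : ∀ a, Nonempty (β a ↪ T)) :
    Nonempty ((Σ a, β a) ↪ T) := by
  obtain ⟨f⟩ := hT.prod
  obtain ⟨g⟩ := hα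
  let h := fun a => (hβ a).some
  refine ⟨Function.Embedding.trans (β := T × T) ⟨fun x => (g x.1, h x.1 x.2), ?_⟩ f⟩
  rintro ⟨a, b⟩ ⟨a', b'⟩ hab
  obtain rfl : a = a' := g.injective (congrArg Prod.fst hab)
  obtain rfl : b = b' := (h a).injective (congrArg Prod.snd hab)
  rfl

lemma arrow {α β : Type*} [Countable α] (hβ : Nonempty (β ↪ T)) : Nonempty ((α → β) ↪ T) := by
  obtain ⟨f⟩ := hT.pi
  obtain ⟨g⟩ := hβ
  obtain ⟨c, hc⟩ := exists_injective_nat α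
  obtain ⟨t⟩ := hT.nat
  refine ⟨Function.Embedding.trans (β := ℕ → T) ⟨fun x n => Function.extend c (g ∘ x) (fun _ => t 0) n, ?_⟩ f⟩
  intro x y h
  funext a
  have := congrFun h (c a)
  simp only [hc.extend_apply] at this
  exact g.injective this

end CountablyClosed

/-- All the sets of simplices of `X` embed into `T`. -/
def IsBounded (T : Type w) (X : SSet.{w}) : Prop := ∀ m, Nonempty (X.obj m ↪ T)

lemma IsBounded.of_mono {T : Type w} {X Y : SSet.{w}} (hY : IsBounded T Y) (f : X ⟶ Y) [Mono f] :
    IsBounded T X := fun m =>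
  ⟨Function.Embedding.trans ⟨f.app m, (mono_iff_injective f).1 inferInstance m⟩ (hY m).some⟩

instance : Countable SimplexCategoryᵒᵖ :=
  Function.Injective.countable (f := fun m : SimplexCategoryᵒᵖ => m.unop.len) fun _ _ h =>
    unop_injective (SimplexCategory.ext h)

instance (n : ℕ) (m : SimplexCategoryᵒᵖ) : Countable ((Δ[n] : SSet.{w}).obj m) :=
  stdSimplex.objEquiv.injective.countable

lemma IsBounded.fibProd {T : Type w} (hT : CountablyClosed T) {X E B : SSet.{w}}
    (hX : IsBounded T X) (hE : IsBounded T E) (f : X ⟶ B) (p : E ⟶ B) :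
    IsBounded T (fibProd f p) := fun m => by
  obtain ⟨e⟩ := hT.prod
  exact ⟨(Function.Embedding.subtype _).trans (((hX m).some.prodMap (hE m).some).trans e)⟩

lemma IsBounded.push {T : Type w} (hT : CountablyClosed T) {Z E B : SSet.{w}}
    (hB : IsBounded T B) (hZ : IsBounded T Z) (p : E ⟶ B) (q : Z ⟶ E)
    (hp : ∀ m (b : B.obj m), Countable { e : E.obj m // p.app m e = b }) :
    IsBounded T (push p q) := fun n => by
  let F (b : B.obj n) := (Σ (m : SimplexCategoryᵒᵖ) (θ : n ⟶ m), { e : E.obj m // p.app m e = B.map θ b }) →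
    Σ m, Z.obj m
  have h₁ : Nonempty ((Σ m, Z.obj m) ↪ T) := hT.sigma (hT.of_countable _) hZ
  have h₂ : Nonempty ((Σ b, F b) ↪ T) := hT.sigma (hB n) fun b => by
    have : ∀ m, Countable (n ⟶ m) := fun m =>
      (Quiver.Hom.unop_inj (X := n) (Y := m)).countable
    exact hT.arrow h₁
  obtain ⟨g⟩ := h₂
  refine ⟨Function.Embedding.trans ⟨fun x => (⟨x.base, fun y => ⟨_, x.sec y.2.1 y.2.2.1 y.2.2.2⟩⟩ : Σ b, F b), ?_⟩ g⟩
  intro x y hxy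
  obtain ⟨b, s, hs, hs'⟩ := x
  obtain ⟨b', s', _, _⟩ := y
  obtain rfl : b = b' := congrArg Sigma.fst hxy
  refine PushElt.ext rfl fun {m} θ e h₁ _ => ?_
  have := congrFun (eq_of_heq (Sigma.mk.inj hxy).2) ⟨m, θ, e, h₁⟩
  exact eq_of_heq (Sigma.mk.inj this).2

/-! ### Extending Kan fibrations along monomorphisms -/

lemma isPullback_of_elements {P X Y B : SSet.{w}} {a : P ⟶ X} {b : P ⟶ Y} {f : X ⟶ B} {g : Y ⟶ B}
    (w : a ≫ f = b ≫ g)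
    (h : ∀ m (x : X.obj m) (y : Y.obj m), f.app m x = g.app m y →
      ∃ z, a.app m z = x ∧ b.app m z = y)
    (h' : ∀ m (z z' : P.obj m), a.app m z = a.app m z' → b.app m z = b.app m z' → z = z') :
    IsPullback a b f g := by
  have : IsIso (fibProd.lift a b w) := by
    rw [NatTrans.isIso_iff_isIso_app]
    intro m
    rw [isIso_iff_bijective]
    refine ⟨fun z z' hz => h' m z z' ?_ ?_, fun x => ?_⟩
    · exact congrArg (fun z : (fibProd f g).obj m => z.1.1) hz
    · exact congrArg (fun z : (fibProd f g).obj m => z.1.2) hz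
    · obtain ⟨z, hz₁, hz₂⟩ := h m x.1.1 x.1.2 x.2
      exact ⟨z, fibProd.ext_elt hz₁ hz₂⟩
  exact IsPullback.of_iso (fibProd.isPullback f g) (asIso (fibProd.lift a b w)).symm (Iso.refl _)
    (Iso.refl _) (Iso.refl _) (by simp) (by simp) (by simp) (by simp)

lemma exists_of_isPullback {P X Y B : SSet.{w}} {a : P ⟶ X} {b : P ⟶ Y} {f : X ⟶ B} {g : Y ⟶ B}
    (h : IsPullback a b f g) {m : SimplexCategoryᵒᵖ} {x : X.obj m} {y : Y.obj m}
    (hxy : f.app m x = g.app m y) : ∃ z, a.app m z = x ∧ b.app m z = y := by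
  have := Limits.Types.exists_of_isPullback (h.map ((evaluation _ _).obj m)) x y hxy
  exact this

/-- The fibration `p : E ⟶ A` is the restriction along `i : A ⟶ B` of a Kan fibration over `B`,
whose sets of simplices are bounded by `T`. -/
def ExtendsAlong (T : Type w) {A B E : SSet.{w}} (i : A ⟶ B) (p : E ⟶ A) : Prop :=
  ∃ (E' : SSet.{w}) (p' : E' ⟶ B) (t : E ⟶ E'), kanFibration p' ∧ IsPullback t p p' i ∧ IsBounded T E'

section

variable {T : Type w} (hT : CountablyClosed T) {A B : SSet.{w}} {i : A ⟶ B} [Mono i]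

include hT

/-- Extensibility ascends along trivial fibrations: extend by a pushforward. -/
lemma ExtendsAlong.comp_trivialFibration {M N : SSet.{w}} {p : N ⟶ A} (h : ExtendsAlong T i p)
    {q : M ⟶ N} (hq : trivialFibration q) (hM : IsBounded T M) : ExtendsAlong T i (q ≫ p) := by
  obtain ⟨N', p', t, hp', ht, hN'⟩ := h
  have : Mono t :=
    MorphismProperty.of_isPullback (P := MorphismProperty.monomorphisms _) ht.flip
      (MorphismProperty.monomorphisms.infer_property i)
  have ht' := (mono_iff_injective t).1 this
  have hq' : trivialFibration (pushProj t q) := fun _ _ j (hj : Mono j) =>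
    hasLiftingProperty_pushProj j fun f =>
      hq _ (inferInstanceAs (Mono (fibProd.map f t j)))
  let ψ : fibProd (q ≫ t) t ⟶ M := fibProd.fst _ _
  have hψ : ψ ≫ q = fibProd.snd _ _ := by
    rw [← cancel_mono t]
    exact (Category.assoc _ _ _).trans (fibProd.condition _ _)
  refine ⟨push t q, pushProj t q ≫ p', toPush ψ hψ,
    MorphismProperty.comp_mem (W := modelCategoryQuillen.J.rlp) _ _ hq'.kanFibration hp', ?_, ?_⟩
  · refine IsPullback.paste_vert ?_ ht
    refine isPullback_of_elements rfl (fun m x y hxy => ?_) (fun m z z' hz hz' => ?_)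
    · have h₁ : t.app m y = N'.map (𝟙 m) x.base := by rw [map_id_app]; exact hxy.symm
      refine ⟨x.sec (𝟙 m) y h₁, ?_, x.isSection _ _ _⟩
      refine PushElt.ext ?_ fun {m'} θ e h₂ h₃ => ?_
      · change t.app m (q.app m _) = x.base
        rw [x.isSection]
        exact hxy.symm
      · obtain rfl : e = N.map θ y := by
          apply ht' m'
          rw [h₃, app_map]
          exact congrArg _ hxy
        refine (x.nat (𝟙 m) θ y h₁).trans (x.sec_congr (Category.id_comp θ) rfl _)
    · have hz₁ := PushElt.sec_eq_of_eq_map (α := 𝟙 m) (hz.trans (map_id_app (push t q) _).symm)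
        (Category.id_comp (𝟙 m)) (e := q.app m z) rfl (by rw [map_id_app]; rfl) (by rw [map_id_app, hz']; rfl)
      have hz₂ : M.map (𝟙 m) z = M.map (𝟙 m) z' := hz₁
      rwa [map_id_app, map_id_app] at hz₂
  · refine IsBounded.push hT hN' hM t q fun m b => ?_
    have : Subsingleton { e : N.obj m // t.app m e = b } :=
      ⟨fun x y => Subtype.ext (ht' m (x.2.trans y.2.symm))⟩
    infer_instance

omit hT in
/-- Extensibility descends along trivial fibrations: an extension of the source retracts onto
an extension of the target. -/
lemma ExtendsAlong.of_comp_trivialFibration {M E : SSet.{w}} {p : E ⟶ A} {r : M ⟶ E}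
    (hr : trivialFibration r) (h : ExtendsAlong T i (r ≫ p)) : ExtendsAlong T i p := by
  obtain ⟨M', pM, t, hpM, ht, hM'⟩ := h
  have htm : Mono t :=
    MorphismProperty.of_isPullback (P := MorphismProperty.monomorphisms _) ht.flip
      (MorphismProperty.monomorphisms.infer_property i)
  have ht' := (mono_iff_injective t).1 htm
  obtain ⟨s, h, hs, hh₀, hh₁, hhr, hhs⟩ := hr.exists_section
  have hs' : ∀ {m} (e : E.obj m), r.app m (s.app m e) = e := fun e => congr_app_apply hs e
  -- the simplices whose faces over `A` all belong to the image of the section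
  let E' : M'.Subcomplex :=
    { obj := fun n => { y | ∀ (n' : SimplexCategoryᵒᵖ) (θ : n ⟶ n') (x : M.obj n'),
        t.app n' x = M'.map θ y → s.app n' (r.app n' x) = x }
      map := fun {n n'} α y hy n'' θ x hx => hy n'' (α ≫ θ) x (by rw [hx, map_comp_app]) }
  let V : M'.Subcomplex := Subcomplex.range t ⊔ E'
  classical
  let b₀ : ∀ n, M'.obj n → (Δ[1] : SSet.{w}).obj n → M'.obj n := fun n y τ =>
    if hy : ∃ x, t.app n x = y then t.app n (h.app n (hy.choose, τ)) else y
  have b₀_t : ∀ n x τ, b₀ n (t.app n x) τ = t.app n (h.app n (x, τ)) := by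
    intro n x τ
    have hy : ∃ x', t.app n x' = t.app n x := ⟨x, rfl⟩
    have hy' : hy.choose = x := ht' n hy.choose_spec
    simp only [b₀, dif_pos hy, hy']
  have b₀_not : ∀ n y τ, (¬ ∃ x, t.app n x = y) → b₀ n y τ = y := fun n y τ hy => dif_neg hy
  have b₀_fix : ∀ n y τ, y ∈ E'.obj n → b₀ n y τ = y := by
    intro n y τ hy
    by_cases hx : ∃ x, t.app n x = y
    · obtain ⟨x, rfl⟩ := hx
      have h₁ := hy n (𝟙 n) x (map_id_app _ _).symm
      rw [b₀_t]
      conv_lhs => rw [← h₁]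
      exact congrArg (t.app n) ((congr_app_apply hhs ((r.app n x, τ) : (E ⊗ Δ[1]).obj n)).trans h₁)
    · exact b₀_not n y τ hx
  let b : (V : SSet.{w}) ⊗ Δ[1] ⟶ M' :=
    { app := fun n => ↾fun y => b₀ n y.1.1 y.2
      naturality := fun n n' θ => by
        refine ConcreteCategory.hom_ext _ _ fun y => ?_
        change b₀ n' (M'.map θ y.1.1) (Δ[1].map θ y.2) = M'.map θ (b₀ n y.1.1 y.2)
        obtain ⟨⟨y, hy⟩, τ⟩ := y
        rcases hy with ⟨x, rfl⟩ | hy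
        · change b₀ n' (M'.map θ (t.app n x)) (Δ[1].map θ τ) = M'.map θ (b₀ n (t.app n x) τ)
          rw [b₀_t, ← app_map, b₀_t, ← app_map]
          exact congrArg (t.app n') (app_map h θ ((x, τ) : (M ⊗ Δ[1]).obj n))
        · change b₀ n' (M'.map θ y) (Δ[1].map θ τ) = M'.map θ (b₀ n y τ)
          rw [b₀_fix n y τ hy, b₀_fix n' _ _ (E'.map θ hy)] }
  have hE'V : E' ≤ V := le_sup_right
  obtain ⟨l, hl₀, hlV, hlp⟩ := exists_lift_cylinder V.ι hpM 0 (𝟙 M') b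
    (SemiCartesianMonoidalCategory.fst _ _ ≫ pM) (by
      refine hom_ext_app fun n y => ?_
      obtain ⟨y, hy⟩ := y
      change y = b₀ n y _
      rcases hy with ⟨x, rfl⟩ | hy
      · rw [b₀_t]
        exact congrArg (t.app n) (congr_app_apply hh₀ x).symm
      · exact (b₀_fix n y _ hy).symm) rfl (by
      refine hom_ext_app fun n y => ?_
      obtain ⟨⟨y, hy⟩, τ⟩ := y
      change pM.app n (b₀ n y τ) = pM.app n y
      rcases hy with ⟨x, rfl⟩ | hy
      · rw [b₀_t]
        have h₁ : ∀ z, pM.app n (t.app n z) = i.app n (p.app n (r.app n z)) := fun z =>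
          congr_app_apply ht.w z
        rw [h₁, h₁]
        exact congrArg (fun z => i.app n (p.app n z))
          (congr_app_apply hhr ((x, τ) : (M ⊗ Δ[1]).obj n))
      · rw [b₀_fix n y τ hy])
  let ρ : M' ⟶ M' := cylEnd _ 1 ≫ l
  have hρp : ρ ≫ pM = pM := by
    rw [Category.assoc, hlp, cylEnd_fst_assoc]
  have hρV : ∀ n (y : M'.obj n) (hy : y ∈ V.obj n), ρ.app n y = b₀ n y ((cylEnd M' 1).app n y).2 :=
    fun n y hy => congr_app_apply hlV (((⟨y, hy⟩, ((cylEnd M' 1).app n y).2) :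
      ((V : SSet.{w}) ⊗ Δ[1]).obj n))
  have hρt : ∀ n x, ρ.app n (t.app n x) = t.app n (s.app n (r.app n x)) := by
    intro n x
    rw [hρV n _ (Or.inl ⟨x, rfl⟩), b₀_t]
    exact congrArg (t.app n) (congr_app_apply hh₁ x)
  have hρE' : Subcomplex.range ρ ≤ E' := by
    rintro n _ ⟨y, rfl⟩ n' θ x hx
    rw [← app_map] at hx
    obtain ⟨z, hz, -⟩ := exists_of_isPullback ht (x := M'.map θ y) (y := p.app n' (r.app n' x)) (by
      rw [← congr_app_apply hρp]
      change pM.app n' (ρ.app n' _) = _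
      rw [← hx]
      exact congr_app_apply ht.w x)
    rw [← hz, hρt] at hx
    rw [ht' n' hx, hs']
  have hfix : E'.ι ≫ Subcomplex.lift ρ hρE' = 𝟙 _ := by
    rw [← cancel_mono E'.ι]
    refine hom_ext_app fun n y => ?_
    exact (hρV n y.1 (hE'V n y.2)).trans (b₀_fix n _ _ y.2)
  have hst : Subcomplex.range (s ≫ t) ≤ E' := by
    rintro n _ ⟨e, rfl⟩ n' θ x hx
    rw [← app_map] at hx
    rw [ht' n' hx]
    exact congrArg (s.app n') (hs' _)
  refine ⟨E', E'.ι ≫ pM, Subcomplex.lift (s ≫ t) hst, ?_, ?_, hM'.of_mono E'.ι⟩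
  · refine MorphismProperty.of_retract (P := modelCategoryQuillen.J.rlp) (f := E'.ι ≫ pM) (g := pM)
      { i := Arrow.homMk E'.ι (𝟙 _) (by simp)
        r := Arrow.homMk (Subcomplex.lift ρ hρE') (𝟙 _) (by
          change Subcomplex.lift ρ hρE' ≫ E'.ι ≫ pM = pM ≫ 𝟙 _
          rw [Category.comp_id, ← Category.assoc]
          exact hρp)
        retract := by
          ext : 1
          · exact hfix
          · exact Category.comp_id _ } hpM
  · refine isPullback_of_elements ?_ (fun n y a hya => ?_) (fun n z z' hz _ => ?_)
    · change s ≫ t ≫ pM = p ≫ i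
      rw [ht.w, Category.assoc, reassoc_of% hs]
    · obtain ⟨y, hy⟩ := y
      obtain ⟨x, rfl, hx⟩ := exists_of_isPullback ht hya
      refine ⟨r.app n x, Subtype.ext ?_, hx⟩
      exact congrArg (t.app n) (hy n (𝟙 n) x (map_id_app _ _).symm)
    · have h₁ : t.app n (s.app n z) = t.app n (s.app n z') := congrArg Subtype.val hz
      rw [← hs' z, ht' n h₁, hs']

end

/-! ### Path objects over a deformation -/

section Path

variable {A E : SSet.{w}} (κ : A ⊗ Δ[1] ⟶ A) (p : E ⟶ A)

/-- The object over `A` whose fibre over `a` consists of the paths of `E` lying over the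
path `κ (a, -)` of `A`. -/
def pathObj : SSet.{w} :=
  push (SemiCartesianMonoidalCategory.fst A Δ[1]) (fibProd.fst κ p)

/-- The structure map of the path object. -/
def pathObjProj : pathObj κ p ⟶ A := pushProj _ _

variable {κ p}

/-- The homotopy which corresponds to a map to the path object. -/
def pathUncurry {X : SSet.{w}} (u : X ⟶ pathObj κ p) : X ⊗ Δ[1] ⟶ E :=
  fibProd.lift (SemiCartesianMonoidalCategory.fst _ _) ((u ≫ pathObjProj κ p) ▷ Δ[1]) rfl ≫
    ofPush u rfl ≫ fibProd.snd _ _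

lemma pathUncurry_comp {X : SSet.{w}} (u : X ⟶ pathObj κ p) :
    pathUncurry u ≫ p = (u ≫ pathObjProj κ p) ▷ Δ[1] ≫ κ := by
  have h := ofPush_comp u rfl
  rw [pathUncurry, Category.assoc, Category.assoc, ← fibProd.condition, reassoc_of% h]
  rfl

lemma pathUncurry_naturality {X Y : SSet.{w}} (f : X ⟶ Y) (u : Y ⟶ pathObj κ p) :
    pathUncurry (f ≫ u) = f ▷ Δ[1] ≫ pathUncurry u := rfl

/-- The map to the path object which corresponds to a homotopy. -/
def pathCurry {X : SSet.{w}} (f : X ⟶ A) (l : X ⊗ Δ[1] ⟶ E) (h : l ≫ p = f ▷ Δ[1] ≫ κ) :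
    X ⟶ pathObj κ p :=
  toPush (f := f) (fibProd.lift (fibProd.snd _ _) (CartesianMonoidalCategory.lift
    (fibProd.fst _ _) (fibProd.snd _ _ ≫ SemiCartesianMonoidalCategory.snd _ _) ≫ l) (by
      rw [Category.assoc, h, ← Category.assoc]
      congr 1
      refine hom_ext_app fun m x => Prod.ext ?_ rfl
      exact x.2.symm)) rfl

lemma pathUncurry_pathCurry {X : SSet.{w}} (f : X ⟶ A) (l : X ⊗ Δ[1] ⟶ E)
    (h : l ≫ p = f ▷ Δ[1] ≫ κ) : pathUncurry (pathCurry f l h) = l :=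
  hom_ext_app fun m _ => congrArg (l.app m) (Prod.ext (map_id_app _ _) rfl)

lemma pathObj_hom_ext {X : SSet.{w}} {u u' : X ⟶ pathObj κ p}
    (h : u ≫ pathObjProj κ p = u' ≫ pathObjProj κ p) (h' : pathUncurry u = pathUncurry u') :
    u = u' := by
  have key : ∀ (u : X ⟶ pathObj κ p) n (x : X.obj n) {m} (θ : n ⟶ m) (e : (A ⊗ Δ[1]).obj m)
      (h₁ : e.1 = A.map θ (u.app n x).base), ((u.app n x).sec θ e h₁).1.2 =
        (pathUncurry u).app m (X.map θ x, e.2) := by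
    intro u n x m θ e h₁
    refine congrArg (fun z : (fibProd κ p).obj m => z.1.2) (PushElt.sec_eq_of_eq_map
      (app_map u θ x) (Category.comp_id θ) ?_ ?_ h₁).symm
    · exact Prod.ext ((congrArg PushElt.base (app_map u θ x)).trans h₁.symm) rfl
    · exact (map_id_app _ _).symm
  refine hom_ext_app fun n x => ?_
  refine PushElt.ext (congr_app_apply h x) fun {m} θ e h₁ h₂ => ?_
  refine fibProd.ext_elt ((PushElt.isSection (q := fibProd.fst κ p) _ θ e h₁).trans
    (PushElt.isSection (q := fibProd.fst κ p) _ θ e h₂).symm) ?_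
  rw [key u n x θ e h₁, key u' n x θ e h₂, h']

/-- The evaluation of paths at an end. -/
def pathEval (κ : A ⊗ Δ[1] ⟶ A) (p : E ⟶ A) (e : Fin 2) :
    pathObj κ p ⟶ fibProd (cylEnd A e ≫ κ) p :=
  fibProd.lift (pathObjProj κ p) (cylEnd _ e ≫ pathUncurry (𝟙 _)) (by
    rw [Category.assoc, pathUncurry_comp, Category.id_comp]; rfl)

lemma pathEval_fst (κ : A ⊗ Δ[1] ⟶ A) (p : E ⟶ A) (e : Fin 2) :
    pathEval κ p e ≫ fibProd.fst _ _ = pathObjProj κ p := rfl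

lemma comp_pathEval_snd {X : SSet.{w}} (u : X ⟶ pathObj κ p) (e : Fin 2) :
    u ≫ pathEval κ p e ≫ fibProd.snd _ _ = cylEnd X e ≫ pathUncurry u := rfl

/-- The evaluations of paths at the ends are trivial fibrations, by the relative homotopy
lifting property. -/
lemma trivialFibration_pathEval (hp : kanFibration p) (e : Fin 2) :
    trivialFibration (pathEval κ p e) := by
  intro V W j (hj : Mono j)
  refine ⟨fun {u v} sq => ?_⟩
  have hu : u ≫ pathObjProj κ p = j ≫ v ≫ fibProd.fst _ _ :=
    congrArg (· ≫ fibProd.fst _ _) sq.w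
  obtain ⟨l, hl₀, hl₁, hl₂⟩ := exists_lift_cylinder j hp e (v ≫ fibProd.snd _ _) (pathUncurry u)
    ((v ≫ fibProd.fst _ _) ▷ Δ[1] ≫ κ)
    (by rw [← comp_pathEval_snd, ← Category.assoc, ← sq.w, Category.assoc])
    (by rw [Category.assoc, ← fibProd.condition]; rfl)
    (by rw [pathUncurry_comp, hu]; rfl)
  refine ⟨⟨⟨pathCurry (v ≫ fibProd.fst _ _) l hl₂, ?_, ?_⟩⟩⟩
  · refine pathObj_hom_ext hu.symm ?_
    rw [pathUncurry_naturality, pathUncurry_pathCurry, hl₁]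
  · refine fibProd.hom_ext rfl ?_
    rw [Category.assoc, comp_pathEval_snd, pathUncurry_pathCurry, hl₀]

end Path

section

variable {T : Type w} (hT : CountablyClosed T)

include hT

/-- Kan fibrations extend along a monomorphism `A ⟶ B` with a deformation into `A`. The path object
is trivially fibred both over the given fibration and over its restriction along the retraction,
and the latter is visibly the restriction of a fibration over `B`. -/
lemma ExtendsAlong.of_deformation {A B E : SSet.{w}} {i : A ⟶ B} [Mono i] (D : Deformation i)
    (hA : IsBounded T A) (hB : IsBounded T B)
    {p : E ⟶ A} (hp : kanFibration p) (hE : IsBounded T E) : ExtendsAlong T i p := by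
  -- the restriction of the fibration along the retraction extends
  have h₀ : ExtendsAlong T i (fibProd.fst (cylEnd A D.e' ≫ D.k) p) := by
    have h : cylEnd A D.e' ≫ D.k = i ≫ D.r := D.k_e'
    refine ⟨fibProd D.r p, fibProd.fst _ _, fibProd.lift (fibProd.fst _ _ ≫ i) (fibProd.snd _ _) ?_,
      fibProd.fst_mem_rlp hp, ?_, hB.fibProd hT hE _ _⟩
    · rw [← fibProd.condition, h, Category.assoc]
    · refine isPullback_of_elements rfl (fun m x a hxa => ?_) (fun m z z' hz hz' => ?_)
      · have h₁ := congr_app_apply h a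
        refine ⟨⟨(a, x.1.2), ?_⟩, fibProd.ext_elt hxa.symm rfl, rfl⟩
        rw [h₁]
        refine (congrArg (D.r.app m) ?_).trans x.2
        exact hxa.symm
      · exact fibProd.ext_elt hz' (congrArg (fun z : (fibProd D.r p).obj m => z.1.2) hz)
  have h₁ : IsBounded T (pathObj D.k p) := by
    have h : IsBounded T (A ⊗ Δ[1]) := fun m => by
      obtain ⟨f⟩ := hT.prod
      exact ⟨((hA m).some.prodMap (hT.of_countable _).some).trans f⟩
    refine IsBounded.push hT hA (h.fibProd hT hE D.k p) _ _ fun m b => ?_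
    refine Function.Injective.countable (f := fun x => x.1.2) fun x y hxy => ?_
    exact Subtype.ext (Prod.ext (x.2.trans y.2.symm) hxy)
  have h₂ := h₀.comp_trivialFibration hT (trivialFibration_pathEval hp D.e') h₁
  have h_e : fibProd.fst (cylEnd A D.e ≫ D.k) p ≫ (cylEnd A D.e ≫ D.k) = fibProd.fst _ p :=
    (congrArg (fun z => fibProd.fst (cylEnd A D.e ≫ D.k) p ≫ z) D.k_e).trans (Category.comp_id _)
  have h₃ : pathEval D.k p D.e' ≫ fibProd.fst _ _ =
    (pathEval D.k p D.e ≫ fibProd.snd (cylEnd A D.e ≫ D.k) p) ≫ p := by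
    rw [Category.assoc, ← fibProd.condition, h_e]
    exact (pathEval_fst _ _ _).trans (pathEval_fst _ _ _).symm
  rw [h₃] at h₂
  refine ExtendsAlong.of_comp_trivialFibration ?_ h₂
  have : IsIso (fibProd.snd (cylEnd A D.e ≫ D.k) p) :=
    ⟨fibProd.lift p (𝟙 _) (by rw [D.k_e]; simp), fibProd.hom_ext (by
      rw [Category.assoc, fibProd.lift_fst, ← fibProd.condition, h_e, Category.id_comp]) rfl, rfl⟩
  exact MorphismProperty.comp_mem (W := trivialFibration) _ _
    (trivialFibration_pathEval hp D.e) (MorphismProperty.rlp_of_isIso _ _)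

end

/-! ### A universe for bounded Kan fibrations -/

/-- A family of sets over the simplices of `B` with an action of simplicial operators, i.e. a
simplicial set over `B`, whose fibres are realized as subsets of the fixed type `T`.
The action is extended to `T` by the identity, which makes families equal
as soon as their fibres and the actions on them agree. -/
@[ext]
structure Family (T : Type w) (B : SSet.{w}) where
  /-- the fibres -/
  D : ∀ {m : SimplexCategoryᵒᵖ}, B.obj m → Set T
  /-- the action of simplicial operators -/
  act : ∀ {m m' : SimplexCategoryᵒᵖ} (_ : m ⟶ m'), B.obj m → T → T
  act_mem : ∀ {m m' : SimplexCategoryᵒᵖ} (θ : m ⟶ m') (b : B.obj m) t, t ∈ D b →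
    act θ b t ∈ D (B.map θ b)
  act_notMem : ∀ {m m' : SimplexCategoryᵒᵖ} (θ : m ⟶ m') (b : B.obj m) t, t ∉ D b → act θ b t = t
  act_id : ∀ {m : SimplexCategoryᵒᵖ} (b : B.obj m) t, t ∈ D b → act (𝟙 m) b t = t
  act_comp : ∀ {m m' m'' : SimplexCategoryᵒᵖ} (θ : m ⟶ m') (θ' : m' ⟶ m'') (b : B.obj m) t,
    t ∈ D b → act (θ ≫ θ') b t = act θ' (B.map θ b) (act θ b t)

namespace Family

variable {T : Type w} {B B' : SSet.{w}}

/-- The total space of a family. -/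
def total (F : Family T B) : SSet.{w} where
  obj m := { x : B.obj m × T // x.2 ∈ F.D x.1 }
  map θ := ↾fun x => ⟨(B.map θ x.1.1, F.act θ x.1.1 x.1.2), F.act_mem _ _ _ x.2⟩
  map_id m := ConcreteCategory.hom_ext _ _ fun x =>
    Subtype.ext (Prod.ext (map_id_app _ _) (F.act_id _ _ x.2))
  map_comp θ θ' := ConcreteCategory.hom_ext _ _ fun x =>
    Subtype.ext (Prod.ext (map_comp_app _ _ _ _) (F.act_comp _ _ _ _ x.2))

/-- The projection of the total space. -/
def proj (F : Family T B) : F.total ⟶ B where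
  app m := ↾fun x => x.1.1

/-- The restriction of a family. -/
def pull (F : Family T B) (f : B' ⟶ B) : Family T B' where
  D b := F.D (f.app _ b)
  act θ b t := F.act θ (f.app _ b) t
  act_mem θ b t h := by rw [app_map]; exact F.act_mem _ _ _ h
  act_notMem θ b t h := F.act_notMem _ _ _ h
  act_id b t h := F.act_id _ _ h
  act_comp θ θ' b t h := by rw [app_map]; exact F.act_comp _ _ _ _ h

/-- The total space of a restriction is a pullback. -/
lemma isPullback (F : Family T B) (f : B' ⟶ B) :
    ∃ t : (F.pull f).total ⟶ F.total, IsPullback t (F.pull f).proj F.proj f := by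
  refine ⟨{ app := fun m => ↾fun x => ⟨(f.app m x.1.1, x.1.2), x.2⟩
            naturality := fun m m' θ => ConcreteCategory.hom_ext _ _ fun x => by
              refine Subtype.ext (Prod.ext ?_ ?_)
              · exact app_map f θ x.1.1
              · rfl }, isPullback_of_elements rfl ?_ ?_⟩
  · rintro m ⟨⟨b, t⟩, h⟩ b' rfl
    exact ⟨⟨(b', t), h⟩, rfl, rfl⟩
  · intro m z z' h h'
    exact Subtype.ext (Prod.ext h' (congrArg (fun y : F.total.obj m => y.1.2) h))

open Classical in
/-- The family of the fibres of a map, realized in `T` by functions which are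
injective on fibres. -/
def ofMap {E : SSet.{w}} (p : E ⟶ B) (c : ∀ m, E.obj m → T)
    (hc : ∀ m e e', p.app m e = p.app m e' → c m e = c m e' → e = e') : Family T B where
  D {m} b := { t | ∃ e, p.app m e = b ∧ c m e = t }
  act {m m'} θ b t := if h : ∃ e, p.app m e = b ∧ c m e = t then c m' (E.map θ h.choose) else t
  act_mem {m m'} θ b t h := by
    have h : ∃ e, p.app m e = b ∧ c m e = t := h
    rw [dif_pos h]
    exact ⟨E.map θ h.choose, by rw [app_map, h.choose_spec.1], rfl⟩
  act_notMem θ b t h := dif_neg h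
  act_id {m} b t h := by
    have h : ∃ e, p.app m e = b ∧ c m e = t := h
    rw [dif_pos h, map_id_app, h.choose_spec.2]
  act_comp {m m' m''} θ θ' b t h := by
    have h : ∃ e, p.app m e = b ∧ c m e = t := h
    have h' : ∃ e, p.app m' e = B.map θ b ∧ c m' e = c m' (E.map θ h.choose) :=
      ⟨_, by rw [app_map, h.choose_spec.1], rfl⟩
    simp only [dif_pos h]
    rw [dif_pos h', map_comp_app]
    congr 2
    exact hc m' _ _ (by rw [h'.choose_spec.1, app_map, h.choose_spec.1]) h'.choose_spec.2.symm

lemma ofMap_act {E : SSet.{w}} (p : E ⟶ B) (c : ∀ m, E.obj m → T) (hc) {m m' : SimplexCategoryᵒᵖ}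
    (θ : m ⟶ m') (e : E.obj m) :
    (ofMap p c hc).act θ (p.app m e) (c m e) = c m' (E.map θ e) := by
  classical
  have h : ∃ e', p.app m e' = p.app m e ∧ c m e' = c m e := ⟨e, rfl, rfl⟩
  refine (dif_pos h).trans ?_
  rw [hc m _ _ h.choose_spec.1 h.choose_spec.2]

/-- The total space of the family of fibres of a map is its source. -/
def ofMapIso {E : SSet.{w}} (p : E ⟶ B) (c : ∀ m, E.obj m → T) (hc) :
    E ⟶ (ofMap p c hc).total where
  app m := ↾fun e => ⟨(p.app m e, c m e), e, rfl, rfl⟩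
  naturality m m' θ := ConcreteCategory.hom_ext _ _ fun e =>
    Subtype.ext (Prod.ext (app_map p θ e) (ofMap_act p c hc θ e).symm)

instance {E : SSet.{w}} (p : E ⟶ B) (c : ∀ m, E.obj m → T) (hc) : IsIso (ofMapIso p c hc) := by
  rw [NatTrans.isIso_iff_isIso_app]
  intro m
  rw [isIso_iff_bijective]
  refine ⟨fun e e' h => ?_, fun x => ?_⟩
  · have h := Subtype.ext_iff.1 h
    exact hc m e e' (congrArg Prod.fst h) (congrArg Prod.snd h)
  · obtain ⟨x, e, h₁, h₂⟩ := x
    exact ⟨e, Subtype.ext (Prod.ext h₁ h₂)⟩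

lemma kanFibration_proj_of_stdSimplex (F : Family T B)
    (h : ∀ (n : ℕ) (b : Δ[n] ⟶ B), kanFibration (F.pull b).proj) : kanFibration F.proj := by
  refine kanFibration_of_horn fun n k => ⟨fun {u b} sq => ?_⟩
  obtain ⟨t, ht⟩ := F.isPullback b
  have sq' : CommSq (ht.lift u _ sq.w) Λ[n + 1, k].ι (F.pull b).proj (𝟙 _) := ⟨by simp⟩
  have := h _ b _ (modelCategoryQuillen.horn_ι_mem_J (n + 1) k)
  refine ⟨⟨⟨sq'.lift ≫ t, ?_, ?_⟩⟩⟩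
  · rw [← Category.assoc, sq'.fac_left, ht.lift_fst]
  · rw [Category.assoc, ht.w, ← Category.assoc, sq'.fac_right, Category.id_comp]

lemma kanFibration_pull {F : Family T B} (hF : kanFibration F.proj) (f : B' ⟶ B) :
    kanFibration (F.pull f).proj := by
  obtain ⟨t, ht⟩ := F.isPullback f
  exact MorphismProperty.of_isPullback (P := modelCategoryQuillen.J.rlp) ht hF

end Family

/-- The simplicial set which classifies the Kan fibrations bounded by `T`. -/
def kanUniverse (T : Type w) : SSet.{w} where
  obj m := { F : Family T (SSet.stdSimplex.{w}.obj m.unop) // kanFibration F.proj }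
  map θ := ↾fun F => ⟨F.1.pull (SSet.stdSimplex.map θ.unop), Family.kanFibration_pull F.2 _⟩
  map_id m := ConcreteCategory.hom_ext _ _ fun F =>
    Subtype.ext (congrArg F.1.pull (SSet.stdSimplex.map_id m.unop))
  map_comp θ θ' := ConcreteCategory.hom_ext _ _ fun F =>
    Subtype.ext (congrArg F.1.pull (SSet.stdSimplex.map_comp θ'.unop θ.unop))

/-- The map from a standard simplex given by a simplex. -/
def simplexMap {B : SSet.{w}} {m : SimplexCategoryᵒᵖ} (b : B.obj m) :
    SSet.stdSimplex.{w}.obj m.unop ⟶ B := SSet.yonedaEquiv.symm b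

/-- The fundamental simplex of a standard simplex. -/
def fundSimplex (m : SimplexCategoryᵒᵖ) : (SSet.stdSimplex.{w}.obj m.unop).obj m :=
  stdSimplex.objEquiv.symm (𝟙 m.unop)

lemma simplexMap_app {B : SSet.{w}} {m m' : SimplexCategoryᵒᵖ} (b : B.obj m)
    (x : (SSet.stdSimplex.{w}.obj m.unop).obj m') :
    (simplexMap b).app m' x = B.map (stdSimplex.objEquiv x : m'.unop ⟶ m.unop).op b := rfl

lemma map_fundSimplex {m m' : SimplexCategoryᵒᵖ} (θ : m ⟶ m') :
    (SSet.stdSimplex.{w}.obj m.unop).map θ (fundSimplex m) =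
      (SSet.stdSimplex.{w}.map θ.unop).app m' (fundSimplex m') := by
  apply stdSimplex.objEquiv.injective
  change θ.unop ≫ 𝟙 _ = 𝟙 _ ≫ θ.unop
  rw [Category.comp_id, Category.id_comp]

lemma simplexMap_fundSimplex {B : SSet.{w}} {m : SimplexCategoryᵒᵖ} (b : B.obj m) :
    (simplexMap b).app m (fundSimplex m) = b := map_id_app B b

lemma simplexMap_map {B : SSet.{w}} {m m' : SimplexCategoryᵒᵖ} (b : B.obj m) (θ : m ⟶ m') :
    simplexMap (B.map θ b) = SSet.stdSimplex.map θ.unop ≫ simplexMap b :=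
  hom_ext_app fun _ x => (map_comp_app B θ _ b).symm

lemma map_objEquiv_fundSimplex {m m' : SimplexCategoryᵒᵖ}
    (x : (SSet.stdSimplex.{w}.obj m.unop).obj m') :
    (SSet.stdSimplex.{w}.map (stdSimplex.objEquiv x : m'.unop ⟶ m.unop)).app m' (fundSimplex m') = x := by
  apply stdSimplex.objEquiv.injective
  change 𝟙 _ ≫ (stdSimplex.objEquiv x : m'.unop ⟶ m.unop) = stdSimplex.objEquiv x
  exact Category.id_comp _

namespace Family

variable {T : Type w} {B : SSet.{w}}

/-- The family classified by a map to the universe. -/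
def ofHom (χ : B ⟶ kanUniverse T) : Family T B where
  D {m} b := (χ.app m b).1.D (fundSimplex m)
  act {m m'} θ b t := (χ.app m b).1.act θ (fundSimplex m) t
  act_mem θ b t h := by
    have := (χ.app _ b).1.act_mem θ _ t h
    rw [map_fundSimplex] at this
    rw [app_map]
    exact this
  act_notMem θ b t h := (χ.app _ b).1.act_notMem θ _ t h
  act_id b t h := (χ.app _ b).1.act_id _ t h
  act_comp θ θ' b t h := by
    have := (χ.app _ b).1.act_comp θ θ' _ t h
    rw [map_fundSimplex] at this
    rw [app_map]
    exact this

lemma ofHom_pull_simplexMap (χ : B ⟶ kanUniverse T) {m : SimplexCategoryᵒᵖ} (b : B.obj m) :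
    (ofHom χ).pull (simplexMap b) = (χ.app m b).1 := by
  have h : ∀ {m'} (x : (SSet.stdSimplex.{w}.obj m.unop).obj m'),
      (χ.app m' ((simplexMap b).app m' x)).1 =
        (χ.app m b).1.pull (SSet.stdSimplex.map (stdSimplex.objEquiv x)) := by
    intro m' x
    rw [simplexMap_app, app_map]
    rfl
  apply Family.ext
  · funext m' x
    change (χ.app m' ((simplexMap b).app m' x)).1.D (fundSimplex m') = _
    rw [h]
    exact congrArg (χ.app m b).1.D (map_objEquiv_fundSimplex x)
  · funext m' m'' θ x t
    change (χ.app m' ((simplexMap b).app m' x)).1.act θ (fundSimplex m') t = _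
    rw [h]
    exact congrArg (fun z => (χ.app m b).1.act θ z t) (map_objEquiv_fundSimplex x)

lemma kanFibration_ofHom (χ : B ⟶ kanUniverse T) : kanFibration (ofHom χ).proj := by
  refine kanFibration_proj_of_stdSimplex _ fun n b => ?_
  obtain ⟨b, rfl⟩ := SSet.yonedaEquiv.symm.surjective b
  have h := ofHom_pull_simplexMap χ b
  have h' := (χ.app _ b).2
  rw [← h] at h'
  exact h'

/-- The map to the universe which classifies a family. -/
def toHom (F : Family T B) (hF : kanFibration F.proj) : B ⟶ kanUniverse T where
  app m := ↾fun b => ⟨F.pull (simplexMap b), kanFibration_pull hF _⟩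
  naturality m m' θ := ConcreteCategory.hom_ext _ _ fun b =>
    Subtype.ext (congrArg F.pull (simplexMap_map b θ))

lemma ofHom_toHom (F : Family T B) (hF : kanFibration F.proj) : ofHom (F.toHom hF) = F := by
  apply Family.ext
  · funext m b
    exact congrArg F.D (simplexMap_fundSimplex b)
  · funext m m' θ b t
    exact congrArg (fun z => F.act θ z t) (simplexMap_fundSimplex b)

lemma toHom_ofHom (χ : B ⟶ kanUniverse T) : (ofHom χ).toHom (kanFibration_ofHom χ) = χ :=
  hom_ext_app fun _ b => Subtype.ext (ofHom_pull_simplexMap χ b)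

end Family

/-- The universe of bounded Kan fibrations is a Kan complex, since bounded Kan fibrations
extend along horn inclusions. -/
lemma kanComplex_kanUniverse {T : Type w} (hT : CountablyClosed T) : KanComplex (kanUniverse T) := by
  classical
  rw [kanComplex_iff_kanFibration]
  refine kanFibration_of_horn fun n k => ⟨fun {χ _} _ => ?_⟩
  suffices ∃ χ' : Δ[n + 1] ⟶ kanUniverse T, Λ[n + 1, k].ι ≫ χ' = χ by
    obtain ⟨χ', h⟩ := this
    exact ⟨⟨⟨χ', h, Subsingleton.elim _ _⟩⟩⟩
  let F := Family.ofHom χ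
  have hF := Family.kanFibration_ofHom χ
  have hΔ : IsBounded T (Δ[n + 1] : SSet.{w}) := fun m => hT.of_countable _
  have hΛ : IsBounded T (Λ[n + 1, k] : SSet.{w}) := hΔ.of_mono Λ[n + 1, k].ι
  have hFb : IsBounded T F.total := fun m => by
    obtain ⟨f⟩ := hT.prod
    exact ⟨(Function.Embedding.subtype _).trans
      (((hΛ m).some.prodMap (Function.Embedding.refl T)).trans f)⟩
  obtain ⟨D⟩ := nonempty_deformation_horn.{w} n k
  obtain ⟨E', p', t, hp', ht, hE'⟩ := ExtendsAlong.of_deformation hT D hΛ hΔ hF hFb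
  have htm : Mono t :=
    MorphismProperty.of_isPullback (P := MorphismProperty.monomorphisms _) ht.flip
      (MorphismProperty.monomorphisms.infer_property Λ[n + 1, k].ι)
  have ht' := (mono_iff_injective t).1 htm
  -- The fibres of the extension are realized in `T` such that over the horn they are, strictly,
  -- those of the given family.
  let c : ∀ m, E'.obj m → T := fun m e =>
    if h : ∃ x, t.app m x = e then h.choose.1.2 else (hE' m).some e
  have hct : ∀ m x, c m (t.app m x) = x.1.2 := by
    intro m x
    have h : ∃ x', t.app m x' = t.app m x := ⟨x, rfl⟩
    have h' : h.choose = x := ht' m h.choose_spec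
    simp only [c, dif_pos h, h']
  have hpt : ∀ m x, p'.app m (t.app m x) = x.1.1.1 := fun m x => congr_app_apply ht.w x
  have hrange : ∀ m e b, p'.app m e = b.1 → ∃ x, t.app m x = e ∧ x.1.1 = b := fun m e b h =>
    exists_of_isPullback ht (x := e) (y := b) h
  have hc : ∀ m e e', p'.app m e = p'.app m e' → c m e = c m e' → e = e' := by
    intro m e e' h h'
    by_cases hx : ∃ x, t.app m x = e
    · obtain ⟨x, rfl⟩ := hx
      obtain ⟨x', rfl, hx'⟩ := hrange m e' x.1.1 (h.symm.trans (hpt m x))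
      rw [hct, hct] at h'
      exact congrArg (t.app m) (Subtype.ext (Prod.ext hx'.symm h'))
    · have hy : ¬ ∃ y, t.app m y = e' := by
        rintro ⟨y, rfl⟩
        obtain ⟨x, hx', -⟩ := hrange m e y.1.1 (h.trans (hpt m y))
        exact hx ⟨x, hx'⟩
      simp only [c, dif_neg hx, dif_neg hy] at h'
      exact (hE' m).some.injective h'
  let F' := Family.ofMap p' c hc
  have hF' : kanFibration F'.proj := by
    have h : F'.proj = inv (Family.ofMapIso p' c hc) ≫ p' := by
      rw [IsIso.eq_inv_comp]; rfl
    rw [h]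
    exact MorphismProperty.comp_mem (W := modelCategoryQuillen.J.rlp) _ _
      (MorphismProperty.rlp_of_isIso _ _) hp'
  have hFF' : F'.pull Λ[n + 1, k].ι = F := by
    have hD : ∀ {m} (b : (Λ[n + 1, k] : SSet.{w}).obj m), F'.D b.1 = F.D b := by
      intro m b
      ext τ
      constructor
      · rintro ⟨e, h₁, rfl⟩
        obtain ⟨x, rfl, rfl⟩ := hrange m e b h₁
        rw [hct]
        exact x.2
      · intro hτ
        exact ⟨t.app m ⟨(b, τ), hτ⟩, hpt m _, hct m _⟩
    apply Family.ext
    · funext m b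
      exact hD b
    · funext m m' θ b τ
      by_cases hτ : τ ∈ F.D b
      · obtain ⟨x, rfl, rfl⟩ : ∃ x : F.total.obj m, x.1.1 = b ∧ x.1.2 = τ := ⟨⟨(b, τ), hτ⟩, rfl, rfl⟩
        have h := Family.ofMap_act p' c hc θ (t.app m x)
        rw [hpt, hct, ← app_map, hct] at h
        exact h
      · refine (F'.act_notMem θ b.1 τ ?_).trans (F.act_notMem θ b τ hτ).symm
        rw [hD]
        exact hτ
  refine ⟨F'.toHom hF', ?_⟩
  rw [← Family.toHom_ofHom χ]
  refine hom_ext_app fun m b => Subtype.ext ?_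
  change (F'.pull (simplexMap _)) = F.pull (simplexMap b)
  rw [← hFF']
  rfl

lemma anodyne_of_isPullback {A B E E' : SSet.{w}} {j : A ⟶ B} (hj : anodyneExtensions j)
    {p : E ⟶ B} (hp : kanFibration p) {t : E' ⟶ E} {p' : E' ⟶ A} (h : IsPullback t p' p j) :
    anodyneExtensions t := by
  rw [← h.flip.isoIsPullback_hom_snd _ _ (fibProd.isPullback j p)]
  exact anodyneExtensions.comp_mem _ _ (anodyneExtensions.of_isIso _) (anodyne_fibProd_snd hj hp)

/-- A Kan fibration which is a weak equivalence is a trivial fibration. It is classified by a map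
from its base to a universe; as the latter is a Kan complex, the fibration extends to one over
a Kan complex `B'` which contains the base via an anodyne extension. By the Frobenius property, the
extension is still a weak equivalence, and the case of a Kan base applies. -/
theorem trivialFibration_of_weakEquiv {E B : SSet.{w}} {p : E ⟶ B} (hp : kanFibration p)
    (hp' : weakEquiv p) : trivialFibration p := by
  obtain ⟨T, hT, ⟨f⟩⟩ := exists_countablyClosed (Σ m, E.obj m)
  let c : ∀ m, E.obj m → T := fun m e => f ⟨m, e⟩
  let F : Family T B := Family.ofMap p c fun m e e' _ h => by
    simpa using f.injective h
  have hpF : p = Family.ofMapIso p c _ ≫ F.proj := rfl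
  have hF : kanFibration F.proj := by
    have h : F.proj = inv (Family.ofMapIso p c _) ≫ p := by
      rw [IsIso.eq_inv_comp]; rfl
    rw [h]
    exact MorphismProperty.comp_mem (W := modelCategoryQuillen.J.rlp) _ _
      (MorphismProperty.rlp_of_isIso _ _) hp
  have hF' : weakEquiv F.proj := by
    rw [hpF] at hp'
    exact weakEquiv.of_precomp _ _ (weakEquiv_of_isIso _) hp'
  obtain ⟨B', j, hj, hB'⟩ : ∃ (B' : SSet.{w}) (j : B ⟶ B'), anodyneExtensions j ∧ KanComplex B' := by
    let h := MorphismProperty.factorizationData modelCategoryQuillen.J.rlp.llp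
      modelCategoryQuillen.J.rlp (terminal.from B)
    refine ⟨h.Z, h.i, h.hi, ?_⟩
    rw [kanComplex_iff_kanFibration, Subsingleton.elim (terminal.from h.Z) h.p]
    exact h.hp
  obtain ⟨χ, hχ⟩ : ∃ χ : B' ⟶ kanUniverse T, j ≫ χ = F.toHom hF := by
    have := hj _ ((kanComplex_iff_kanFibration _).1 (kanComplex_kanUniverse hT))
    have sq : CommSq (F.toHom hF) j (terminal.from (kanUniverse T)) (terminal.from B') :=
      ⟨Subsingleton.elim _ _⟩
    exact ⟨sq.lift, sq.fac_left⟩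
  let F' := Family.ofHom χ
  have hFF' : F'.pull j = F := by
    rw [← Family.ofHom_toHom F hF, ← hχ]
    rfl
  have hk : kanFibration F'.proj := Family.kanFibration_ofHom χ
  obtain ⟨t, ht⟩ := F'.isPullback j
  have ht' : weakEquiv t := weakEquiv_of_anodyne (anodyne_of_isPullback hj hk ht)
  have hk' : weakEquiv F'.proj := by
    refine weakEquiv.of_precomp t _ ht' ?_
    rw [ht.w, hFF']
    exact weakEquiv.comp_mem _ _ hF' (weakEquiv_of_anodyne hj)
  have h := MorphismProperty.of_isPullback (P := trivialFibration) ht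
    (trivialFibration_of_weakEquiv_of_kanComplex hk hk' hB')
  rw [hFF'] at h
  rw [hpF]
  exact MorphismProperty.comp_mem (W := trivialFibration) _ _ (MorphismProperty.rlp_of_isIso _ _) h

/-- A monomorphism which is a weak equivalence is an anodyne extension. -/
theorem anodyne_of_mono_of_weakEquiv {A B : SSet.{w}} (i : A ⟶ B) [Mono i] (hi : weakEquiv i) :
    anodyneExtensions i := by
  let h := MorphismProperty.factorizationData modelCategoryQuillen.J.rlp.llp
    modelCategoryQuillen.J.rlp i
  have hp : weakEquiv h.p := by
    refine weakEquiv.of_precomp h.i h.p (weakEquiv_of_anodyne h.hi) ?_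
    rwa [h.fac]
  have := trivialFibration_of_weakEquiv h.hp hp _ (MorphismProperty.monomorphisms.infer_property i)
  have sq : CommSq h.i i h.p (𝟙 _) := ⟨by simp⟩
  refine MorphismProperty.of_retract (P := anodyneExtensions) (f := i) (g := h.i)
    { i := Arrow.homMk (𝟙 _) sq.lift (by simp)
      r := Arrow.homMk (𝟙 _) h.p (by simp) } h.hi

/-! ### Diagonals of levelwise anodyne maps -/

/-- Attaching `V` to a subcomplex `M` along an anodyne extension `g⁻¹(M) ⟶ V` is anodyne. -/
lemma anodyne_homOfLE_of_cover {V Y : SSet.{w}} (g : V ⟶ Y) {M N : Y.Subcomplex} (hMN : M ≤ N)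
    (hg : anodyneExtensions (M.preimage g).ι)
    (hinj : ∀ m (v v' : V.obj m), g.app m v = g.app m v' → g.app m v ∉ M.obj m → v = v')
    (hgN : ∀ m (v : V.obj m), g.app m v ∈ N.obj m)
    (hN : ∀ m, ∀ y ∈ N.obj m, y ∈ M.obj m ∨ ∃ v, g.app m v = y) :
    anodyneExtensions (Subcomplex.homOfLE hMN) := by
  intro E Q p hp
  refine ⟨fun {a b} sq => ?_⟩
  have : HasLiftingProperty (M.preimage g).ι p := hg p hp
  let c : V ⟶ (N : SSet) :=
    { app := fun m => ↾fun v => ⟨g.app m v, hgN m v⟩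
      naturality := fun m m' θ =>
        ConcreteCategory.hom_ext _ _ fun v => Subtype.ext (app_map g θ v) }
  have sq' : CommSq (M.fromPreimage g ≫ a) (M.preimage g).ι p (c ≫ b) := ⟨by
    rw [Category.assoc, sq.w]
    rfl⟩
  have hl₁ : ∀ m (v : V.obj m) (hv : g.app m v ∈ M.obj m),
      sq'.lift.app m v = a.app m ⟨g.app m v, hv⟩ := fun m v hv =>
    congr_app_apply sq'.fac_left (m := m) ⟨v, hv⟩
  have hl₂ : ∀ m (v : V.obj m), p.app m (sq'.lift.app m v) = b.app m ⟨g.app m v, hgN m v⟩ :=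
    fun m v => congr_app_apply sq'.fac_right v
  classical
  have hex : ∀ m (y : (N : SSet).obj m), ∃ e : E.obj m,
      (∀ h : y.1 ∈ M.obj m, e = a.app m ⟨y.1, h⟩) ∧
        ∀ v, g.app m v = y.1 → e = sq'.lift.app m v := by
    rintro m ⟨y, hy⟩
    by_cases h : y ∈ M.obj m
    · refine ⟨a.app m ⟨y, h⟩, fun _ => rfl, ?_⟩
      rintro v rfl
      exact (hl₁ m v h).symm
    · obtain ⟨v, rfl⟩ := (hN m y hy).resolve_left h
      exact ⟨sq'.lift.app m v, fun h' => (h h').elim, fun v' hv' =>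
        congrArg (sq'.lift.app m) (hinj m v v' hv'.symm h)⟩
  choose l hl hl' using hex
  refine ⟨⟨{ l :=
    { app := fun m => ↾fun y => l m y
      naturality := fun m m' θ => ConcreteCategory.hom_ext _ _ ?_ }
             fac_left := ?_
             fac_right := ?_ }⟩⟩
  · rintro ⟨y, hy⟩
    change l m' ((N : SSet).map θ ⟨y, hy⟩) = E.map θ (l m ⟨y, hy⟩)
    rcases hN m y hy with h | ⟨v, hv⟩
    · exact (hl m' ((N : SSet).map θ ⟨y, hy⟩) (M.map θ h)).trans ((app_map a θ ⟨y, h⟩).trans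
        (congrArg (E.map θ) (hl m ⟨y, hy⟩ h).symm))
    · exact (hl' m' ((N : SSet).map θ ⟨y, hy⟩) (V.map θ v) ((app_map g θ v).trans (congrArg (Y.map θ) hv))).trans
        ((app_map _ θ v).trans (congrArg (E.map θ) (hl' m ⟨y, hy⟩ v hv).symm))
  · exact hom_ext_app fun m y => hl m _ y.2
  · refine hom_ext_app fun m y => ?_
    change p.app m (l m y) = b.app m y
    rcases hN m y.1 y.2 with h | ⟨v, hv⟩
    · rw [hl m _ h]
      exact congr_app_apply sq.w (m := m) ⟨y.1, h⟩
    · rw [hl' m _ v hv, hl₂]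
      congr 1
      exact Subtype.ext hv

section Diagonal

variable {B : SimplicialObject SSet.{w}} (A : ∀ n, (B.obj n).Subcomplex)

/-- The union of `A` with the images of the first `k` degeneracies in degree `n` of the
simplicial object `B`; for `k = n` this is the relative latching object. -/
def latching (n k : ℕ) : (B.obj (op ⦋n⦌)).Subcomplex :=
  match n with
  | 0 => A _
  | p + 1 => A _ ⊔ ⨆ (i : Fin (p + 1)) (_ : i.1 < k), Subcomplex.range (B.σ i)

lemma mem_latching_succ {p k : ℕ} {m : SimplexCategoryᵒᵖ} (x : (B.obj (op ⦋p + 1⦌)).obj m) :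
    x ∈ (latching A (p + 1) k).obj m ↔
      x ∈ (A _).obj m ∨ ∃ i : Fin (p + 1), i.1 < k ∧ ∃ z, (B.σ i).app m z = x := by
  simp only [latching, Subfunctor.max_obj, Set.mem_union, Subfunctor.iSup_obj, Set.mem_iUnion,
    exists_prop]
  rfl

lemma le_latching (n k : ℕ) : A _ ≤ latching A n k := by
  cases n with
  | zero => exact le_rfl
  | succ p => exact le_sup_left

lemma latching_zero (n : ℕ) : latching A n 0 = A _ := by
  cases n with
  | zero => rfl
  | succ p => simp [latching]

lemma latching_mono (n : ℕ) {k l : ℕ} (h : k ≤ l) : latching A n k ≤ latching A n l := by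
  cases n with
  | zero => exact le_rfl
  | succ p =>
    intro m x hx
    rw [mem_latching_succ] at hx ⊢
    exact hx.imp id fun ⟨i, hi, hz⟩ => ⟨i, hi.trans_le h, hz⟩

variable {A}

/-- The preimage of `latching A (p + 1) k` under the degeneracy of index `k` is the subobject of the
same kind in degree `p`: this is the attaching locus in the induction on `k`. -/
lemma preimage_latching (hA : ∀ ⦃n n' : SimplexCategoryᵒᵖ⦄ (θ : n ⟶ n'), A n ≤ (A n').preimage (B.map θ))
    (p k : ℕ) (hk : k < p + 1) :
    (latching A (p + 1) k).preimage (B.σ ⟨k, hk⟩) = latching A p k := by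
  ext m x
  change (B.σ ⟨k, hk⟩).app m x ∈ (latching A (p + 1) k).obj m ↔ _
  have hδ : (B.δ (Fin.succ ⟨k, hk⟩)).app m ((B.σ ⟨k, hk⟩).app m x) = x :=
    congr_app_apply (B.δ_comp_σ_succ (i := ⟨k, hk⟩)) x
  rw [mem_latching_succ]
  constructor
  · rintro (h | ⟨i, hi, z, hz⟩)
    · rw [← hδ]
      exact le_latching A _ _ _ (hA _ _ h)
    · rw [← hδ, ← hz]
      cases p with
      | zero => exact absurd hi (by lia)
      | succ p =>
        rw [mem_latching_succ]
        refine Or.inr ⟨⟨i, by lia⟩, hi, (B.δ ⟨k, by lia⟩).app m z, ?_⟩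
        exact (congr_app_apply (B.δ_comp_σ_of_gt (i := ⟨k, by lia⟩) (j := ⟨i, by lia⟩) hi) z).symm
  · intro h
    cases p with
    | zero => exact Or.inl (hA _ _ h)
    | succ p =>
      rw [mem_latching_succ] at h
      refine h.imp (fun h => hA _ _ h) ?_
      rintro ⟨i, hi, z, rfl⟩
      obtain ⟨k, rfl⟩ : ∃ k', k = k' + 1 := ⟨k - 1, by lia⟩
      refine ⟨i.castSucc, hi, (B.σ ⟨k, by lia⟩).app m z, ?_⟩
      exact congr_app_apply (B.σ_comp_σ (i := i) (j := ⟨k, by lia⟩)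
        (Fin.le_def.2 (Nat.lt_succ_iff.1 hi))) z

/-- The step from `k` to `k + 1` attaches a copy of the previous degree along its own latching
subobject, by a degeneracy. -/
lemma anodyne_le_latching
    (hA : ∀ ⦃n n' : SimplexCategoryᵒᵖ⦄ (θ : n ⟶ n'), A n ≤ (A n').preimage (B.map θ))
    (hA' : ∀ n, anodyneExtensions (A n).ι) (n k : ℕ) :
    anodyneExtensions (Subcomplex.homOfLE (le_latching A n k)) := by
  have hiso : ∀ n, anodyneExtensions (Subcomplex.homOfLE (le_latching A n 0)) := fun n => by
    have : IsIso (Subcomplex.homOfLE (le_latching A n 0)) :=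
      ⟨Subcomplex.homOfLE (latching_zero A n).le, rfl, rfl⟩
    exact anodyneExtensions.of_isIso _
  induction n generalizing k with
  | zero => exact hiso 0
  | succ p ih =>
    induction k with
    | zero => exact hiso _
    | succ k ihk =>
      have hstep : anodyneExtensions (Subcomplex.homOfLE (latching_mono A (p + 1) (Nat.le_succ k))) := by
        by_cases hk : k < p + 1
        · refine anodyne_homOfLE_of_cover (B.σ ⟨k, hk⟩) _ ?_ ?_ ?_ ?_
          · rw [preimage_latching hA]
            refine anodyne_of_mono_of_weakEquiv _ ?_
            refine weakEquiv.of_precomp _ _ (weakEquiv_of_anodyne (ih k)) ?_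
            exact weakEquiv_of_anodyne (hA' _)
          · intro m v v' h _
            have hδ := congr_app_apply (m := m) (B.δ_comp_σ_succ (i := ⟨k, hk⟩))
            rw [← show _ = v from hδ v, ← show _ = v' from hδ v']
            exact congrArg ((B.δ (Fin.succ ⟨k, hk⟩)).app m) h
          · intro m v
            exact (mem_latching_succ A _).2 (Or.inr ⟨⟨k, hk⟩, Nat.lt_succ_self k, v, rfl⟩)
          · intro m y hy
            rw [mem_latching_succ] at hy ⊢
            rcases hy with hy | ⟨i, hi, z, rfl⟩
            · exact Or.inl (Or.inl hy)
            · rcases Nat.lt_succ_iff_lt_or_eq.1 hi with hi | hi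
              · exact Or.inl (Or.inr ⟨i, hi, z, rfl⟩)
              · obtain rfl : i = ⟨k, hk⟩ := Fin.ext hi
                exact Or.inr ⟨z, rfl⟩
        · have : latching A (p + 1) (k + 1) ≤ latching A (p + 1) k := fun m x hx => by
            rw [mem_latching_succ] at hx ⊢
            exact hx.imp id fun ⟨i, hi, hz⟩ => ⟨i, by lia, hz⟩
          have : IsIso (Subcomplex.homOfLE (latching_mono A (p + 1) (Nat.le_succ k))) :=
            ⟨Subcomplex.homOfLE this, rfl, rfl⟩
          exact anodyneExtensions.of_isIso _
      exact MorphismProperty.comp_mem _ _ _ ihk hstep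

lemma anodyne_latching
    (hA : ∀ ⦃n n' : SimplexCategoryᵒᵖ⦄ (θ : n ⟶ n'), A n ≤ (A n').preimage (B.map θ))
    (hA' : ∀ n, anodyneExtensions (A n).ι) (n k : ℕ) : anodyneExtensions (latching A n k).ι := by
  refine anodyne_of_mono_of_weakEquiv _ ?_
  refine weakEquiv.of_precomp _ _ (weakEquiv_of_anodyne (anodyne_le_latching hA hA' n k)) ?_
  exact weakEquiv_of_anodyne (hA' _)

/-- A surjective map in the simplex category has a section through any given point. -/
lemma exists_section_apply_eq {m n : SimplexCategory} (θ : m ⟶ n)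
    (hθ : Function.Surjective θ.toOrderHom) (a : Fin (m.len + 1)) :
    ∃ s : n ⟶ m, s ≫ θ = 𝟙 n ∧ s.toOrderHom (θ.toOrderHom a) = a := by
  classical
  choose r hr using hθ
  let s : Fin (n.len + 1) → Fin (m.len + 1) := fun b => if b = θ.toOrderHom a then a else r b
  have hs : ∀ b, θ.toOrderHom (s b) = b := fun b => by
    by_cases h : b = θ.toOrderHom a
    · simp [s, h]
    · simp [s, h, hr]
  refine ⟨SimplexCategory.Hom.mk ⟨s, fun b b' hbb' => ?_⟩, ?_, if_pos rfl⟩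
  · by_contra! h
    have := θ.toOrderHom.monotone h.le
    rw [hs, hs] at this
    rw [le_antisymm hbb' this] at h
    exact h.false
  · ext b : 3
    exact hs b

/-- The filtration of the diagonal of `B` by the diagonal of `A` together with the simplices
which are degenerate, in the simplicial direction of `B`, on simplices of degree `< n`. -/
def diagonalSkeleton (hA : ∀ ⦃n n' : SimplexCategoryᵒᵖ⦄ (θ : n ⟶ n'), A n ≤ (A n').preimage (B.map θ))
    (n : ℕ) : (realization.obj B).Subcomplex where
  obj m := {x | x ∈ (A m).obj m ∨
    ∃ j : ℕ, j < n ∧ ∃ (θ : op ⦋j⦌ ⟶ m) (y : (B.obj (op ⦋j⦌)).obj m), (B.map θ).app m y = x}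
  map {m m'} θ x hx := by
    rcases hx with hx | ⟨j, hj, η, y, rfl⟩
    · exact Or.inl ((A m').map θ (hA θ _ hx))
    · refine Or.inr ⟨j, hj, η ≫ θ, (B.obj (op ⦋j⦌)).map θ y, ?_⟩
      rw [B.map_comp]
      exact (congrArg ((B.map θ).app m') (app_map (B.map η) θ y)).trans (app_map (B.map θ) θ _)

lemma diagonalSkeleton_mono
    (hA : ∀ ⦃n n' : SimplexCategoryᵒᵖ⦄ (θ : n ⟶ n'), A n ≤ (A n').preimage (B.map θ)) :
    Monotone (diagonalSkeleton hA) := fun _ _ h _ _ hx =>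
  hx.imp id fun ⟨j, hj, hz⟩ => ⟨j, hj.trans_le h, hz⟩

/-- The map `(y, θ) ↦ θ^* y` from `B_n ⊗ Δ[n]` to the diagonal of `B`. -/
def diagonalCell (B : SimplicialObject SSet.{w}) (n : ℕ) :
    B.obj (op ⦋n⦌) ⊗ Δ[n] ⟶ realization.obj B where
  app m := ↾fun z => (B.map (stdSimplex.objEquiv z.2).op).app m z.1
  naturality m m' θ := ConcreteCategory.hom_ext _ _ fun z => by
    change (B.map ((stdSimplex.objEquiv z.2).op ≫ θ)).app m' ((B.obj (op ⦋n⦌)).map θ z.1) =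
      (B.obj m').map θ ((B.map θ).app m ((B.map (stdSimplex.objEquiv z.2).op).app m z.1))
    rw [B.map_comp]
    exact (congrArg ((B.map θ).app m') (app_map (B.map (stdSimplex.objEquiv z.2).op) θ z.1)).trans
      (app_map (B.map θ) θ _)

lemma map_map_eq {B : SimplicialObject SSet.{w}} {n n' n'' : SimplexCategory} (θ : n ⟶ n')
    (η : n' ⟶ n'') {m : SimplexCategoryᵒᵖ} (y : (B.obj (op n'')).obj m) :
    (B.map θ.op).app m ((B.map η.op).app m y) = (B.map (θ ≫ η).op).app m y := by
  rw [op_comp, B.map_comp]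
  rfl

lemma map_eq_self {B : SimplicialObject SSet.{w}} {n n' : SimplexCategory} {θ : n ⟶ n'}
    {s : n' ⟶ n} (hs : s ≫ θ = 𝟙 n') {m : SimplexCategoryᵒᵖ} (y : (B.obj (op n')).obj m) :
    (B.map s.op).app m ((B.map θ.op).app m y) = y := by
  rw [map_map_eq, hs]
  exact congr_app_apply (B.map_id _) y

lemma mem_latching_of_not_injective {n : ℕ} {n' : SimplexCategory} (η : ⦋n⦌ ⟶ n')
    (hη : ¬ Function.Injective η.toOrderHom) {m : SimplexCategoryᵒᵖ} (y : (B.obj (op n')).obj m) :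
    (B.map η.op).app m y ∈ (latching A n n).obj m := by
  cases n with
  | zero => exact (hη (Function.injective_of_subsingleton (α := Fin 1) _)).elim
  | succ p =>
    obtain ⟨i, η, rfl⟩ := SimplexCategory.eq_σ_comp_of_not_injective η hη
    exact (mem_latching_succ A _).2 (Or.inr ⟨i, i.2, _, map_map_eq _ _ y⟩)

/-- The part of the `n`-th cell which lies in the skeleton is a pushout-product. -/
lemma preimage_diagonalSkeleton
    (hA : ∀ ⦃n n' : SimplexCategoryᵒᵖ⦄ (θ : n ⟶ n'), A n ≤ (A n').preimage (B.map θ)) (n : ℕ) :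
    (diagonalSkeleton hA n).preimage (diagonalCell B n) =
      (latching A n n).unionProd (SSet.boundary n) := by
  ext m ⟨y, t⟩
  obtain ⟨θ, rfl⟩ := stdSimplex.objEquiv.symm.surjective t
  refine Iff.trans ?_ (Subcomplex.mem_unionProd_iff _ _ _).symm
  constructor
  · intro h
    by_cases hθ : Function.Surjective θ.toOrderHom
    · right
      obtain ⟨s, hs, -⟩ := exists_section_apply_eq θ hθ 0
      rcases h with h | ⟨j, hj, η, z, hz⟩
      · have := hA s.op _ h
        change (B.map s.op).app m ((B.map θ.op).app m y) ∈ (A (op ⦋n⦌)).obj m at this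
        rw [map_eq_self hs] at this
        exact le_latching A _ _ _ this
      · change _ = (B.map θ.op).app m y at hz
        change y ∈ (latching A n n).obj m
        rw [← map_eq_self hs y, ← hz]
        have hη : ¬ Function.Injective (s ≫ η.unop).toOrderHom := fun h => by
          have := Fintype.card_le_of_injective _ h
          simp only [Fintype.card_fin] at this
          change n + 1 ≤ j + 1 at this
          lia
        have := mem_latching_of_not_injective (A := A) (s ≫ η.unop) hη z
        rwa [← map_map_eq] at this
    · exact Or.inl hθ
  · rintro (h | h)
    · have hθ : ¬ Function.Surjective θ.toOrderHom := h
      cases n with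
      | zero => exact (hθ (fun b => ⟨0, Subsingleton.elim (α := Fin 1) _ _⟩)).elim
      | succ n =>
        obtain ⟨i, θ, rfl⟩ := SimplexCategory.eq_comp_δ_of_not_surjective θ hθ
        exact Or.inr ⟨n, Nat.lt_succ_self n, θ.op, (B.δ i).app m y, map_map_eq _ _ y⟩
    · cases n with
      | zero => exact Or.inl (hA θ.op _ h)
      | succ n =>
        rcases (mem_latching_succ A _).1 h with h | ⟨i, -, z, rfl⟩
        · exact Or.inl (hA θ.op _ h)
        · exact Or.inr ⟨n, Nat.lt_succ_self n, (θ ≫ SimplexCategory.σ i).op, z,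
            (map_map_eq _ _ z).symm⟩

/-- Outside the skeleton the `n`-th cell is injective, by uniqueness of the presentation of a
simplex as a degeneracy of a nondegenerate one. -/
lemma diagonalCell_injective
    (hA : ∀ ⦃n n' : SimplexCategoryᵒᵖ⦄ (θ : n ⟶ n'), A n ≤ (A n').preimage (B.map θ)) (n : ℕ)
    {m : SimplexCategoryᵒᵖ} (v v' : (B.obj (op ⦋n⦌) ⊗ Δ[n]).obj m)
    (h : (diagonalCell B n).app m v = (diagonalCell B n).app m v')
    (hv : (diagonalCell B n).app m v ∉ (diagonalSkeleton hA n).obj m) : v = v' := by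
  change v ∉ ((diagonalSkeleton hA n).preimage (diagonalCell B n)).obj m at hv
  rw [preimage_diagonalSkeleton] at hv
  replace hv := not_or.1 (mt (Subcomplex.mem_unionProd_iff _ _ _).2 hv)
  obtain ⟨y, t⟩ := v
  obtain ⟨y', t'⟩ := v'
  obtain ⟨θ, rfl⟩ := stdSimplex.objEquiv.symm.surjective t
  obtain ⟨θ', rfl⟩ := stdSimplex.objEquiv.symm.surjective t'
  have hθ : Function.Surjective θ.toOrderHom := not_not.1 hv.1
  change (B.map θ.op).app m y = (B.map θ'.op).app m y' at h
  -- a section of `θ` is a section of `θ'`, since otherwise `y` would be degenerate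
  have key : ∀ s : ⦋n⦌ ⟶ m.unop, s ≫ θ = 𝟙 _ → s ≫ θ' = 𝟙 _ := fun s hs => by
    have hy : y = (B.map (s ≫ θ').op).app m y' := by
      rw [← map_map_eq, ← h, map_eq_self hs]
    have : Mono (s ≫ θ') := by
      rw [SimplexCategory.mono_iff_injective]
      by_contra hinj
      exact hv.2 (hy ▸ mem_latching_of_not_injective (A := A) _ hinj y')
    exact SimplexCategory.eq_id_of_mono _
  have hθθ' : θ = θ' := by
    ext a : 3
    obtain ⟨s, hs, hsa⟩ := exists_section_apply_eq θ hθ a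
    have := congrArg (fun f => f.toOrderHom (θ.toOrderHom a)) (key s hs)
    change θ'.toOrderHom (s.toOrderHom (θ.toOrderHom a)) = θ.toOrderHom a at this
    rw [← this, hsa]
  subst hθθ'
  obtain ⟨s, hs, -⟩ := exists_section_apply_eq θ hθ 0
  have := congrArg ((B.map s.op).app m) h
  rw [map_eq_self hs, map_eq_self hs] at this
  rw [this]

lemma anodyne_diagonalSkeleton_succ
    (hA : ∀ ⦃n n' : SimplexCategoryᵒᵖ⦄ (θ : n ⟶ n'), A n ≤ (A n').preimage (B.map θ))
    (hA' : ∀ n, anodyneExtensions (A n).ι) (n : ℕ) :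
    anodyneExtensions (Subcomplex.homOfLE (diagonalSkeleton_mono hA (Nat.le_succ n))) := by
  refine anodyne_homOfLE_of_cover (diagonalCell B n) _ ?_
    (fun m v v' h hv => diagonalCell_injective hA n v v' h hv) ?_ ?_
  · rw [preimage_diagonalSkeleton]
    exact anodyneExtensions_unionProd_ι' _ _ (anodyne_latching hA hA' n n)
  · intro m v
    exact Or.inr ⟨n, Nat.lt_succ_self n, _, v.1, rfl⟩
  · rintro m x (hx | ⟨j, hj, θ, y, rfl⟩)
    · exact Or.inl (Or.inl hx)
    · rcases Nat.lt_succ_iff_lt_or_eq.1 hj with hj | rfl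
      · exact Or.inl (Or.inr ⟨j, hj, θ, y, rfl⟩)
      · exact Or.inr ⟨⟨y, stdSimplex.objEquiv.symm θ.unop⟩, rfl⟩

lemma iSup_diagonalSkeleton
    (hA : ∀ ⦃n n' : SimplexCategoryᵒᵖ⦄ (θ : n ⟶ n'), A n ≤ (A n').preimage (B.map θ)) :
    ⨆ n, diagonalSkeleton hA n = ⊤ := by
  refine top_unique fun m x _ => ?_
  rw [Subfunctor.iSup_obj, Set.mem_iUnion]
  exact ⟨m.unop.len + 1, Or.inr ⟨m.unop.len, Nat.lt_succ_self _, 𝟙 m, x,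
    congr_app_apply (B.map_id m) x⟩⟩

lemma anodyne_diagonalSkeleton_zero
    (hA : ∀ ⦃n n' : SimplexCategoryᵒᵖ⦄ (θ : n ⟶ n'), A n ≤ (A n').preimage (B.map θ))
    (hA' : ∀ n, anodyneExtensions (A n).ι) : anodyneExtensions (diagonalSkeleton hA 0).ι := by
  have hlub : IsLUB (Set.range (diagonalSkeleton hA)) ⊤ := by
    rw [← iSup_diagonalSkeleton hA]
    exact isLUB_iSup
  let F := (diagonalSkeleton_mono hA).functor
  refine MorphismProperty.transfiniteCompositionsOfShape_le anodyneExtensions ℕ _ ⟨?_⟩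
  exact
    { F := F ⋙ Subcomplex.toSSetFunctor
      isoBot := Iso.refl _
      incl := { app := fun n => (diagonalSkeleton hA n).ι }
      isColimit := IsColimit.ofIsoColimit (isColimitOfPreserves Subcomplex.toSSetFunctor
          (Preorder.colimitCoconeOfIsLUB F (pt := ⊤) hlub).isColimit)
        (Cocone.ext (Subcomplex.topIso _))
      map_mem := fun n _ => anodyne_diagonalSkeleton_succ hA hA' n }

end Diagonal

/-- The diagonal of a levelwise anodyne map of simplicial objects is anodyne. -/
theorem anodyne_realization_map {B' B : SimplicialObject SSet.{w}} (φ : B' ⟶ B)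
    (hφ : ∀ n, anodyneExtensions (φ.app n)) : anodyneExtensions (realization.map φ) := by
  have hmono : ∀ n, Mono (φ.app n) := fun n => mono_of_anodyne (hφ n)
  have : Mono (realization.map φ) := (mono_iff_injective _).2 fun m =>
    (mono_iff_injective _).1 (hmono m) m
  have hA : ∀ ⦃n n' : SimplexCategoryᵒᵖ⦄ (θ : n ⟶ n'),
      Subcomplex.range (φ.app n) ≤ (Subcomplex.range (φ.app n')).preimage (B.map θ) := by
    rintro n n' θ m _ ⟨x, rfl⟩
    exact ⟨(B'.map θ).app m x, congr_app_apply (φ.naturality θ) x⟩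
  have hA' : ∀ n, anodyneExtensions (Subcomplex.range (φ.app n)).ι := fun n => by
    have h := hφ n
    rw [← Subcomplex.toRange_ι (φ.app n)] at h
    exact (MorphismProperty.cancel_left_of_respectsIso anodyneExtensions _ _).1 h
  have h0 : Subcomplex.range (realization.map φ) = diagonalSkeleton hA 0 := by
    ext m x
    exact ⟨Or.inl, fun h => h.resolve_right fun ⟨_, hj, _⟩ => absurd hj (Nat.not_lt_zero _)⟩
  rw [← Subcomplex.toRange_ι (realization.map φ)]
  refine (MorphismProperty.cancel_left_of_respectsIso anodyneExtensions _ _).2 ?_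
  rw [h0]
  exact anodyne_diagonalSkeleton_zero hA hA'

/-! ### Levelwise weak equivalences and diagonals -/

attribute [local instance] Cardinal.fact_isRegular_aleph0 Cardinal.orderBotAleph0OrdToType

instance : MorphismProperty.HasSmallObjectArgument.{w} modelCategoryQuillen.I.{w} :=
  ⟨.aleph0, inferInstance, inferInstance,
    { isSmall := MorphismProperty.isSmall_ofHoms _
      preservesColimit := fun {A B X Y} i hi f hf => by
        have : IsFinitelyPresentable.{w} A := by
          obtain ⟨n⟩ := hi
          infer_instance
        infer_instance }⟩

lemma mono_of_llp_trivialFibration {A B : SSet.{w}} {i : A ⟶ B} (hi : trivialFibration.llp i) :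
    Mono i := by
  rw [trivialFibration, rlp_monomorphisms,
    MorphismProperty.llp_rlp_of_hasSmallObjectArgument.{w}] at hi
  refine (?_ : _ ≤ MorphismProperty.monomorphisms SSet.{w}) _ hi
  rw [MorphismProperty.retracts_le_iff, MorphismProperty.transfiniteCompositions_le_iff,
    MorphismProperty.pushouts_le_iff, MorphismProperty.coproducts_le_iff]
  exact modelCategoryQuillen.I_le_monomorphisms

/-- The diagonal preserves levelwise weak equivalences: as in Ken Brown's lemma, `φ` is factored
as a levelwise anodyne map followed by a retraction of a levelwise anodyne map. -/
theorem weakEquiv_realization_map {B B' : SimplicialObject SSet.{w}} (φ : B ⟶ B')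
    (hφ : ∀ n, weakEquiv (φ.app n)) : weakEquiv (realization.map φ) := by
  let F := MorphismProperty.factorizationData
    (modelCategoryQuillen.I.rlp.llp.functorCategory SimplexCategoryᵒᵖ)
    (modelCategoryQuillen.I.rlp.functorCategory SimplexCategoryᵒᵖ)
    (coprod.desc φ (𝟙 B') : (B ⨿ B' : SimplexCategoryᵒᵖ ⥤ SSet.{w}) ⟶ B')
  have hp : ∀ n, weakEquiv (F.p.app n) := fun n =>
    weakEquiv_of_trivialFibration (by
      rw [trivialFibration, rlp_monomorphisms]
      exact F.hp n)
  have hmono : ∀ n, Mono (F.i.app n) := fun n => by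
    have : trivialFibration.llp (F.i.app n) := by
      rw [trivialFibration, rlp_monomorphisms]
      exact F.hi n
    exact mono_of_llp_trivialFibration this
  have hi : ∀ n, anodyneExtensions ((coprod.inl ≫ F.i : B ⟶ F.Z).app n) := fun n => by
    have : Mono ((coprod.inl : B ⟶ B ⨿ B').app n) := inferInstance
    have : Mono ((coprod.inl ≫ F.i : B ⟶ F.Z).app n) := by
      rw [NatTrans.comp_app]
      infer_instance
    refine anodyne_of_mono_of_weakEquiv _ (weakEquiv.of_postcomp _ (F.p.app n) (hp n) ?_)
    rw [← NatTrans.comp_app, Category.assoc, F.fac, coprod.inl_desc]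
    exact hφ n
  have hs : ∀ n, anodyneExtensions ((coprod.inr ≫ F.i : B' ⟶ F.Z).app n) := fun n => by
    have : Mono ((coprod.inr : B' ⟶ B ⨿ B').app n) := inferInstance
    have : Mono ((coprod.inr ≫ F.i : B' ⟶ F.Z).app n) := by
      rw [NatTrans.comp_app]
      infer_instance
    refine anodyne_of_mono_of_weakEquiv _ (weakEquiv.of_postcomp _ (F.p.app n) (hp n) ?_)
    rw [← NatTrans.comp_app, Category.assoc, F.fac, coprod.inr_desc]
    exact weakEquiv_of_isIso _
  have hi' := weakEquiv_of_anodyne (anodyne_realization_map _ hi)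
  have hs' := weakEquiv_of_anodyne (anodyne_realization_map _ hs)
  have hp' : weakEquiv (realization.map F.p) := by
    refine weakEquiv.of_precomp _ _ hs' ?_
    rw [← Functor.map_comp, Category.assoc, F.fac, coprod.inr_desc]
    exact weakEquiv_of_isIso _
  have := weakEquiv.comp_mem _ _ hi' hp'
  rwa [← Functor.map_comp, Category.assoc, F.fac, coprod.inl_desc] at this

/-! ### The projective model structure -/

section Projective

variable {C : Type w} [Category.{v} C]

/-- The maps of presheaves obtained by applying the left adjoints of the evaluation functors
to a family of maps of simplicial sets. -/
def freeHoms [∀ a b : Cᵒᵖ, HasCoproductsOfShape (a ⟶ b) SSet.{w}] {ι : Type} {A B : ι → SSet.{w}}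
    (i : ∀ x, A x ⟶ B x) : MorphismProperty (SPre C) :=
  .ofHoms fun z : Cᵒᵖ × ι => (evaluationLeftAdjoint SSet.{w} z.1).map (i z.2)

lemma freeHoms_rlp [∀ a b : Cᵒᵖ, HasCoproductsOfShape (a ⟶ b) SSet.{w}] {ι : Type}
    {A B : ι → SSet.{w}} (i : ∀ x, A x ⟶ B x) :
    (freeHoms (C := C) i).rlp = (MorphismProperty.ofHoms i).rlp.functorCategory Cᵒᵖ := by
  ext X Y p
  constructor
  · rintro h U _ _ _ ⟨x⟩
    exact ((evaluationAdjunctionRight SSet.{w} U).hasLiftingProperty_iff (i x) p).1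
      (h _ ⟨(U, x)⟩)
  · rintro h _ _ _ ⟨U, x⟩
    exact ((evaluationAdjunctionRight SSet.{w} U).hasLiftingProperty_iff (i x) p).2
      (h U _ ⟨x⟩)

instance [∀ a b : Cᵒᵖ, HasCoproductsOfShape (a ⟶ b) SSet.{w}]
    {ι : Type} {A B : ι → SSet.{w}} (i : ∀ x, A x ⟶ B x) [∀ x, IsFinitelyPresentable.{w} (A x)] :
    MorphismProperty.HasSmallObjectArgument.{w} (freeHoms (C := C) i) :=
  ⟨.aleph0, inferInstance, inferInstance,
    { isSmall := MorphismProperty.isSmall_ofHoms _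
      preservesColimit := fun {A' B' X Y} j hj f hf => by
        have : IsFinitelyPresentable.{w} A' := by
          obtain ⟨U, x⟩ := hj
          have : ((evaluation Cᵒᵖ SSet.{w}).obj U).IsCardinalAccessible Cardinal.aleph0.{w} := {}
          exact (evaluationAdjunctionRight SSet.{w} U).isCardinalPresentable_leftAdjoint_obj _ _
        infer_instance }⟩

variable [LocallySmall.{w} C]

instance small_hom_op (a b : Cᵒᵖ) : Small.{w} (a ⟶ b) :=
  small_of_injective (f := Quiver.Hom.unop) fun _ _ h => Quiver.Hom.unop_inj h

instance hasCoproductsOfShape_hom (a b : Cᵒᵖ) : HasCoproductsOfShape (a ⟶ b) SSet.{w} :=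
  hasColimitsOfShape_of_equivalence (Discrete.equivalence (equivShrink (a ⟶ b)).symm)

instance hasProductsOfShape_hom (a b : Cᵒᵖ) : HasProductsOfShape (a ⟶ b) SSet.{w} :=
  hasLimitsOfShape_of_equivalence (Discrete.equivalence (equivShrink (a ⟶ b)).symm)

lemma hornInclusions_eq_ofHoms : modelCategoryQuillen.J.{w} =
    .ofHoms fun x : Σ n : ℕ, Fin (n + 2) => (Λ[x.1 + 1, x.2] : (Δ[x.1 + 1] : SSet.{w}).Subcomplex).ι :=
  MorphismProperty.iSup_ofHoms _

variable (C) in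
/-- The generating projective cofibrations. -/
def projectiveI : MorphismProperty (SPre C) :=
  freeHoms fun n : ℕ => (∂Δ[n] : (Δ[n] : SSet.{w}).Subcomplex).ι

variable (C) in
/-- The generating projective trivial cofibrations. -/
def projectiveJ : MorphismProperty (SPre C) :=
  freeHoms fun x : Σ n : ℕ, Fin (n + 2) =>
    (Λ[x.1 + 1, x.2] : (Δ[x.1 + 1] : SSet.{w}).Subcomplex).ι

instance : MorphismProperty.HasSmallObjectArgument.{w} (projectiveI C) := by
  unfold projectiveI; infer_instance

instance : MorphismProperty.HasSmallObjectArgument.{w} (projectiveJ C) := by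
  unfold projectiveJ; infer_instance

lemma projectiveJ_rlp : (projectiveJ C).rlp = objectwiseFibration C := by
  rw [projectiveJ, freeHoms_rlp, ← hornInclusions_eq_ofHoms]
  rfl

omit [LocallySmall.{w} C] in
lemma objectwiseFibration_inf_objectwiseWeakEquiv :
    objectwiseFibration C ⊓ objectwiseWeakEquiv C = trivialFibration.functorCategory Cᵒᵖ := by
  ext X Y p
  exact ⟨fun h U => trivialFibration_of_weakEquiv (h.1 U) (h.2 U),
    fun h => ⟨fun U => (h U).kanFibration, fun U => weakEquiv_of_trivialFibration (h U)⟩⟩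

lemma projectiveI_rlp : (projectiveI C).rlp = objectwiseFibration C ⊓ objectwiseWeakEquiv C := by
  rw [objectwiseFibration_inf_objectwiseWeakEquiv, projectiveI, freeHoms_rlp, trivialFibration,
    rlp_monomorphisms]
  rfl

lemma projectiveCofibration_eq : projectiveCofibration C = (projectiveI C).rlp.llp := by
  rw [projectiveI_rlp, projectiveCofibration]

/-- Maps with the left lifting property against all objectwise fibrations are objectwise
anodyne extensions. -/
lemma anodyne_of_llp_objectwiseFibration {X Y : SPre C} {i : X ⟶ Y}
    (hi : (objectwiseFibration C).llp i) (U : Cᵒᵖ) : anodyneExtensions (i.app U) := by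
  intro E B p hp
  refine ((evaluationAdjunctionLeft SSet.{w} U).hasLiftingProperty_iff i p).2 (hi _ fun V => ?_)
  change modelCategoryQuillen.J.rlp (Limits.Pi.map fun _ : V ⟶ U => p)
  exact MorphismProperty.limMap _ fun _ => hp

instance : (objectwiseWeakEquiv C).HasTwoOutOfThreeProperty where
  comp_mem f g hf hg U := weakEquiv.comp_mem _ _ (hf U) (hg U)
  of_precomp f g hf hfg U := weakEquiv.of_precomp (f.app U) (g.app U) (hf U) (hfg U)
  of_postcomp f g hg hfg U := weakEquiv.of_postcomp (f.app U) (g.app U) (hg U) (hfg U)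

instance : CategoryWithFibrations (SPre C) := ⟨objectwiseFibration C⟩

instance : CategoryWithCofibrations (SPre C) := ⟨projectiveCofibration C⟩

instance : CategoryWithWeakEquivalences (SPre C) := ⟨objectwiseWeakEquiv C⟩

instance : (weakEquivalences (SPre C)).HasTwoOutOfThreeProperty :=
  inferInstanceAs (objectwiseWeakEquiv C).HasTwoOutOfThreeProperty

lemma trivialFibrations_eq : trivialFibrations (SPre C) = (projectiveI C).rlp :=
  projectiveI_rlp.symm

lemma trivialCofibrations_eq : trivialCofibrations (SPre C) = (projectiveJ C).rlp.llp := by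
  ext X Y f
  constructor
  · intro hf
    let F := MorphismProperty.factorizationData (projectiveJ C).rlp.llp (projectiveJ C).rlp f
    have hFi : objectwiseWeakEquiv C F.i := fun U => weakEquiv_of_anodyne
      (anodyne_of_llp_objectwiseFibration (projectiveJ_rlp (C := C) ▸ F.hi) U)
    have hFp : objectwiseWeakEquiv C F.p := by
      refine MorphismProperty.of_precomp _ F.i F.p hFi ?_
      rw [F.fac]
      exact hf.2
    have : HasLiftingProperty f F.p :=
      hf.1 _ ⟨projectiveJ_rlp (C := C) ▸ F.hp, hFp⟩
    exact MorphismProperty.of_retract (RetractArrow.ofLeftLiftingProperty F.fac) F.hi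
  · rw [projectiveJ_rlp]
    exact fun hf => ⟨MorphismProperty.antitone_llp inf_le_left _ hf,
      fun U => weakEquiv_of_anodyne (anodyne_of_llp_objectwiseFibration hf U)⟩

instance : MorphismProperty.IsWeakFactorizationSystem (cofibrations (SPre C))
    (trivialFibrations (SPre C)) := by
  rw [trivialFibrations_eq, show cofibrations (SPre C) = _ from projectiveCofibration_eq]
  exact { rlp := MorphismProperty.rlp_llp_rlp _
          llp := rfl }

instance : MorphismProperty.IsWeakFactorizationSystem (trivialCofibrations (SPre C))
    (fibrations (SPre C)) := by
  rw [trivialCofibrations_eq, show fibrations (SPre C) = _ from projectiveJ_rlp.symm]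
  exact { rlp := MorphismProperty.rlp_llp_rlp _
          llp := rfl }

instance projectiveModelCategory : ModelCategory (SPre C) := ModelCategory.mk' (SPre C)

end Projective

/-! ### Tensors, powers and mapping spaces -/

section Tensor

variable {C : Type w} [Category.{v} C]

variable (C) in
/-- The objectwise product of a simplicial presheaf with a simplicial set. -/
abbrev tens (L : SSet.{w}) : SPre C ⥤ SPre C :=
  (Functor.whiskeringRight Cᵒᵖ SSet.{w} SSet.{w}).obj (tensorRight L)

variable (C) in
/-- The objectwise internal hom from a simplicial set to a simplicial presheaf. -/
abbrev power (L : SSet.{w}) : SPre C ⥤ SPre C :=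
  (Functor.whiskeringRight Cᵒᵖ SSet.{w} SSet.{w}).obj (ihom L)

/-- The adjunction between `(- ⊗ L)` and the internal hom from `L`. -/
def tensorRightAdj (L : SSet.{w}) : tensorRight L ⊣ ihom L :=
  (ihom.adjunction L).ofNatIsoLeft (BraidedCategory.tensorLeftIsoTensorRight L)

variable (C) in
/-- The adjunction between tensors and powers. -/
def tensAdj (L : SSet.{w}) : tens C L ⊣ power C L :=
  (tensorRightAdj L).whiskerRight Cᵒᵖ

lemma trivialFibration_whiskerRight {E B : SSet.{w}} {p : E ⟶ B} (hp : trivialFibration p)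
    (L : SSet.{w}) : trivialFibration (p ▷ L) := by
  intro V W j hj
  refine ⟨fun {a b} sq => ?_⟩
  have : HasLiftingProperty j p := hp j hj
  have sq' : CommSq (a ≫ SemiCartesianMonoidalCategory.fst _ _) j p
      (b ≫ SemiCartesianMonoidalCategory.fst _ _) := ⟨by
    rw [← Category.assoc, ← sq.w]
    rfl⟩
  refine ⟨⟨{ l := CartesianMonoidalCategory.lift sq'.lift
                (b ≫ SemiCartesianMonoidalCategory.snd _ _)
             fac_left := ?_
             fac_right := ?_ }⟩⟩
  · refine hom_ext_app fun m x => Prod.ext ?_ ?_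
    · exact congr_app_apply sq'.fac_left x
    · exact (congrArg (fun z : (B ⊗ L).obj m => z.2) (congr_app_apply sq.w x)).symm
  · refine hom_ext_app fun m x => Prod.ext ?_ rfl
    exact congr_app_apply sq'.fac_right x

lemma weakEquiv_whiskerRight {X Y : SSet.{w}} {f : X ⟶ Y} (hf : weakEquiv f) (L : SSet.{w}) :
    weakEquiv (f ▷ L) := by
  let F := MorphismProperty.factorizationData modelCategoryQuillen.J.rlp.llp
    modelCategoryQuillen.J.rlp f
  have hi : anodyneExtensions F.i := F.hi
  have hp : weakEquiv F.p := by
    refine weakEquiv.of_precomp _ _ (weakEquiv_of_anodyne hi) ?_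
    rwa [F.fac]
  rw [← F.fac, comp_whiskerRight]
  exact weakEquiv.comp_mem _ _ (weakEquiv_of_anodyne (hi.whiskerRight L))
    (weakEquiv_of_trivialFibration
      (trivialFibration_whiskerRight (trivialFibration_of_weakEquiv F.hp hp) L))

lemma objectwiseWeakEquiv_tens_map {X Y : SPre C} {f : X ⟶ Y} (hf : objectwiseWeakEquiv C f)
    (L : SSet.{w}) : objectwiseWeakEquiv C ((tens C L).map f) := fun U =>
  weakEquiv_whiskerRight (hf U) L

lemma trivialFibration_ihom_map {E B : SSet.{w}} {p : E ⟶ B} (hp : trivialFibration p)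
    (L : SSet.{w}) : trivialFibration ((ihom L).map p) := fun V W j hj => by
  have : Mono j := hj
  have : Mono (j ▷ L) := (mono_iff_injective _).2 fun m x y h => Prod.ext
    ((mono_iff_injective j).1 hj m (congrArg (fun z : (W ⊗ L).obj m => z.1) h))
    (congrArg (fun z : (W ⊗ L).obj m => z.2) h)
  exact ((tensorRightAdj L).hasLiftingProperty_iff j p).1 (hp _ this)

lemma isProjectiveCofibrant_tens {A : SPre C} (hA : IsProjectiveCofibrant A) (L : SSet.{w}) :
    IsProjectiveCofibrant ((tens C L).obj A) := by
  intro X Y p hp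
  refine ⟨fun {a b} sq => ?_⟩
  have hp' : (objectwiseFibration C ⊓ objectwiseWeakEquiv C) ((power C L).map p) := by
    rw [objectwiseFibration_inf_objectwiseWeakEquiv] at hp ⊢
    exact fun U => trivialFibration_ihom_map (hp U) L
  have : HasLiftingProperty (initial.to A) ((power C L).map p) := hA _ hp'
  have sq' : CommSq (initial.to _) (initial.to A) ((power C L).map p)
    ((tensAdj C L).homEquiv _ _ b) := ⟨initial.hom_ext _ _⟩
  refine ⟨⟨{ l := ((tensAdj C L).homEquiv _ _).symm sq'.lift
             fac_left := initial.hom_ext _ _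
             fac_right := ?_ }⟩⟩
  rw [← Adjunction.homEquiv_naturality_right_symm, sq'.fac_right, Equiv.symm_apply_apply]

/-- The functoriality of `tens C L` in `L`. -/
def tensMap {L L' : SSet.{w}} (i : L ⟶ L') (A : SPre C) : (tens C L).obj A ⟶ (tens C L').obj A where
  app U := A.obj U ◁ i
  naturality _ _ _ := hom_ext_app fun _ x => Prod.ext rfl rfl

/-- The ends of the cylinder on a simplicial presheaf. -/
def tensEnd (A : SPre C) (e : Fin 2) : A ⟶ (tens C Δ[1]).obj A where
  app U := cylEnd (A.obj U) e
  naturality _ _ f := (cylEnd_naturality (A.map f) e).symm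

lemma tensEnd_naturality {A A' : SPre C} (f : A ⟶ A') (e : Fin 2) :
    f ≫ tensEnd A' e = tensEnd A e ≫ (tens C Δ[1]).map f :=
  NatTrans.ext (funext fun U => (cylEnd_naturality (f.app U) e).symm)

/-- The projection of the cylinder on a simplicial presheaf. -/
def tensProj (A : SPre C) : (tens C Δ[1]).obj A ⟶ A where
  app U := SemiCartesianMonoidalCategory.fst _ _
  naturality _ _ _ := hom_ext_app fun _ _ => rfl

lemma tensEnd_proj (A : SPre C) (e : Fin 2) : tensEnd A e ≫ tensProj A = 𝟙 A :=
  NatTrans.ext (funext fun U => cylEnd_fst (A.obj U) e)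

/-- The evaluation of the path object at an end of the interval. -/
def powerEnd (K : SPre C) (e : Fin 2) : (power C Δ[1]).obj K ⟶ K :=
  tensEnd _ e ≫ ((tensAdj C Δ[1]).homEquiv _ _).symm (𝟙 _)

lemma comp_powerEnd {A K : SPre C} (h : A ⟶ (power C Δ[1]).obj K) (e : Fin 2) :
    h ≫ powerEnd K e = tensEnd A e ≫ ((tensAdj C Δ[1]).homEquiv _ _).symm h := by
  rw [powerEnd, ← Category.assoc, tensEnd_naturality, Category.assoc,
    ← Adjunction.homEquiv_naturality_left_symm, Category.comp_id]

lemma powerEnd_app (K : SPre C) (e : Fin 2) (U : Cᵒᵖ) {V : SSet.{w}}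
    (h : V ⟶ ((power C Δ[1]).obj K).obj U) :
    h ≫ (powerEnd K e).app U =
      cylEnd V e ≫ ((tensorRightAdj Δ[1]).homEquiv V (K.obj U)).symm h := by
  have h₁ : (((tensAdj C Δ[1]).homEquiv _ _).symm (𝟙 ((power C Δ[1]).obj K))).app U =
      ((tensorRightAdj Δ[1]).homEquiv _ (K.obj U)).symm (𝟙 _) := by
    rw [Adjunction.homEquiv_counit, Adjunction.homEquiv_counit]
    simp [tensAdj]
  rw [powerEnd, NatTrans.comp_app, h₁]
  change h ≫ cylEnd _ e ≫ _ = _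
  rw [← Category.assoc, ← cylEnd_naturality, Category.assoc]
  refine congrArg (cylEnd V e ≫ ·) (((tensorRightAdj Δ[1]).homEquiv_naturality_left_symm h
    (𝟙 _)).symm.trans ?_)
  rw [Category.comp_id]

/-- The values of a projectively fibrant presheaf are Kan complexes. -/
lemma kanFibration_terminal_of_isProjectiveFibrant {K : SPre C} (hK : IsProjectiveFibrant K)
    (U : Cᵒᵖ) : kanFibration (terminal.from (K.obj U)) := by
  have : IsIso (terminal.from ((⊤_ SPre C).obj U)) :=
    isIso_of_isTerminal (terminalIsTerminal.isTerminalObj ((evaluation Cᵒᵖ SSet.{w}).obj U) _)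
      terminalIsTerminal _
  have h : terminal.from (K.obj U) = (terminal.from K).app U ≫ terminal.from _ :=
    terminal.hom_ext _ _
  rw [h]
  exact MorphismProperty.comp_mem (W := modelCategoryQuillen.J.rlp) _ _ (hK U)
    (MorphismProperty.rlp_of_isIso _ _)

lemma trivialFibration_powerEnd_app {K : SPre C} (hK : IsProjectiveFibrant K) (e : Fin 2)
    (U : Cᵒᵖ) : trivialFibration ((powerEnd K e).app U) := by
  intro V W j hj
  have : Mono j := hj
  let E := fun V => (tensorRightAdj Δ[1]).homEquiv V (K.obj U)
  refine ⟨fun {a b} sq => ?_⟩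
  have hab : j ≫ b = cylEnd V e ≫ (E V).symm a := by
    rw [← powerEnd_app, sq.w]
  obtain ⟨l, hl₁, hl₂, -⟩ := exists_lift_cylinder j (kanFibration_terminal_of_isProjectiveFibrant hK U)
    e b ((E V).symm a) (terminal.from _) hab (terminal.hom_ext _ _) (terminal.hom_ext _ _)
  refine ⟨⟨{ l := E W l
             fac_left := ?_
             fac_right := ?_ }⟩⟩
  · apply (E V).symm.injective
    exact ((tensorRightAdj Δ[1]).homEquiv_naturality_left_symm j (E W l)).trans
      ((congrArg (j ▷ Δ[1] ≫ ·) ((E W).symm_apply_apply l)).trans hl₂)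
  · rw [powerEnd_app]
    exact (congrArg (cylEnd W e ≫ ·) ((E W).symm_apply_apply l)).trans hl₁

/-- The identification of iterated tensors. -/
def tensAssoc (A : SPre C) (L : SSet.{w}) :
    (tens C (L ⊗ Δ[1])).obj A ≅ (tens C Δ[1]).obj ((tens C L).obj A) :=
  NatIso.ofComponents (fun U => (α_ (A.obj U) L Δ[1]).symm)
    fun _ => hom_ext_app fun _ _ => rfl

lemma tensMap_cylEnd_tensAssoc (A : SPre C) (L : SSet.{w}) (e : Fin 2) :
    tensMap (cylEnd L e) A ≫ (tensAssoc A L).hom = tensEnd _ e :=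
  NatTrans.ext (funext fun U => hom_ext_app fun m x => rfl)

lemma anodyne_cylEnd (X : SSet.{w}) (e : Fin 2) : anodyneExtensions (cylEnd X e) := by
  intro E B p hp
  refine ⟨fun {a c} sq => ?_⟩
  let b : ((⊥ : X.Subcomplex) : SSet.{w}) ⊗ Δ[1] ⟶ E :=
    { app := fun m => ↾fun x => False.elim x.1.2
      naturality := fun m m' θ => ConcreteCategory.hom_ext _ _ fun x => False.elim x.1.2 }
  obtain ⟨l, h₁, -, h₂⟩ := exists_lift_cylinder (⊥ : X.Subcomplex).ι hp e a b c
    (hom_ext_app fun m x => False.elim x.2) sq.w (hom_ext_app fun m x => False.elim x.1.2)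
  exact ⟨⟨{ l := l, fac_left := h₁, fac_right := h₂ }⟩⟩

lemma objectwiseWeakEquiv_tensProj (A : SPre C) : objectwiseWeakEquiv C (tensProj A) := fun U =>
  weakEquiv.of_precomp (cylEnd (A.obj U) 0) _ (weakEquiv_of_anodyne (anodyne_cylEnd _ 0))
    (weakEquiv_of_isIso (𝟙 (A.obj U)))

/-- The two ends of a cylinder agree in the homotopy category. -/
lemma Q_map_tensEnd (A : SPre C) (e : Fin 2) : (objectwiseWeakEquiv C).Q.map (tensEnd A e) =
    (objectwiseWeakEquiv C).Q.map (tensEnd A 0) := by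
  have : IsIso ((objectwiseWeakEquiv C).Q.map (tensProj A)) :=
    Localization.inverts _ (objectwiseWeakEquiv C) _ (objectwiseWeakEquiv_tensProj A)
  rw [← cancel_mono ((objectwiseWeakEquiv C).Q.map (tensProj A)), ← Functor.map_comp,
    ← Functor.map_comp, tensEnd_proj, tensEnd_proj]

/-- The path object of a fibrant simplicial presheaf given by the power with `Δ[1]`. -/
def pathObject (K : SPre C) (hK : IsProjectiveFibrant K) : PathObject K where
  P := (power C Δ[1]).obj K
  p₀ := powerEnd K 0
  p₁ := powerEnd K 1
  ι := (tensAdj C Δ[1]).homEquiv _ _ (tensProj K)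
  ι_p₀ := by rw [comp_powerEnd, Equiv.symm_apply_apply, tensEnd_proj]
  ι_p₁ := by rw [comp_powerEnd, Equiv.symm_apply_apply, tensEnd_proj]
  weakEquivalence_ι := by
    have h₀ : objectwiseWeakEquiv C (powerEnd K 0) := fun U =>
      weakEquiv_of_trivialFibration (trivialFibration_powerEnd_app hK 0 U)
    refine ⟨MorphismProperty.of_postcomp (objectwiseWeakEquiv C) _ (powerEnd K 0) h₀ ?_⟩
    rw [comp_powerEnd, Equiv.symm_apply_apply, tensEnd_proj]
    exact fun U => weakEquiv_of_isIso _

lemma isGood_pathObject (K : SPre C) (hK : IsProjectiveFibrant K) :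
    (pathObject K hK).IsGood := by
  refine ⟨⟨fun U V W j hj => ⟨fun {a b} sq => ?_⟩⟩⟩
  let E := fun V => (tensorRightAdj Δ[1]).homEquiv V (K.obj U)
  let pr : Fin 2 → (K ⨯ K ⟶ K) := fun e => if e = 0 then prod.fst else prod.snd
  have hpr : ∀ e, (pathObject K hK).p ≫ pr e = powerEnd K e := fun e => by
    fin_cases e
    · exact prod.lift_fst _ _
    · exact prod.lift_snd _ _
  have hext : ∀ {T : SSet.{w}} {f g : T ⟶ (K ⨯ K).obj U},
      (∀ e, f ≫ (pr e).app U = g ≫ (pr e).app U) → f = g := fun {T f g} h =>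
    BinaryFan.IsLimit.hom_ext (mapIsLimitOfPreservesOfIsLimit ((evaluation Cᵒᵖ SSet.{w}).obj U)
      _ _ (prodIsProd K K)) (h 0) (h 1)
  have hpr' : ∀ e, (pathObject K hK).p.app U ≫ (pr e).app U = (powerEnd K e).app U :=
    fun e => congr_app (hpr e) U
  have hfb : ∀ e, j ≫ b ≫ (pr e).app U = cylEnd V e ≫ (E V).symm a := fun e =>
    (sq.w_assoc _).symm.trans ((congrArg (a ≫ ·) (hpr' e)).trans (powerEnd_app K e U a))
  obtain ⟨l, hl₁, hl₂, -⟩ := exists_extend_homotopy (j := j)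
    (MorphismProperty.le_llp_rlp _ _ hj : anodyneExtensions j)
    (kanFibration_terminal_of_isProjectiveFibrant hK U) (fun e => b ≫ (pr e).app U)
    ((E V).symm a) (terminal.from _) hfb (fun _ => terminal.hom_ext _ _) (terminal.hom_ext _ _)
  refine ⟨⟨{ l := E W l
             fac_left := ?_
             fac_right := hext fun e => ?_ }⟩⟩
  · apply (E V).symm.injective
    exact ((tensorRightAdj Δ[1]).homEquiv_naturality_left_symm j (E W l)).trans
      ((congrArg (j ▷ Δ[1] ≫ ·) ((E W).symm_apply_apply l)).trans hl₂)
  · refine (Category.assoc _ _ _).trans ((congrArg (E W l ≫ ·) (hpr' e)).trans ?_)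
    refine (powerEnd_app K e U (E W l)).trans ?_
    exact (congrArg (cylEnd W e ≫ ·) ((E W).symm_apply_apply l)).trans (hl₁ e)

end Tensor

section MappingSpace

variable {C : Type w} [Category.{v} C] {A K : SPre C}

/-- A map from `L` to the mapping space of `A` and `K` corresponds to a map from the tensor of
`A` and `L` to `K`. -/
def mapTranspose {L : SSet.{w}} (φ : L ⟶ mappingSpace A K) : (tens C L).obj A ⟶ K where
  app U :=
    { app := fun m => ↾fun x => ((φ.app m x.2 : A ⊗ (constSimplex C).obj m.unop ⟶ K).app U).app m
        (x.1, stdSimplex.objEquiv.symm (𝟙 m.unop))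
      naturality := fun m m' θ => ConcreteCategory.hom_ext _ _ fun x => by
        change ((φ.app m' (L.map θ x.2) : A ⊗ (constSimplex C).obj m'.unop ⟶ K).app U).app m'
          ((A.obj U).map θ x.1, stdSimplex.objEquiv.symm (𝟙 m'.unop)) =
            (K.obj U).map θ (((φ.app m x.2 : A ⊗ (constSimplex C).obj m.unop ⟶ K).app U).app m
              (x.1, stdSimplex.objEquiv.symm (𝟙 m.unop)))
        have h : φ.app m' (L.map θ x.2) =
            A ◁ (constSimplex C).map θ.unop ≫ (φ.app m x.2 : _ ⟶ K) := app_map φ θ x.2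
        refine (congrArg (fun f : A ⊗ (constSimplex C).obj m'.unop ⟶ K => (f.app U).app m'
          ((A.obj U).map θ x.1, stdSimplex.objEquiv.symm (𝟙 m'.unop))) h).trans ?_
        refine Eq.trans ?_ (app_map ((φ.app m x.2 : A ⊗ (constSimplex C).obj m.unop ⟶ K).app U) θ
          (x.1, stdSimplex.objEquiv.symm (𝟙 m.unop)))
        refine congrArg (((φ.app m x.2 : A ⊗ (constSimplex C).obj m.unop ⟶ K).app U).app m')
          (Prod.ext rfl ?_)
        exact congrArg stdSimplex.objEquiv.symm
          ((Category.id_comp θ.unop).trans (Category.comp_id θ.unop).symm) }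
  naturality U U' f := hom_ext_app fun m x =>
    congr_app_apply ((φ.app m x.2 : A ⊗ (constSimplex C).obj m.unop ⟶ K).naturality f)
      (m := m) (x.1, stdSimplex.objEquiv.symm (𝟙 m.unop))

lemma mapTranspose_tensMap {L L' : SSet.{w}} (i : L ⟶ L') (φ : L' ⟶ mappingSpace A K) :
    mapTranspose (i ≫ φ) = tensMap i A ≫ mapTranspose φ := rfl

lemma mapTranspose_precomp {A' : SPre C} (f : A ⟶ A') {L : SSet.{w}} (φ : L ⟶ mappingSpace A' K) :
    mapTranspose (φ ≫ mappingSpacePrecomp f K) = (tens C L).map f ≫ mapTranspose φ := rfl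

lemma app_eq_mapTranspose {L : SSet.{w}} (φ : L ⟶ mappingSpace A K) {n : SimplexCategoryᵒᵖ}
    (l : L.obj n) (U : Cᵒᵖ) {m : SimplexCategoryᵒᵖ} (a : (A.obj U).obj m) (θ : m.unop ⟶ n.unop) :
    ((φ.app n l : A ⊗ (constSimplex C).obj n.unop ⟶ K).app U).app m
      (a, stdSimplex.objEquiv.symm θ) = ((mapTranspose φ).app U).app m (a, L.map θ.op l) := by
  have h : φ.app m (L.map θ.op l) = A ◁ (constSimplex C).map θ ≫ (φ.app n l : _ ⟶ K) :=
    app_map φ θ.op l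
  refine Eq.symm ((congrArg (fun f : A ⊗ (constSimplex C).obj m.unop ⟶ K => (f.app U).app m
    (a, stdSimplex.objEquiv.symm (𝟙 m.unop))) h).trans ?_)
  refine congrArg (((φ.app n l : A ⊗ (constSimplex C).obj n.unop ⟶ K).app U).app m)
    (Prod.ext rfl ?_)
  exact congrArg stdSimplex.objEquiv.symm (Category.id_comp θ)

lemma mapTranspose_injective {L : SSet.{w}} :
    Function.Injective (mapTranspose : (L ⟶ mappingSpace A K) → _) := by
  intro φ ψ h
  refine hom_ext_app fun n l => NatTrans.ext (funext fun U => hom_ext_app fun m x => ?_)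
  obtain ⟨a, t⟩ := x
  obtain ⟨θ, rfl⟩ := stdSimplex.objEquiv.symm.surjective t
  exact (app_eq_mapTranspose φ l U a θ).trans
    ((congr_app_apply (congr_app h U) (a, L.map θ.op l)).trans (app_eq_mapTranspose ψ l U a θ).symm)

lemma mapTranspose_surjective {L : SSet.{w}} :
    Function.Surjective (mapTranspose : (L ⟶ mappingSpace A K) → _) := by
  intro ψ
  refine ⟨{ app := fun n => ↾fun l =>
              ({ app := fun U => A.obj U ◁ yonedaEquiv.symm l ≫ ψ.app U
                 naturality := fun U U' f => hom_ext_app fun m x =>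
                  congr_app_apply (ψ.naturality f) (m := m) (x.1, (yonedaEquiv.symm l).app m x.2) } :
                A ⊗ (constSimplex C).obj n.unop ⟶ K)
            naturality := fun n n' θ => ConcreteCategory.hom_ext _ _ fun l =>
              NatTrans.ext (funext fun U => hom_ext_app fun m x => ?_) }, ?_⟩
  · refine congrArg ((ψ.app U).app m) (Prod.ext rfl ?_)
    exact (map_comp_app L θ (stdSimplex.objEquiv x.2).op l).symm
  · refine NatTrans.ext (funext fun U => hom_ext_app fun m x => ?_)
    exact congrArg ((ψ.app U).app m) (Prod.ext rfl (map_id_app L x.2))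

/-- A map which induces bijections on homotopy classes of maps out of all simplicial sets is a
weak equivalence. -/
lemma weakEquiv_of_bijective_homotopyClasses {M N : SSet.{w}} (f : M ⟶ N)
    (hs : ∀ (L : SSet.{w}) (φ : L ⟶ N), ∃ ψ : L ⟶ M, HomotopyClasses.mk (ψ ≫ f) = .mk φ)
    (hi : ∀ (L : SSet.{w}) (φ ψ : L ⟶ M), HomotopyClasses.mk (φ ≫ f) = .mk (ψ ≫ f) →
      HomotopyClasses.mk φ = .mk ψ) : weakEquiv f := by
  obtain ⟨g, hg⟩ := hs N (𝟙 N)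
  refine weakEquiv_of_homotopyInverse f g (hi _ _ _ ?_) hg
  rw [Category.id_comp, Category.assoc]
  refine (congrArg (HomotopyClasses.precomp f N) hg).trans ?_
  rw [HomotopyClasses.precomp_mk, Category.comp_id]

variable [LocallySmall.{w} C]

/-- Simplicial homotopy classes of maps into the mapping space from a cofibrant to a fibrant
presheaf are morphisms in the homotopy category. -/
lemma mk_eq_mk_iff_map_mapTranspose_eq (hA : IsProjectiveCofibrant A) (hK : IsProjectiveFibrant K)
    {L : SSet.{w}} (φ ψ : L ⟶ mappingSpace A K) :
    HomotopyClasses.mk φ = .mk ψ ↔ (objectwiseWeakEquiv C).Q.map (mapTranspose φ) =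
      (objectwiseWeakEquiv C).Q.map (mapTranspose ψ) := by
  constructor
  · refine fun h => congrArg (Quot.lift (fun φ => (objectwiseWeakEquiv C).Q.map (mapTranspose φ))
      fun φ ψ h => ?_) h
    obtain ⟨H, rfl, rfl⟩ := (homotopic_iff _ _).2 h
    have h₁ : ∀ e, mapTranspose (cylEnd L e ≫ H) =
        tensEnd _ e ≫ (tensAssoc A L).inv ≫ mapTranspose H := fun e => by
      rw [mapTranspose_tensMap, ← tensMap_cylEnd_tensAssoc, Category.assoc, Iso.hom_inv_id_assoc]
    change (objectwiseWeakEquiv C).Q.map _ = (objectwiseWeakEquiv C).Q.map _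
    rw [h₁, h₁, Functor.map_comp, Functor.map_comp _ (tensEnd _ 1), Q_map_tensEnd _ 1]
  · intro h
    have : IsCofibrant ((tens C L).obj A) := ⟨isProjectiveCofibrant_tens hA L⟩
    have : IsFibrant K := ⟨hK⟩
    have := isGood_pathObject K hK
    have : (objectwiseWeakEquiv C).Q.IsLocalization (weakEquivalences (SPre C)) :=
      inferInstanceAs ((objectwiseWeakEquiv C).Q.IsLocalization (objectwiseWeakEquiv C))
    obtain ⟨H, h₀, h₁⟩ :=
      ((RightHomotopyRel.iff_map_eq (objectwiseWeakEquiv C).Q _ _).2 h).rightHomotopy (pathObject K hK)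
    obtain ⟨H', hH'⟩ := mapTranspose_surjective
      ((tensAssoc A L).hom ≫ ((tensAdj C Δ[1]).homEquiv _ _).symm H)
    have key : ∀ e, mapTranspose (cylEnd L e ≫ H') = H ≫ powerEnd K e := fun e => by
      rw [mapTranspose_tensMap, hH', ← Category.assoc, tensMap_cylEnd_tensAssoc]
      exact (comp_powerEnd H e).symm
    exact HomotopyClasses.sound ⟨H', mapTranspose_injective ((key 0).trans h₀),
      mapTranspose_injective ((key 1).trans h₁)⟩

/-- The map of mapping spaces induced by a map of cofibrant presheaves into a fibrant presheaf is
a weak equivalence as soon as all tensors of the map induce bijections in the homotopy category. -/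
theorem weakEquiv_mappingSpacePrecomp {A A' K : SPre C} (f : A ⟶ A')
    (hA : IsProjectiveCofibrant A) (hA' : IsProjectiveCofibrant A') (hK : IsProjectiveFibrant K)
    (hf : ∀ L : SSet.{w}, Function.Bijective
      fun α : (objectwiseWeakEquiv C).Q.obj ((tens C L).obj A') ⟶ (objectwiseWeakEquiv C).Q.obj K =>
        (objectwiseWeakEquiv C).Q.map ((tens C L).map f) ≫ α) :
    weakEquiv (mappingSpacePrecomp f K) := by
  refine weakEquiv_of_bijective_homotopyClasses _ (fun L φ => ?_) (fun L φ ψ h => ?_)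
  · obtain ⟨α, hα⟩ := (hf L).2 ((objectwiseWeakEquiv C).Q.map (mapTranspose φ))
    have : IsCofibrant ((tens C L).obj A') := ⟨isProjectiveCofibrant_tens hA' L⟩
    have : IsFibrant K := ⟨hK⟩
    have : (objectwiseWeakEquiv C).Q.IsLocalization (weakEquivalences (SPre C)) :=
      inferInstanceAs ((objectwiseWeakEquiv C).Q.IsLocalization (objectwiseWeakEquiv C))
    obtain ⟨a, rfl⟩ := map_surjective_of_isLocalization (objectwiseWeakEquiv C).Q _ _ α
    obtain ⟨ψ, rfl⟩ := mapTranspose_surjective a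
    refine ⟨ψ, (mk_eq_mk_iff_map_mapTranspose_eq hA hK _ _).2 ?_⟩
    rw [mapTranspose_precomp, Functor.map_comp]
    exact hα
  · rw [mk_eq_mk_iff_map_mapTranspose_eq hA hK, mapTranspose_precomp, mapTranspose_precomp,
      Functor.map_comp, Functor.map_comp] at h
    exact (mk_eq_mk_iff_map_mapTranspose_eq hA' hK _ _).2 ((hf L).1 h)

end MappingSpace

/-! ### Morphisms into products, the affine line and the algebraic simplices -/

section Geometry

variable {S : Scheme.{u}}

namespace Sm

/-- The projection `U ×_S V ⟶ V`. -/
def prodSnd (U V : Sm S) : prod U V ⟶ V :=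
  ObjectProperty.homMk (Over.homMk (pullback.snd _ _) pullback.condition.symm)

/-- The morphism `T ⟶ U ×_S V` with given components. -/
def prodLift {T U V : Sm S} (f : T ⟶ U) (g : T ⟶ V) : T ⟶ prod U V :=
  ObjectProperty.homMk (Over.homMk (pullback.lift f.hom.left g.hom.left
    ((Over.w f.hom).trans (Over.w g.hom).symm)) ((pullback.lift_fst_assoc _ _ _ _).trans
      (Over.w f.hom)))

lemma prodLift_fst {T U V : Sm S} (f : T ⟶ U) (g : T ⟶ V) : prodLift f g ≫ prodFst U V = f :=
  hom_ext (pullback.lift_fst _ _ _)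

lemma prodLift_snd {T U V : Sm S} (f : T ⟶ U) (g : T ⟶ V) : prodLift f g ≫ prodSnd U V = g :=
  hom_ext (pullback.lift_snd _ _ _)

lemma prod_hom_ext {T U V : Sm S} {f g : T ⟶ prod U V}
    (h₁ : f ≫ prodFst U V = g ≫ prodFst U V) (h₂ : f ≫ prodSnd U V = g ≫ prodSnd U V) : f = g :=
  hom_ext (pullback.hom_ext (congrArg (fun k => k.hom.left) h₁)
    (congrArg (fun k => k.hom.left) h₂))

lemma prodMap_snd {U U' V V' : Sm S} (f : U ⟶ U') (g : V ⟶ V') :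
    prodMap f g ≫ prodSnd U' V' = prodSnd U V ≫ g :=
  hom_ext (prodMapLeft_snd f g)

lemma comp_prodLift {T T' U V : Sm S} (h : T' ⟶ T) (f : T ⟶ U) (g : T ⟶ V) :
    h ≫ prodLift f g = prodLift (h ≫ f) (h ≫ g) :=
  prod_hom_ext (by simp only [Category.assoc, prodLift_fst])
    (by simp only [Category.assoc, prodLift_snd])

lemma prodLift_prodMap {T U V U' V' : Sm S} (f : T ⟶ U) (g : T ⟶ V) (h : U ⟶ U') (k : V ⟶ V') :
    prodLift f g ≫ prodMap h k = prodLift (f ≫ h) (g ≫ k) :=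
  prod_hom_ext (by rw [Category.assoc, prodMap_fst, prodLift_fst, ← Category.assoc, prodLift_fst])
    (by rw [Category.assoc, prodMap_snd, prodLift_snd, ← Category.assoc, prodLift_snd])

lemma prodLift_fst_snd (U V : Sm S) : prodLift (prodFst U V) (prodSnd U V) = 𝟙 _ :=
  prod_hom_ext (by rw [prodLift_fst, Category.id_comp]) (by rw [prodLift_snd, Category.id_comp])

end Sm

/-- The ring of global functions on a smooth `S`-scheme. -/
abbrev Functions (V : Sm S) := Γ(V.obj.left, ⊤)

/-- Pullback of functions. -/
def pull {V W : Sm S} (f : V ⟶ W) : Functions W →+* Functions V := f.hom.left.appTop.hom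

lemma pull_id {V : Sm S} (s : Functions V) : pull (𝟙 V) s = s :=
  congrArg (fun k : Γ(V.obj.left, ⊤) ⟶ Γ(V.obj.left, ⊤) => k.hom s) Scheme.Hom.id_appTop

lemma pull_comp {V W T : Sm S} (f : V ⟶ W) (g : W ⟶ T) (s : Functions T) :
    pull (f ≫ g) s = pull f (pull g s) :=
  congrArg (fun k => k.hom s) (Scheme.Hom.comp_appTop f.hom.left g.hom.left)

/-- The coordinate of the affine line. -/
def lineCoord (S : Scheme.{u}) : Functions (affineLine S) := AffineSpace.coord S PUnit.unit

/-- The morphism to the affine line given by a function. -/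
def toLine {V : Sm S} (s : Functions V) : V ⟶ affineLine S :=
  ObjectProperty.homMk (Over.homMk (AffineSpace.homOfVector V.obj.hom fun _ => s)
    (AffineSpace.homOfVector_over _ _))

lemma pull_toLine {V : Sm S} (s : Functions V) : pull (toLine s) (lineCoord S) = s :=
  AffineSpace.homOfVector_appTop_coord _ _ _

lemma toLine_ext {V : Sm S} {f g : V ⟶ affineLine S}
    (h : pull f (lineCoord S) = pull g (lineCoord S)) : f = g :=
  Sm.hom_ext (AffineSpace.hom_ext ((Over.w f.hom).trans (Over.w g.hom).symm) fun _ => h)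

lemma comp_toLine {V W : Sm S} (f : V ⟶ W) (s : Functions W) :
    f ≫ toLine s = toLine (pull f s) :=
  toLine_ext (by rw [pull_comp, pull_toLine, pull_toLine])

/-- The function on `X` which is the pullback of `r` along a morphism `X ⟶ Spec R`. -/
def pullSpec {X : Scheme.{u}} {R : CommRingCat.{u}} (f : X ⟶ Spec R) : R →+* Γ(X, ⊤) :=
  ((Scheme.ΓSpecIso R).inv ≫ f.appTop).hom

lemma pullSpec_toSpecΓ {X : Scheme.{u}} {R : CommRingCat.{u}} (φ : R ⟶ Γ(X, ⊤)) :
    pullSpec (X.toSpecΓ ≫ Spec.map φ) = φ.hom := by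
  refine congrArg CommRingCat.Hom.hom (?_ : (Scheme.ΓSpecIso R).inv ≫ _ = φ)
  simp

lemma pullSpec_injective {X : Scheme.{u}} {R : CommRingCat.{u}} {f g : X ⟶ Spec R}
    (h : pullSpec f = pullSpec g) : f = g := by
  have h' : (Scheme.ΓSpecIso R).inv ≫ f.appTop = (Scheme.ΓSpecIso R).inv ≫ g.appTop :=
    CommRingCat.hom_ext h
  exact ext_of_isAffine ((cancel_epi _).1 h')

namespace SimplexRing

/-- Ring homomorphisms out of the coordinate ring of the integral algebraic simplex are determined
by the images of the coordinates. -/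
lemma ringHom_ext {n : ℕ} {A : Type*} [CommRing A]
    {f g : SimplexRing (ULift.{u} ℤ) n →+* A} (h : ∀ i, f (coord _ i) = g (coord _ i)) :
    f = g := by
  refine Ideal.Quotient.ringHom_ext (MvPolynomial.ringHom_ext (fun r => ?_) h)
  exact DFunLike.congr_fun (RingHom.ext_int
    (((f.comp (Ideal.Quotient.mk _)).comp MvPolynomial.C).comp ULift.ringEquiv.symm.toRingHom)
    (((g.comp (Ideal.Quotient.mk _)).comp MvPolynomial.C).comp ULift.ringEquiv.symm.toRingHom))
      r.down

/-- The ring homomorphism from the coordinate ring of the integral algebraic simplex given by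
elements with sum `1`. -/
def liftInt {n : ℕ} {A : Type*} [CommRing A] (a : Fin (n + 1) → A) (ha : ∑ i, a i = 1) :
    SimplexRing (ULift.{u} ℤ) n →+* A :=
  letI : Algebra (ULift.{u} ℤ) A := ((algebraMap ℤ A).comp ULift.ringEquiv.toRingHom).toAlgebra
  (lift a ha).toRingHom

lemma liftInt_coord {n : ℕ} {A : Type*} [CommRing A] (a : Fin (n + 1) → A) (ha : ∑ i, a i = 1)
    (i : Fin (n + 1)) : liftInt.{u} a ha (coord _ i) = a i :=
  letI : Algebra (ULift.{u} ℤ) A := ((algebraMap ℤ A).comp ULift.ringEquiv.toRingHom).toAlgebra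
  lift_coord a ha i

end SimplexRing

/-- The barycentric coordinates of the algebraic simplex. -/
def simplexCoord (S : Scheme.{u}) (n : SimplexCategory) (i : Fin (n.len + 1)) :
    Functions ((algSimplex S).obj n) :=
  pullSpec (pullback.snd (specULiftZIsTerminal.from S) (SimplexRing.toSpec (ULift.{u} ℤ) n.len))
    (SimplexRing.coord _ i)

lemma sum_simplexCoord (n : SimplexCategory) : ∑ i, simplexCoord S n i = 1 := by
  refine (map_sum (pullSpec (pullback.snd (specULiftZIsTerminal.from S)
    (SimplexRing.toSpec (ULift.{u} ℤ) n.len))) _ _).symm.trans ?_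
  rw [SimplexRing.sum_coord, map_one]
  rfl

lemma toSimplex_ext {V : Sm S} {n : SimplexCategory} {f g : V ⟶ (algSimplex S).obj n}
    (h : ∀ i, pull f (simplexCoord S n i) = pull g (simplexCoord S n i)) : f = g := by
  refine Sm.hom_ext (pullback.hom_ext ((Over.w f.hom).trans (Over.w g.hom).symm) ?_)
  exact pullSpec_injective (SimplexRing.ringHom_ext h)

/-- The morphism to the algebraic simplex with given barycentric coordinates. -/
def toSimplex {V : Sm S} (n : SimplexCategory) (a : Fin (n.len + 1) → Functions V)
    (ha : ∑ i, a i = 1) : V ⟶ (algSimplex S).obj n :=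
  ObjectProperty.homMk (Over.homMk (pullback.lift V.obj.hom (V.obj.left.toSpecΓ ≫
    Spec.map (CommRingCat.ofHom (SimplexRing.liftInt a ha)))
      (specULiftZIsTerminal.hom_ext _ _)) (pullback.lift_fst _ _ _))

lemma pull_toSimplex {V : Sm S} (n : SimplexCategory) (a : Fin (n.len + 1) → Functions V)
    (ha : ∑ i, a i = 1) (i : Fin (n.len + 1)) :
    pull (toSimplex n a ha) (simplexCoord S n i) = a i := by
  have h := pullback.lift_snd (f := specULiftZIsTerminal.from S)
    (g := SimplexRing.toSpec (ULift.{u} ℤ) n.len) V.obj.hom (V.obj.left.toSpecΓ ≫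
    Spec.map (CommRingCat.ofHom (SimplexRing.liftInt a ha)))
      (specULiftZIsTerminal.hom_ext _ _)
  refine (congrArg (fun k => pullSpec k (SimplexRing.coord _ i)) h).trans ?_
  rw [pullSpec_toSpecΓ]
  exact SimplexRing.liftInt_coord a ha i

lemma pull_algSimplex_map {m n : SimplexCategory} (θ : m ⟶ n) (j : Fin (n.len + 1)) :
    pull ((algSimplex S).map θ) (simplexCoord S n j) =
      ∑ i with θ.toOrderHom i = j, simplexCoord S m i := by
  have h := congrArg (fun k => pullSpec k (SimplexRing.coord _ j)) (algSimplexMap_snd S θ)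
  have h₁ : (Scheme.ΓSpecIso _).inv ≫ (SimplexRing.specMap (ULift.{u} ℤ) θ).appTop =
      CommRingCat.ofHom (SimplexRing.map θ).toRingHom ≫ (Scheme.ΓSpecIso _).inv :=
    (Scheme.ΓSpecIso_inv_naturality _).symm
  have h₂ : (SimplexRing.specMap (ULift.{u} ℤ) θ).appTop.hom
      ((Scheme.ΓSpecIso _).inv.hom (SimplexRing.coord _ j)) =
        (Scheme.ΓSpecIso _).inv.hom (SimplexRing.map θ (SimplexRing.coord _ j)) :=
    congrArg (fun k => k.hom (SimplexRing.coord _ j)) h₁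
  refine Eq.trans h (Eq.trans (congrArg (pullback.snd (specULiftZIsTerminal.from S)
    (SimplexRing.toSpec (ULift.{u} ℤ) m.len)).appTop.hom h₂) ?_)
  rw [SimplexRing.map_coord, map_sum, map_sum]
  rfl

/-- The section of `V ×_S 𝔸¹ ⟶ V` given by a function. -/
def lineSection {V : Sm S} (s : Functions V) : V ⟶ Sm.prod V (affineLine S) :=
  Sm.prodLift (𝟙 V) (toLine s)

lemma lineSection_fst {V : Sm S} (s : Functions V) :
    lineSection s ≫ Sm.prodFst V (affineLine S) = 𝟙 V :=
  Sm.prodLift_fst _ _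

lemma pull_lineSection {V : Sm S} (s : Functions V) :
    pull (lineSection s) (pull (Sm.prodSnd V (affineLine S)) (lineCoord S)) = s := by
  rw [← pull_comp, lineSection, Sm.prodLift_snd, pull_toLine]

/-! ### `𝔸¹`-homotopies -/

/-- The sum of those barycentric coordinates which belong to vertices lying over `1`. -/
def upperCoord (V : Sm S) {m : SimplexCategoryᵒᵖ} (t : (Δ[1] : SSet.{w}).obj m) :
    Functions (Sm.prod V ((algSimplex S).obj m.unop)) :=
  ∑ i with vtx t i = 1, pull (Sm.prodSnd V _) (simplexCoord S m.unop i)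

lemma upperCoord_eq_zero (V : Sm S) {m : SimplexCategoryᵒᵖ} (t : (Δ[1] : SSet.{w}).obj m)
    (h : ∀ i, vtx t i = 0) : upperCoord V t = 0 :=
  Finset.sum_eq_zero fun i hi =>
    absurd ((h i).symm.trans (Finset.mem_filter.1 hi).2) (by decide)

lemma upperCoord_eq_one (V : Sm S) {m : SimplexCategoryᵒᵖ} (t : (Δ[1] : SSet.{w}).obj m)
    (h : ∀ i, vtx t i = 1) : upperCoord V t = 1 := by
  rw [upperCoord, Finset.filter_true_of_mem fun i _ => h i, ← map_sum, sum_simplexCoord, map_one]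

lemma pull_upperCoord (V : Sm S) {m m' : SimplexCategoryᵒᵖ} (θ : m ⟶ m')
    (t : (Δ[1] : SSet.{w}).obj m) :
    pull (Sm.prodMap (𝟙 V) ((algSimplex S).map θ.unop)) (upperCoord V t) =
      upperCoord V ((Δ[1] : SSet.{w}).map θ t) := by
  rw [upperCoord, map_sum, upperCoord]
  simp_rw [← pull_comp, Sm.prodMap_snd, pull_comp, pull_algSimplex_map, map_sum]
  refine (Finset.sum_comm' (t' := Finset.univ.filter fun j => vtx t (θ.unop.toOrderHom j) = 1)
    (s' := fun j => {θ.unop.toOrderHom j}) fun i j => ?_).trans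
      (Finset.sum_congr rfl fun j _ => Finset.sum_singleton _ _)
  simp only [Finset.mem_filter, Finset.mem_univ, true_and, Finset.mem_singleton]
  constructor
  · rintro ⟨h, rfl⟩
    exact ⟨rfl, h⟩
  · rintro ⟨rfl, h⟩
    exact ⟨h, rfl⟩

/-- The morphism `(v, x) ↦ ((v, ∑ xᵢ), x)`, with the sum over the vertices of `t` lying
over `1`. -/
def prism (V : Sm S) {m : SimplexCategoryᵒᵖ} (t : (Δ[1] : SSet.{w}).obj m) :
    Sm.prod V ((algSimplex S).obj m.unop) ⟶
      Sm.prod (Sm.prod V (affineLine S)) ((algSimplex S).obj m.unop) :=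
  Sm.prodLift (Sm.prodLift (Sm.prodFst _ _) (toLine (upperCoord V t))) (Sm.prodSnd _ _)

lemma prism_naturality (V : Sm S) {m m' : SimplexCategoryᵒᵖ} (θ : m ⟶ m')
    (t : (Δ[1] : SSet.{w}).obj m) :
    Sm.prodMap (𝟙 V) ((algSimplex S).map θ.unop) ≫ prism V t =
      prism V ((Δ[1] : SSet.{w}).map θ t) ≫ Sm.prodMap (𝟙 _) ((algSimplex S).map θ.unop) := by
  rw [prism, prism, Sm.prodLift_prodMap, Sm.comp_prodLift, Sm.comp_prodLift, comp_toLine,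
    Sm.prodMap_fst, Sm.prodMap_snd, pull_upperCoord, Category.comp_id, Category.comp_id]

/-- Where the function used in `prism` is constant, the morphism is a product. -/
lemma prism_eq (V : Sm S) {m : SimplexCategoryᵒᵖ} (t : (Δ[1] : SSet.{w}).obj m) (s : Functions V)
    (h : upperCoord V t = pull (Sm.prodFst _ _) s) :
    prism V t = Sm.prodMap (lineSection s) (𝟙 ((algSimplex S).obj m.unop)) := by
  apply Sm.prod_hom_ext
  · rw [prism, Sm.prodLift_fst, Sm.prodMap_fst, lineSection, Sm.comp_prodLift, comp_toLine, h,
      Category.comp_id]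
  · rw [prism, Sm.prodLift_snd, Sm.prodMap_snd, Category.comp_id]

lemma map_op_comp_apply {C : Type w} [Category.{v} C] (X : SPre C) {a b c : C} (f : a ⟶ b)
    (g : b ⟶ c) {m : SimplexCategoryᵒᵖ} (x : (X.obj (op c)).obj m) :
    (X.map (f ≫ g).op).app m x = (X.map f.op).app m ((X.map g.op).app m x) :=
  congrArg (fun k => k.app m x) (X.map_comp g.op f.op)

/-- The two constant sections of `V ×_S 𝔸¹ ⟶ V` induce homotopic maps on the singular
construction: the homotopy is given by the functions `upperCoord` on `V ×_S Δⁿ`. -/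
lemma homotopic_singA1_map_lineSection (X : SPre (Sm S)) (V : Sm S) :
    Homotopic (((singA1 S).obj X).map (lineSection (0 : Functions V)).op)
      (((singA1 S).obj X).map (lineSection (1 : Functions V)).op) := by
  refine ⟨⟨fun m => ↾fun x => (X.map (prism V x.2).op).app m x.1,
    fun m m' θ => ConcreteCategory.hom_ext _ _ fun x => ?_⟩, hom_ext_app fun m x => ?_,
      hom_ext_app fun m x => ?_⟩
  · change (X.map (prism V ((Δ[1] : SSet.{u + 1}).map θ x.2)).op).app m' ((X.obj _).map θ
      ((X.map (Sm.prodMap (𝟙 _) ((algSimplex S).map θ.unop)).op).app m x.1)) = (X.obj _).map θ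
        ((X.map (Sm.prodMap (𝟙 V) ((algSimplex S).map θ.unop)).op).app m
          ((X.map (prism V x.2).op).app m x.1))
    rw [app_map]
    refine congrArg ((X.obj _).map θ) ?_
    exact (map_op_comp_apply X _ _ x.1).symm.trans
      ((congrArg (fun k => (X.map k.op).app m x.1) (prism_naturality V θ x.2)).symm.trans
        (map_op_comp_apply X _ _ x.1))
  · refine congrArg (fun k => (X.map k.op).app m x) (prism_eq V _ 0 ?_)
    exact (upperCoord_eq_zero V _ (vtx_cylEnd 0 x)).trans (map_zero _).symm
  · refine congrArg (fun k => (X.map k.op).app m x) (prism_eq V _ 1 ?_)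
    exact (upperCoord_eq_one V _ (vtx_cylEnd 1 x)).trans (map_one _).symm

/-- `𝔸¹`-homotopic morphisms induce the same map of singular constructions up to homotopy. -/
lemma mk_singA1_map_eq (X : SPre (Sm S)) {V W : Sm S} (h : Sm.prod V (affineLine S) ⟶ W) :
    HomotopyClasses.mk (((singA1 S).obj X).map (lineSection (0 : Functions V) ≫ h).op) =
      .mk (((singA1 S).obj X).map (lineSection (1 : Functions V) ≫ h).op) := by
  rw [op_comp, op_comp, Functor.map_comp, Functor.map_comp]
  exact HomotopyClasses.sound ((homotopic_singA1_map_lineSection X V).precomp _)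

/-- The multiplication homotopy `((u, x), t) ↦ (u, t x)`. -/
def lineContraction (U : Sm S) :
    Sm.prod (Sm.prod U (affineLine S)) (affineLine S) ⟶ Sm.prod U (affineLine S) :=
  Sm.prodLift (Sm.prodFst _ _ ≫ Sm.prodFst _ _) (toLine (pull (Sm.prodSnd _ _) (lineCoord S) *
    pull (Sm.prodFst _ _) (pull (Sm.prodSnd _ _) (lineCoord S))))

lemma lineSection_lineContraction (U : Sm S) (s : Functions (Sm.prod U (affineLine S))) :
    lineSection s ≫ lineContraction U = Sm.prodLift (Sm.prodFst _ _)
      (toLine (s * pull (Sm.prodSnd _ _) (lineCoord S))) := by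
  rw [lineContraction, Sm.comp_prodLift, ← Category.assoc, lineSection_fst, Category.id_comp,
    comp_toLine, map_mul, pull_lineSection, ← pull_comp, lineSection_fst, pull_id]

/-- The singular construction is `𝔸¹`-invariant: the zero section is a homotopy inverse. -/
theorem isA1Invariant_singA1 (X : SPre (Sm S)) : IsA1Invariant ((singA1 S).obj X) := by
  intro U
  refine weakEquiv_of_homotopyInverse _
    (((singA1 S).obj X).map (lineSection (0 : Functions U)).op) ?_ ?_
  · rw [← Functor.map_comp, ← op_comp, lineSection_fst, op_id, CategoryTheory.Functor.map_id]
  · have h := mk_singA1_map_eq X (lineContraction U)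
    rw [lineSection_lineContraction, lineSection_lineContraction, zero_mul, one_mul] at h
    rw [← Functor.map_comp, ← op_comp, ← CategoryTheory.Functor.map_id, ← op_id]
    convert h using 4
    · rw [lineSection, Sm.comp_prodLift, Category.comp_id, comp_toLine, map_zero]
    · refine (Sm.prodLift_fst_snd _ _).symm.trans (congrArg _ (toLine_ext ?_))
      rw [pull_toLine]

/-! ### `𝔸¹`-invariant presheaves do not see the algebraic simplices -/

/-- A case of the two-out-of-six property. -/
lemma weakEquiv_of_retraction_comp {A B : SSet.{w}} (e : A ⟶ B) (r : B ⟶ A) (h : e ≫ r = 𝟙 A)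
    (h' : weakEquiv (r ≫ e)) : weakEquiv e := by
  intro K hK
  have hc : ∀ {X Y Z : SSet.{w}} (f : X ⟶ Y) (g : Y ⟶ Z) (z : HomotopyClasses Z K),
      HomotopyClasses.precomp (f ≫ g) K z = HomotopyClasses.precomp f K (.precomp g K z) := by
    rintro X Y Z f g ⟨z⟩
    exact congrArg HomotopyClasses.mk (Category.assoc f g z)
  refine ⟨fun x y hxy => (h' K).1 ?_, fun x => ⟨HomotopyClasses.precomp r K x, ?_⟩⟩
  · rw [hc, hc, hxy]
  · rw [← hc, h]
    obtain ⟨x⟩ := x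
    exact congrArg HomotopyClasses.mk (Category.id_comp x)

lemma IsA1Invariant.weakEquiv_map_lineSection {Y : SPre (Sm S)} (hY : IsA1Invariant Y) {V : Sm S}
    (s : Functions V) : weakEquiv (Y.map (lineSection s).op) := by
  refine weakEquiv.of_precomp _ _ (hY V) ?_
  rw [← Functor.map_comp, ← op_comp, lineSection_fst]
  exact weakEquiv_of_isIso _

section

variable (U : Sm S) (n : SimplexCategory)

/-- The section of `U ×_S Δⁿ ⟶ U` at the zeroth vertex. -/
def vertexSection : U ⟶ Sm.prod U ((algSimplex S).obj n) :=
  Sm.prodLift (𝟙 U) (toSimplex n (fun i => if i = 0 then 1 else 0) (by simp))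

lemma vertexSection_fst : vertexSection U n ≫ Sm.prodFst _ _ = 𝟙 U := Sm.prodLift_fst _ _

/-- The linear contraction of `U ×_S Δⁿ` to the zeroth vertex. -/
def simplexContraction :
    Sm.prod (Sm.prod U ((algSimplex S).obj n)) (affineLine S) ⟶
      Sm.prod U ((algSimplex S).obj n) :=
  Sm.prodLift (Sm.prodFst _ _ ≫ Sm.prodFst _ _) (toSimplex n
    (fun i => pull (Sm.prodSnd _ _) (lineCoord S) *
      pull (Sm.prodFst _ _) (pull (Sm.prodSnd _ _) (simplexCoord S n i)) +
        (1 - pull (Sm.prodSnd _ _) (lineCoord S)) * if i = 0 then 1 else 0) (by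
      rw [Finset.sum_add_distrib, ← Finset.mul_sum, ← Finset.mul_sum, ← map_sum, ← map_sum,
        sum_simplexCoord]
      simp))

lemma lineSection_zero_simplexContraction :
    lineSection 0 ≫ simplexContraction U n = Sm.prodFst _ _ ≫ vertexSection U n := by
  rw [simplexContraction, vertexSection, Sm.comp_prodLift, Sm.comp_prodLift, ← Category.assoc,
    lineSection_fst, Category.id_comp, Category.comp_id]
  refine congrArg _ (toSimplex_ext fun i => ?_)
  rw [pull_comp, pull_comp, pull_toSimplex, pull_toSimplex, map_add, map_mul, map_mul, map_sub,
    pull_lineSection]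
  split_ifs <;> simp

lemma lineSection_one_simplexContraction :
    lineSection 1 ≫ simplexContraction U n = 𝟙 _ := by
  rw [simplexContraction, Sm.comp_prodLift, ← Category.assoc,
    lineSection_fst, Category.id_comp, ← Sm.prodLift_fst_snd]
  refine congrArg _ (toSimplex_ext fun i => ?_)
  rw [pull_comp, pull_toSimplex, map_add, map_mul, map_mul, map_sub,
    pull_lineSection, ← pull_comp, lineSection_fst, pull_id]
  simp

end

/-- An `𝔸¹`-invariant presheaf `Y` satisfies `Y(U) ≃ Y(U ×_S Δⁿ)`, by linear contraction of the
algebraic simplex. -/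
theorem IsA1Invariant.weakEquiv_map_prodFst_algSimplex {Y : SPre (Sm S)} (hY : IsA1Invariant Y)
    (U : Sm S) (n : SimplexCategory) :
    weakEquiv (Y.map (Sm.prodFst U ((algSimplex S).obj n)).op) := by
  refine weakEquiv_of_retraction_comp _ (Y.map (vertexSection U n).op) ?_ ?_
  · rw [← Functor.map_comp, ← op_comp, vertexSection_fst, op_id, CategoryTheory.Functor.map_id]
  · have h : weakEquiv (Y.map (simplexContraction U n).op) := by
      refine weakEquiv.of_postcomp _ _ (hY.weakEquiv_map_lineSection 1) ?_
      rw [← Functor.map_comp, ← op_comp, lineSection_one_simplexContraction]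
      exact weakEquiv_of_isIso _
    rw [← Functor.map_comp, ← op_comp, ← lineSection_zero_simplexContraction, op_comp,
      Functor.map_comp]
    exact weakEquiv.comp_mem _ _ h (hY.weakEquiv_map_lineSection 0)

end Geometry

/-! ### The singular construction in the homotopy category -/

/-- Let `g : 𝟭 ⟶ G` be a natural transformation to an endofunctor which preserves `W`. If `K` is
local in the sense that `g_K` becomes invertible in the localization, then so does every morphism
`A ⟶ K` of the localization extend uniquely along `g_A`, provided that `G(g_A)` becomes epi. -/
lemma bijective_precomp_of_localization {D : Type*} [Category* D] (W : MorphismProperty D)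
    (G : D ⥤ D) (hG : W.IsInvertedBy (G ⋙ W.Q)) (g : 𝟭 D ⟶ G) (A K : D)
    (hA : Epi (W.Q.map (G.map (g.app A)))) (hK : IsIso (W.Q.map (g.app K))) :
    Function.Bijective
      fun α : W.Q.obj (G.obj A) ⟶ W.Q.obj K => W.Q.map (g.app A) ≫ α := by
  let F := Localization.lift (G ⋙ W.Q) hG W.Q
  let e : W.Q ⋙ F ≅ G ⋙ W.Q := Localization.fac (G ⋙ W.Q) hG W.Q
  let τ : W.Q ⟶ G ⋙ W.Q := Functor.whiskerRight g W.Q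
  let γ : 𝟭 _ ⟶ F := Localization.liftNatTrans W.Q W W.Q (G ⋙ W.Q) (𝟭 _) F τ
  have hγ : ∀ B, γ.app (W.Q.obj B) = W.Q.map (g.app B) ≫ e.inv.app B := fun B =>
    (Localization.liftNatTrans_app W.Q W W.Q (G ⋙ W.Q) (𝟭 _) F τ B).trans (Category.id_comp _)
  have hγK : IsIso (γ.app (W.Q.obj K)) := by
    rw [hγ]
    exact IsIso.comp_isIso
  constructor
  · intro α β hαβ
    have h : F.map (W.Q.map (g.app A)) ≫ F.map α = F.map (W.Q.map (g.app A)) ≫ F.map β := by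
      rw [← Functor.map_comp, ← Functor.map_comp]
      exact congrArg F.map hαβ
    have he : F.map (W.Q.map (g.app A)) =
        e.hom.app A ≫ W.Q.map (G.map (g.app A)) ≫ e.inv.app (G.obj A) := by
      have := e.hom.naturality (g.app A)
      exact (Iso.eq_comp_inv (e.app (G.obj A))).2 this |>.trans (Category.assoc _ _ _)
    have : Epi (F.map (W.Q.map (g.app A))) := by
      rw [he]
      exact epi_comp _ _
    rw [cancel_epi] at h
    rw [← cancel_mono (γ.app (W.Q.obj K))]
    exact (γ.naturality α).trans ((congrArg (_ ≫ ·) h).trans (γ.naturality β).symm)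
  · intro α
    refine ⟨e.inv.app A ≫ F.map α ≫ inv (γ.app (W.Q.obj K)), ?_⟩
    change W.Q.map (g.app A) ≫ e.inv.app A ≫ F.map α ≫ inv (γ.app (W.Q.obj K)) = α
    have h : α ≫ γ.app (W.Q.obj K) = γ.app (W.Q.obj A) ≫ F.map α := γ.naturality α
    rw [← Category.assoc, ← hγ, ← Category.assoc, ← h, Category.assoc, IsIso.hom_inv_id,
      Category.comp_id]

section Singular

variable {S : Scheme.{u}}

instance : LocallySmall.{u + 1} (Sm S) where
  hom_small _ _ := small_succ _

lemma objectwiseWeakEquiv_singA1_map {X Y : SPre (Sm S)} {f : X ⟶ Y}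
    (hf : objectwiseWeakEquiv (Sm S) f) : objectwiseWeakEquiv (Sm S) ((singA1 S).map f) :=
  fun U => weakEquiv_realization_map (((simplexEvaluation S).map f).app U) fun _ => hf _

/-- The projections `U ×_S Δⁿ ⟶ U` as a map of simplicial objects. -/
def constToSimplexEvaluation (X : SPre (Sm S)) (U : (Sm S)ᵒᵖ) :
    (Functor.const SimplexCategoryᵒᵖ).obj (X.obj U) ⟶ ((simplexEvaluation S).obj X).obj U where
  app n := X.map (Sm.prodFst U.unop ((algSimplex S).obj n.unop)).op
  naturality m n θ := by
    have h : Sm.prodMap (𝟙 U.unop) ((algSimplex S).map θ.unop) ≫ Sm.prodFst _ _ =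
      Sm.prodFst _ _ := by rw [Sm.prodMap_fst, Category.comp_id]
    refine (Category.id_comp _).trans (Eq.trans ?_ (X.map_comp _ _))
    exact congrArg (fun f => X.map f.op) h.symm

/-- A simplicial set is the realization of the constant simplicial object. -/
def realizationConst (A : SSet.{w}) :
    A ≅ realization.obj ((Functor.const SimplexCategoryᵒᵖ).obj A) :=
  NatIso.ofComponents (fun _ => Iso.refl _)

/-- An `𝔸¹`-invariant presheaf is equivalent to its singular construction. -/
theorem IsA1Invariant.objectwiseWeakEquiv_toSingA1 {X : SPre (Sm S)} (hX : IsA1Invariant X) :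
    objectwiseWeakEquiv (Sm S) ((toSingA1 S).app X) := fun U =>
  weakEquiv.comp_mem (realizationConst (X.obj U)).hom
    (realization.map (constToSimplexEvaluation X U)) (weakEquiv_of_isIso _)
      (weakEquiv_realization_map _ fun n => hX.weakEquiv_map_prodFst_algSimplex U.unop n.unop)

/-- The morphism `(u, x) ↦ ((u, x), x)`. -/
def simplexDiag (U : Sm S) (n : SimplexCategory) : Sm.prod U ((algSimplex S).obj n) ⟶
    Sm.prod (Sm.prod U ((algSimplex S).obj n)) ((algSimplex S).obj n) :=
  Sm.prodLift (𝟙 _) (Sm.prodSnd _ _)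

lemma simplexDiag_naturality_right (U : Sm S) {m n : SimplexCategory} (θ : m ⟶ n) :
    Sm.prodMap (𝟙 U) ((algSimplex S).map θ) ≫ simplexDiag U n =
      simplexDiag U m ≫ Sm.prodMap (𝟙 _) ((algSimplex S).map θ) ≫
        Sm.prodMap (Sm.prodMap (𝟙 U) ((algSimplex S).map θ)) (𝟙 _) := by
  rw [simplexDiag, simplexDiag, ← Sm.prodMap_comp, Sm.prodLift_prodMap, Sm.comp_prodLift,
    Sm.prodMap_snd, Category.id_comp, Category.comp_id, Category.comp_id, Category.id_comp]

lemma simplexDiag_naturality_left {U V : Sm S} (f : V ⟶ U) (n : SimplexCategory) :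
    Sm.prodMap f (𝟙 ((algSimplex S).obj n)) ≫ simplexDiag U n =
      simplexDiag V n ≫ Sm.prodMap (Sm.prodMap f (𝟙 _)) (𝟙 _) := by
  rw [simplexDiag, simplexDiag, Sm.prodLift_prodMap, Sm.comp_prodLift, Sm.prodMap_snd,
    Category.id_comp, Category.comp_id, Category.comp_id]

lemma simplexDiag_fst (U : Sm S) (n : SimplexCategory) :
    simplexDiag U n ≫ Sm.prodFst _ _ = 𝟙 _ := Sm.prodLift_fst _ _

lemma simplexDiag_prodMap_fst (U : Sm S) (n : SimplexCategory) :
    simplexDiag U n ≫ Sm.prodMap (Sm.prodFst _ _) (𝟙 _) = 𝟙 _ := by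
  rw [simplexDiag, Sm.prodLift_prodMap, Category.id_comp, Category.comp_id, Sm.prodLift_fst_snd]

lemma map_map_op_comp_apply {C : Type w} [Category.{v} C] (X : SPre C) {a b c d : C}
    {f : a ⟶ b} {g : b ⟶ d} {f' : a ⟶ c} {g' : c ⟶ d} (h : f ≫ g = f' ≫ g')
    {m : SimplexCategoryᵒᵖ} (x : (X.obj (op d)).obj m) :
    (X.map f.op).app m ((X.map g.op).app m x) = (X.map f'.op).app m ((X.map g'.op).app m x) := by
  rw [← map_op_comp_apply, ← map_op_comp_apply, h]

lemma map_op_apply_of_eq_id {C : Type w} [Category.{v} C] (X : SPre C) {a b : C}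
    {f : a ⟶ b} {g : b ⟶ a} (h : f ≫ g = 𝟙 a) {m : SimplexCategoryᵒᵖ}
    (x : (X.obj (op a)).obj m) :
    (X.map f.op).app m ((X.map g.op).app m x) = x := by
  rw [← map_op_comp_apply, h]
  exact congrArg (fun k => k.app m x) (X.map_id _)

lemma singA1Diag_naturality (X : SPre (Sm S)) (U : Sm S) {m n : SimplexCategoryᵒᵖ} (θ : m ⟶ n)
    (x : (X.obj (op (Sm.prod (Sm.prod U ((algSimplex S).obj m.unop))
      ((algSimplex S).obj m.unop)))).obj m) :
    (X.map (simplexDiag U n.unop).op).app n ((X.obj _).map θ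
      ((X.map (Sm.prodMap (𝟙 _) ((algSimplex S).map θ.unop)).op).app m
        ((X.map (Sm.prodMap (Sm.prodMap (𝟙 U) ((algSimplex S).map θ.unop)) (𝟙 _)).op).app m x))) =
      (X.obj _).map θ ((X.map (Sm.prodMap (𝟙 U) ((algSimplex S).map θ.unop)).op).app m
        ((X.map (simplexDiag U m.unop).op).app m x)) := by
  rw [app_map]
  refine congrArg ((X.obj _).map θ) ?_
  rw [← map_op_comp_apply X (Sm.prodMap (𝟙 _) ((algSimplex S).map θ.unop))]
  exact (map_map_op_comp_apply X (simplexDiag_naturality_right U θ.unop) x).symm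

/-- The diagonal `Sing Sing X ⟶ Sing X`, induced by `(u, x) ↦ ((u, x), x)`. -/
def singA1Diag (X : SPre (Sm S)) :
    (singA1 S).obj ((singA1 S).obj X) ⟶ (singA1 S).obj X where
  app U :=
    { app := fun n => (X.map (simplexDiag U.unop n.unop).op).app n
      naturality := fun _ _ θ => ConcreteCategory.hom_ext _ _ fun x =>
        singA1Diag_naturality X U.unop θ x }
  naturality _ _ f := NatTrans.ext <| funext fun n => ConcreteCategory.hom_ext _ _ fun x =>
    (map_map_op_comp_apply X (simplexDiag_naturality_left f.unop n.unop) x).symm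

lemma toSingA1_singA1Diag (X : SPre (Sm S)) :
    (toSingA1 S).app ((singA1 S).obj X) ≫ singA1Diag X = 𝟙 _ :=
  NatTrans.ext (funext fun U => hom_ext_app fun n x =>
    map_op_apply_of_eq_id X (simplexDiag_prodMap_fst U.unop n.unop) x)

lemma singA1_map_toSingA1_singA1Diag (X : SPre (Sm S)) :
    (singA1 S).map ((toSingA1 S).app X) ≫ singA1Diag X = 𝟙 _ :=
  NatTrans.ext (funext fun U => hom_ext_app fun n x =>
    map_op_apply_of_eq_id X (simplexDiag_fst U.unop n.unop) x)

/-- In the homotopy category, `Sing(g_X) = g_{Sing X}`, since the two maps have a common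
retraction and the second one is invertible. -/
lemma isIso_Q_map_singA1_map_toSingA1 (X : SPre (Sm S)) :
    IsIso ((objectwiseWeakEquiv (Sm S)).Q.map ((singA1 S).map ((toSingA1 S).app X))) := by
  let Q := (objectwiseWeakEquiv (Sm S)).Q
  have h₁ : Q.map ((toSingA1 S).app ((singA1 S).obj X)) ≫ Q.map (singA1Diag X) = 𝟙 _ := by
    rw [← Functor.map_comp, toSingA1_singA1Diag, CategoryTheory.Functor.map_id]
  have h₂ : Q.map ((singA1 S).map ((toSingA1 S).app X)) ≫ Q.map (singA1Diag X) = 𝟙 _ := by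
    rw [← Functor.map_comp, singA1_map_toSingA1_singA1Diag, CategoryTheory.Functor.map_id]
  have i₁ : IsIso (Q.map ((toSingA1 S).app ((singA1 S).obj X))) :=
    MorphismProperty.Q_inverts _ _ (isA1Invariant_singA1 X).objectwiseWeakEquiv_toSingA1
  have i₂ : IsIso (Q.map (singA1Diag X)) := by
    rw [← IsIso.inv_eq_of_hom_inv_id h₁]
    infer_instance
  have h₃ : Q.map ((singA1 S).map ((toSingA1 S).app X)) = inv (Q.map (singA1Diag X)) :=
    IsIso.eq_inv_of_inv_hom_id h₂
  change IsIso (Q.map _)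
  rw [h₃]
  infer_instance

/-- In the homotopy category, `𝔸¹`-invariant presheaves are local for `g : X ⟶ Sing X`. -/
theorem bijective_Q_map_toSingA1_comp (X : SPre (Sm S)) {K : SPre (Sm S)} (hK : IsA1Invariant K) :
    Function.Bijective fun α : (objectwiseWeakEquiv (Sm S)).Q.obj ((singA1 S).obj X) ⟶
      (objectwiseWeakEquiv (Sm S)).Q.obj K =>
        (objectwiseWeakEquiv (Sm S)).Q.map ((toSingA1 S).app X) ≫ α := by
  have := isIso_Q_map_singA1_map_toSingA1 X
  exact bijective_precomp_of_localization (objectwiseWeakEquiv (Sm S)) (singA1 S)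
    (fun _ _ f hf => MorphismProperty.Q_inverts _ _ (objectwiseWeakEquiv_singA1_map hf))
    (toSingA1 S) X K inferInstance
    (MorphismProperty.Q_inverts _ _ hK.objectwiseWeakEquiv_toSingA1)

section

variable (L : SSet.{u + 1}) (X : SPre (Sm S))

lemma singA1_tens_map (U : (Sm S)ᵒᵖ) {m n : SimplexCategoryᵒᵖ} (θ : m ⟶ n)
    (x : (X.obj (op (Sm.prod U.unop ((algSimplex S).obj m.unop)))).obj m) (l : L.obj m) :
    (((singA1 S).obj ((tens (Sm S) L).obj X)).obj U).map θ (x, l) =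
      (((((singA1 S).obj X).obj U).map θ x, L.map θ l) :
        (X.obj (op (Sm.prod U.unop ((algSimplex S).obj n.unop))) ⊗ L).obj n) := rfl

lemma singA1_tens_map_app {U V : (Sm S)ᵒᵖ} (f : U ⟶ V) {m : SimplexCategoryᵒᵖ}
    (x : (X.obj (op (Sm.prod U.unop ((algSimplex S).obj m.unop)))).obj m) (l : L.obj m) :
    (((singA1 S).obj ((tens (Sm S) L).obj X)).map f).app m (x, l) =
      (((((singA1 S).obj X).map f).app m x, l) :
        (X.obj (op (Sm.prod V.unop ((algSimplex S).obj m.unop))) ⊗ L).obj m) := rfl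

/-- The comparison of `Sing(X × L)` with `Sing(X) × L`, which is the identity on simplices. -/
def singA1Tens :
    (singA1 S).obj ((tens (Sm S) L).obj X) ⟶ (tens (Sm S) L).obj ((singA1 S).obj X) where
  app U :=
    { app m := ↾fun x : (X.obj (op (Sm.prod U.unop ((algSimplex S).obj m.unop))) ⊗ L).obj m =>
        ((x.1, x.2) : (((singA1 S).obj X).obj U ⊗ L).obj m)
      naturality := fun _ _ θ => ConcreteCategory.hom_ext _ _ fun x =>
        singA1_tens_map L X U θ x.1 x.2 }
  naturality _ _ f := NatTrans.ext (funext fun _ => ConcreteCategory.hom_ext _ _ fun x =>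
    singA1_tens_map_app L X f x.1 x.2)

instance : IsIso (singA1Tens L X) := by
  have (U : (Sm S)ᵒᵖ) : IsIso ((singA1Tens L X).app U) := by
    have (m : SimplexCategoryᵒᵖ) : IsIso (((singA1Tens L X).app U).app m) :=
      (isIso_iff_bijective _).2 Function.bijective_id
    exact NatIso.isIso_of_isIso_app _
  exact NatIso.isIso_of_isIso_app _

lemma toSingA1_singA1Tens :
    (toSingA1 S).app ((tens (Sm S) L).obj X) ≫ singA1Tens L X =
      (tens (Sm S) L).map ((toSingA1 S).app X) :=
  NatTrans.ext (funext fun _ => hom_ext_app fun _ _ => rfl)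

end

lemma IsA1Invariant.of_objectwiseWeakEquiv {Y Y' : SPre (Sm S)} (hY : IsA1Invariant Y)
    (r : Y ⟶ Y') (hr : objectwiseWeakEquiv (Sm S) r) : IsA1Invariant Y' := fun U => by
  refine weakEquiv.of_precomp _ _ (hr (op U)) ?_
  rw [← r.naturality]
  exact weakEquiv.comp_mem _ _ (hY U) (hr _)

lemma bijective_comp_of_isIso {D : Type*} [Category* D] {A A' B B' K : D} {f : A ⟶ A'}
    {g : B ⟶ B'} {p : A ⟶ B} {q : A' ⟶ B'} [IsIso p] [IsIso q] (h : f ≫ q = p ≫ g)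
    (hg : Function.Bijective fun α : B' ⟶ K => g ≫ α) :
    Function.Bijective fun α : A' ⟶ K => f ≫ α := by
  have hf : ∀ α : B' ⟶ K, f ≫ q ≫ α = p ≫ g ≫ α := fun α => by
    rw [← Category.assoc, h, Category.assoc]
  constructor
  · intro α β hαβ
    obtain ⟨α, rfl⟩ : ∃ α', α = q ≫ α' := ⟨inv q ≫ α, by simp⟩
    obtain ⟨β, rfl⟩ : ∃ β', β = q ≫ β' := ⟨inv q ≫ β, by simp⟩
    change f ≫ q ≫ α = f ≫ q ≫ β at hαβ
    rw [hf, hf, cancel_epi] at hαβ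
    rw [hg.1 hαβ]
  · intro α
    obtain ⟨β, hβ⟩ := hg.2 (inv p ≫ α)
    refine ⟨q ≫ β, (hf β).trans ?_⟩
    change g ≫ β = _ at hβ
    rw [hβ, IsIso.hom_inv_id_assoc]

/-- For each resolution of `g : X ⟶ Sing X` the map of mapping spaces is a weak equivalence,
because the tensors of `g` are again of this form, up to isomorphism. -/
theorem weakEquiv_mappingSpacePrecomp_of_resolution (X : SPre (Sm S)) {Y : SPre (Sm S)}
    (hY : IsA1Invariant Y) (ρ : Resolution ((toSingA1 S).app X) Y) :
    weakEquiv (mappingSpacePrecomp ρ.Qg ρ.RY) := by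
  refine weakEquiv_mappingSpacePrecomp _ ρ.cofibrant_QX ρ.cofibrant_QZ ρ.fibrant_RY fun L => ?_
  let Q := (objectwiseWeakEquiv (Sm S)).Q
  have i₁ : IsIso (Q.map ((tens (Sm S) L).map ρ.p)) :=
    MorphismProperty.Q_inverts _ _ (objectwiseWeakEquiv_tens_map ρ.weakEquiv_p L)
  have i₂ : IsIso (Q.map ((tens (Sm S) L).map ρ.q)) :=
    MorphismProperty.Q_inverts _ _ (objectwiseWeakEquiv_tens_map ρ.weakEquiv_q L)
  refine bijective_comp_of_isIso (p := Q.map ((tens (Sm S) L).map ρ.p))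
    (q := Q.map ((tens (Sm S) L).map ρ.q) ≫ Q.map (inv (singA1Tens L X))) ?_
    (bijective_Q_map_toSingA1_comp ((tens (Sm S) L).obj X)
      (hY.of_objectwiseWeakEquiv ρ.r ρ.weakEquiv_r))
  have h : (tens (Sm S) L).map ρ.Qg ≫ (tens (Sm S) L).map ρ.q ≫ inv (singA1Tens L X) =
      (tens (Sm S) L).map ρ.p ≫ (toSingA1 S).app ((tens (Sm S) L).obj X) := by
    have h₁ : (tens (Sm S) L).map ((toSingA1 S).app X) ≫ inv (singA1Tens L X) =
        (toSingA1 S).app ((tens (Sm S) L).obj X) :=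
      (IsIso.comp_inv_eq _).2 (toSingA1_singA1Tens L X).symm
    rw [← h₁, ← Category.assoc, ← Functor.map_comp, ρ.comm]
    exact (congrArg (· ≫ inv (singA1Tens L X)) ((tens (Sm S) L).map_comp _ _)).trans
      (Category.assoc _ _ _)
  have h' := congrArg Q.map h
  rw [Functor.map_comp, Functor.map_comp, Functor.map_comp] at h'
  exact h'

end Singular

/-! ### Resolutions -/

section Resolution

variable {C : Type w} [Category.{v} C] [LocallySmall.{w} C]

/-- Resolutions are obtained from the factorizations of the projective model structure. -/
theorem nonempty_resolution {X Z : SPre C} (g : X ⟶ Z) (Y : SPre C) :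
    Nonempty (Resolution g Y) := by
  let F₁ := MorphismProperty.factorizationData (cofibrations (SPre C))
    (trivialFibrations (SPre C)) (initial.to X)
  let F₂ := MorphismProperty.factorizationData (cofibrations (SPre C))
    (trivialFibrations (SPre C)) (F₁.p ≫ g)
  let F₃ := MorphismProperty.factorizationData (trivialCofibrations (SPre C))
    (fibrations (SPre C)) (terminal.from Y)
  have h₁ : cofibrations (SPre C) F₁.i := F₁.hi
  have e₁ : F₁.i = initial.to F₁.Z := initialIsInitial.hom_ext _ _
  have e₂ : initial.to F₂.Z = initial.to F₁.Z ≫ F₂.i := initialIsInitial.hom_ext _ _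
  have e₃ : terminal.from F₃.Z = F₃.p := terminalIsTerminal.hom_ext _ _
  have h₂ : cofibrations (SPre C) (initial.to F₂.Z) := by
    rw [e₂, ← e₁]
    exact (cofibrations (SPre C)).comp_mem _ _ h₁ F₂.hi
  exact ⟨{
    QX := F₁.Z
    p := F₁.p
    cofibrant_QX := by
      rw [IsProjectiveCofibrant, ← e₁]
      exact h₁
    weakEquiv_p := F₁.hp.2
    QZ := F₂.Z
    q := F₂.p
    cofibrant_QZ := h₂
    weakEquiv_q := F₂.hp.2
    Qg := F₂.i
    comm := F₂.fac
    RY := F₃.Z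
    r := F₃.i
    fibrant_RY := by
      rw [IsProjectiveFibrant, e₃]
      exact F₃.hp
    weakEquiv_r := F₃.hi.2 }⟩

end Resolution

end MotivicSing

end

theorem mainTheorem5 (S : Scheme.{u}) [IsNoetherian S] [S.IsSeparated]
    (X : MotivicSing.SPre (MotivicSing.Sm S)) :
    MotivicSing.IsA1Invariant ((MotivicSing.singA1 S).obj X) ∧
      ∀ Y : MotivicSing.SPre (MotivicSing.Sm S), MotivicSing.IsA1Invariant Y →
        MotivicSing.InducesWeakEquivOnMap ((MotivicSing.toSingA1 S).app X) Y := by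
  refine ⟨MotivicSing.isA1Invariant_singA1 X, fun Y hY => ⟨?_, fun ρ => ?_⟩⟩
  · exact MotivicSing.nonempty_resolution _ Y
  · exact MotivicSing.weakEquiv_mappingSpacePrecomp_of_resolution X hY ρ
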